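/- **Notation.** For $\lambda\in\mathbb R^n$ let $\sigma_k(\lambda)=\sum_{1\le i_1<\dots<i_k\le n}\lambda_{i_1}\cdots\lambda_{i_k}$ (so $\sigma_0=1$, and $\sigma_k=0$ for $k>n$), let $\Gamma_k=\{\lambda\in\mathbb R^n:\sigma_m(\lambda)>0,\ m=1,\dots,k\}$, and put $\sigma_k(D^2u)=\sigma_k(\lambda(D^2u))$, where $\lambda(D^2u)$ is the vector of eigenvalues of the Hessian $D^2u$. A function $v\in C^2(\Omega)$ is $k$-convex if $\lambda(D^2v(x))\in\Gamma_k$ for all $x\in\Omega$. **Theorem 1.1.** Let $\Omega\subset\mathbb R^n$ be a bounded domain, let $\alpha>0$, and let $f=f(x,z,p)\in C^{1,1}(\overline\Omega\times\mathbb R\times\mathbb R^n)$ be positive on $\overline\Omega\times\mathbb R\times\mathbb R^n$; here $C^{1,1}$ means that $f$ is continuous on $\overline\Omega\times\mathbb R\times\mathbb R^n$, is $C^1$ on $\Omega\times\mathbb R\times\mathbb R^n$, and has a first derivative that is Lipschitz on $\Omega\times B$ for every ball $B\subset\mathbb R\times\mathbb R^n$. For an integer $k\ge 2$ consider $(k-1)$-convex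 solutions $u\in C^4(\Omega)\cap C^{0,1}(\overline\Omega)$ of the Dirichlet problem $$\sigma_k(D^2u)+\alpha\,\sigma_{k-1}(D^2u)=f(x,u,Du)\ \text{ in }\Omega,\qquad u=0\ \text{ on }\partial\Omega .$$ Let $M_0,M_1\in\mathbb R$. (a) If $k=2$ or $k=3$, there are constants $\beta>0$ and $C>0$, depending only on $\Omega$, $\alpha$, $f$, $k$, $M_0$ and $M_1$, such that every such solution $u$ with $\sup_\Omega|u|\le M_0$ and $\sup_\Omega|Du|\le M_1$ satisfies $$(-u)^\beta\,\Delta u\le C\quad\text{in }\Omega .$$ (b) If $1<k\le n$ and $p\mapsto f^{1/k}(x,z,p)$ is convex on $\mathbb R^n$ for all $x\in\overline\Omega$ and $z\in\mathbb R$, then for every $\delta>0$ there is a constant $C>0$, depending only on $\Omega$, $\alpha$, $f$, $k$, $M_0$, $M_1$ and $\delta$, such that every such solution $u$ with $\sup_\Omega|u|\le M_0$ and $\sup_\Omega|Du|\le M_1$ satisfies $$(-u)^{1+\delta}\,\Delta u\le C\quad\text{in }\Omega .$$ -/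

import Mathlib

namespace SumHessian

open scoped NNReal ContDiff Laplacian

/-- The `k`-th elementary symmetric function of `l = (l₁, …, lₙ)`; `σ₀ = 1`, and `σ_k = 0` for
`k > n`. -/
def sigma {n : ℕ} (k : ℕ) (l : Fin n → ℝ) : ℝ :=
  ∑ s ∈ Finset.powersetCard k Finset.univ, ∏ i ∈ s, l i

/-- The Garding cone `Γ_k`. -/
def gardingCone (n k : ℕ) : Set (Fin n → ℝ) :=
  {l | ∀ m : ℕ, 1 ≤ m → m ≤ k → 0 < sigma m l}

/-- The Hessian matrix `D²u(x)` in the standard coordinates. -/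
noncomputable def hessian {n : ℕ} (u : EuclideanSpace ℝ (Fin n) → ℝ)
    (x : EuclideanSpace ℝ (Fin n)) : Matrix (Fin n) (Fin n) ℝ :=
  Matrix.of fun i j =>
    iteratedFDeriv ℝ 2 u x ![EuclideanSpace.single i 1, EuclideanSpace.single j 1]

theorem hessian_isHermitian {n : ℕ} {u : EuclideanSpace ℝ (Fin n) → ℝ}
    {x : EuclideanSpace ℝ (Fin n)} (hu : ContDiffAt ℝ 2 u x) : (hessian u x).IsHermitian := by
  have h := hu.isSymmSndFDerivAt (by simp)
  ext i j
  simp only [hessian, Matrix.conjTranspose_apply, Matrix.of_apply, star_trivial,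
    iteratedFDeriv_two_apply]
  exact h _ _

open Classical in
/-- The eigenvalues `λ(D²u(x)) = (λ₁, …, λₙ)` of the Hessian, with multiplicity.  Where `u` is `C²`
the Hessian is symmetric (`hessian_isHermitian`), so only the first branch matters. -/
noncomputable def hessianEigenvalues {n : ℕ} (u : EuclideanSpace ℝ (Fin n) → ℝ)
    (x : EuclideanSpace ℝ (Fin n)) : Fin n → ℝ :=
  if h : (hessian u x).IsHermitian then h.eigenvalues else 0

/-- `v ∈ C²(Ω)` is `k`-convex: the eigenvalues of its Hessian lie in `Γ_k` at every point. -/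
def IsKConvexOn {n : ℕ} (k : ℕ) (v : EuclideanSpace ℝ (Fin n) → ℝ)
    (Ω : Set (EuclideanSpace ℝ (Fin n))) : Prop :=
  ContDiffOn ℝ 2 v Ω ∧ ∀ x ∈ Ω, hessianEigenvalues v x ∈ gardingCone n k

/-- `f = f(x, z, p)` belongs to `C^{1,1}(Ω̄ × ℝ × ℝⁿ)` (the last two variables range over a
non-compact set, so the bounds are required for bounded `(z, p)`): `f` is continuous up to the
boundary, `C¹` inside, and its derivative is Lipschitz on `Ω × B` for every ball `B` of
`ℝ × ℝⁿ`; in particular the derivative is bounded there and extends continuously to `Ω̄ × B`. -/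
structure IsC11 {n : ℕ} (Ω : Set (EuclideanSpace ℝ (Fin n)))
    (f : EuclideanSpace ℝ (Fin n) × ℝ × EuclideanSpace ℝ (Fin n) → ℝ) : Prop where
  continuousOn : ContinuousOn f (closure Ω ×ˢ Set.univ)
  contDiffOn : ContDiffOn ℝ 1 f (Ω ×ˢ Set.univ)
  lipschitz_fderiv : ∀ R : ℝ, ∃ L : ℝ≥0,
    LipschitzOnWith L (fderiv ℝ f) (Ω ×ˢ Metric.closedBall 0 R)

/-- `u ∈ C⁴(Ω) ∩ C^{0,1}(Ω̄)` is a `(k-1)`-convex solution of the Dirichlet problem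
`σ_k(D²u) + α σ_{k-1}(D²u) = f(x, u, Du)` in `Ω`, `u = 0` on `∂Ω`. -/
structure IsDirichletSolution {n : ℕ} (k : ℕ) (α : ℝ)
    (f : EuclideanSpace ℝ (Fin n) × ℝ × EuclideanSpace ℝ (Fin n) → ℝ)
    (Ω : Set (EuclideanSpace ℝ (Fin n))) (u : EuclideanSpace ℝ (Fin n) → ℝ) : Prop where
  contDiffOn : ContDiffOn ℝ 4 u Ω
  lipschitz : ∃ K : ℝ≥0, LipschitzOnWith K u (closure Ω)
  convex : IsKConvexOn (k - 1) u Ω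
  equation : ∀ x ∈ Ω,
    sigma k (hessianEigenvalues u x) + α * sigma (k - 1) (hessianEigenvalues u x)
      = f (x, u x, gradient u x)
  boundary : ∀ x ∈ frontier Ω, u x = 0

end SumHessian

/-! The estimate is of Pogorelov type, and the structural point is that `σ_k(λ) + α σ_{k-1}(λ)` is
the single elementary symmetric function `σ_k(λ, α)` of `n + 1` entries (`esym_insertNone`). A
`(k-1)`-convex solution with `f > 0` has `(λ, α) ∈ Γ_k`, so the operator is elliptic and its `k`-th
root is concave. The cone facts rest on Newton's inequality; concavity comes from superadditivity of
the quotients `σ_{k+1} / σ_k` (`InCone.superadditive`, `InCone.concave`).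

Since `Δu > 0` and `u = 0` on the boundary, `u < 0` inside. For `e > 0` one maximises `log u_ξξ + β
log(-u - e) + N|Du|²/2 + m|x|²/2` over `{-u ≥ e}` and unit `ξ`; the bounds do not depend on `e`,
which finally tends to `0`. At the maximum, in an eigenbasis with largest eigenvalue `λ₁`, the
second order conditions are weighted by `F_i = ∂σ_k/∂λ_i` and combined with the equation
differentiated twice. Concavity absorbs the products `u_11i u_11j`-type diagonal terms, that is,
those in `∂₁u_ii`, and the off-diagonal part leaves a good term `(2/λ₁) Σ G_1i u_11i²`, where `G_1i
(λ₁ - λ_i) = F_i - F_1`.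

The remaining bad terms are `F_i (u_11i²/λ₁² + β u_i²/(-u-e)²)` (`third_order_sum_bound`). If
`|λ_i|` is small against `λ₁` and `F_1` small against `F_i`, the good term is almost `2 F_i
u_11i²/λ₁²`, while the first order condition makes the bad terms about `(1 + 1/β) F_i u_11i²/λ₁²`;
any `β > 1` then suffices. In the other directions `F_i λ₁²` is controlled by `F_i λ_i² + F_1 λ₁²`,
and the first order condition allows absorption into `N Σ F_i λ_i²` once `(-u-e) λ₁` is large.

There remain the good terms `N Σ F_i λ_i²` and `m Σ F_i`, against the second derivative of the
right-hand side divided by `λ₁`. For general `f` this costs `O(λ₁)`; when `k = 2, 3` the bound `Σ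
F_i ≥ c λ₁` (`opD_sum_ge`) pays for it with `m`, and then `β`, large. When `f^{1/k}` is convex in
`p`, its quadratic gain matches the concavity loss of the operator and the cost is `O(1)`; then `m =
0`, `β = 1 + δ` and `F_1 λ₁² ≥ c λ₁` suffice.

Two regularity issues shape the argument. Eigenvalues need not be differentiable, so symmetric
functions are recovered from the values of `det(1 + sH)`. And `f` is only `C^{1,1}`, so its second
derivatives are replaced by touching from below: the equation itself makes `f(x, u, Du)` twice
differentiable along lines, and `Jet2.le_of_eventually_le` compares second derivatives. -/

namespace SumHessian

/-! ### Elementary symmetric functions over a finite index set -/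

/-- The `k`-th elementary symmetric function of the entries of `l` indexed by `S`. -/
def esym {ι : Type*} (S : Finset ι) (k : ℕ) (l : ι → ℝ) : ℝ :=
  ∑ T ∈ S.powersetCard k, ∏ i ∈ T, l i

section esym

variable {ι : Type*}

@[simp] theorem esym_zero (S : Finset ι) (l : ι → ℝ) : esym S 0 l = 1 := by
  simp [esym]

theorem esym_eq_zero_of_card_lt {S : Finset ι} {k : ℕ} (h : S.card < k) (l : ι → ℝ) :
    esym S k l = 0 := by
  simp [esym, Finset.powersetCard_eq_empty.2 h]

theorem esym_one (S : Finset ι) (l : ι → ℝ) : esym S 1 l = ∑ i ∈ S, l i := by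
  simp [esym, Finset.powersetCard_one]

theorem esym_empty_succ (k : ℕ) (l : ι → ℝ) : esym (∅ : Finset ι) (k + 1) l = 0 :=
  esym_eq_zero_of_card_lt (by simp) l

variable [DecidableEq ι]

theorem esym_insert {S : Finset ι} {i : ι} (hi : i ∉ S) (k : ℕ) (l : ι → ℝ) :
    esym (insert i S) (k + 1) l = esym S (k + 1) l + l i * esym S k l := by
  unfold esym
  rw [Finset.powersetCard_succ_insert hi, Finset.sum_union, Finset.sum_image, Finset.mul_sum]
  · congr 1
    refine Finset.sum_congr rfl fun T hT => ?_
    rw [Finset.prod_insert]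
    exact fun h => hi ((Finset.mem_powersetCard.1 hT).1 h)
  · intro T hT T' hT' h
    have h1 : i ∉ T := fun h => hi ((Finset.mem_powersetCard.1 hT).1 h)
    have h2 : i ∉ T' := fun h => hi ((Finset.mem_powersetCard.1 hT').1 h)
    rw [← Finset.erase_insert h1, h, Finset.erase_insert h2]
  · rw [Finset.disjoint_left]
    intro T hT hT'
    obtain ⟨T', -, rfl⟩ := Finset.mem_image.1 hT'
    exact hi ((Finset.mem_powersetCard.1 hT).1 (Finset.mem_insert_self _ _))

theorem esym_erase {S : Finset ι} {i : ι} (hi : i ∈ S) (k : ℕ) (l : ι → ℝ) :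
    esym S (k + 1) l = esym (S.erase i) (k + 1) l + l i * esym (S.erase i) k l := by
  conv_lhs => rw [← Finset.insert_erase hi]
  exact esym_insert (Finset.notMem_erase i S) k l

-- This generating function transfers real-rootedness to symmetric functions; putting the entries in
-- the slopes rather than the roots lets them vanish.
open Polynomial in
theorem coeff_prod_one_add (S : Finset ι) (l : ι → ℝ) (k : ℕ) :
    (∏ i ∈ S, (1 + X * C (l i))).coeff k = esym S k l := by
  induction S using Finset.induction_on generalizing k with
  | empty => cases k <;> simp [esym_empty_succ, coeff_one]
  | insert i S hi ih =>
    rw [Finset.prod_insert hi, add_mul, one_mul, coeff_add, ih]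
    cases k with
    | zero => simp [mul_assoc]
    | succ k => rw [esym_insert hi, mul_assoc, coeff_X_mul, coeff_C_mul, ih]

/-- Removing each index in turn: `∑ᵢ σ_{k;i} = (|S| - k) σ_k`. -/
theorem sum_esym_erase (S : Finset ι) (k : ℕ) (l : ι → ℝ) :
    ∑ i ∈ S, esym (S.erase i) k l = ((S.card : ℝ) - k) * esym S k l := by
  induction S using Finset.induction_on generalizing k with
  | empty => cases k <;> simp [esym_empty_succ]
  | insert j S hj ih =>
    have key : ∀ i ∈ S, (insert j S).erase i = insert j (S.erase i) := fun i hi => by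
      rw [Finset.erase_insert_of_ne]; rintro rfl; exact hj hi
    have hj' : ∀ i, j ∉ S.erase i := fun i h => hj (Finset.mem_of_mem_erase h)
    rw [Finset.sum_insert hj, Finset.erase_insert hj, Finset.card_insert_of_notMem hj]
    cases k with
    | zero =>
      simp only [esym_zero, Finset.sum_const, nsmul_eq_mul]
      push_cast; ring
    | succ k =>
      rw [Finset.sum_congr rfl fun i hi => by rw [key i hi, esym_insert (hj' i)],
        Finset.sum_add_distrib, ← Finset.mul_sum, ih, ih, esym_insert hj]
      push_cast; ring

/-- Euler's identity `∑ᵢ lᵢ σ_{k;i} = (k+1) σ_{k+1}`. -/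
theorem sum_mul_esym_erase (S : Finset ι) (k : ℕ) (l : ι → ℝ) :
    ∑ i ∈ S, l i * esym (S.erase i) k l = (k + 1) * esym S (k + 1) l := by
  have h : ∀ i ∈ S, l i * esym (S.erase i) k l
      = esym S (k + 1) l - esym (S.erase i) (k + 1) l := fun i hi => by
    rw [esym_erase hi]; ring
  rw [Finset.sum_congr rfl h, Finset.sum_sub_distrib, sum_esym_erase]
  simp only [Finset.sum_const, nsmul_eq_mul]
  push_cast; ring

end esym

/-! ### Newton's inequality -/

section newton

open Polynomial

/-- Rolle's theorem with multiplicities: differentiation loses at most one root, and exactly one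
degree. -/
theorem splits_derivative {p : ℝ[X]} (hp : p.Splits) : (derivative p).Splits := by
  rw [splits_iff_card_roots] at hp ⊢
  have h1 := card_roots_le_derivative p
  have h2 := card_roots' (derivative p)
  have h3 := natDegree_derivative_le p
  rcases Nat.eq_zero_or_pos p.natDegree with h | h
  · rw [natDegree_eq_zero] at h
    obtain ⟨c, rfl⟩ := h
    simp
  · omega

theorem splits_iterate_derivative {p : ℝ[X]} (hp : p.Splits) (k : ℕ) :
    (derivative^[k] p).Splits := by
  induction k with
  | zero => exact hp
  | succ k ih => rw [Function.iterate_succ_apply']; exact splits_derivative ih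

/-- Laguerre's inequality for a real-rooted polynomial. -/
theorem laguerre {p : ℝ[X]} (hp : p.Splits) (x : ℝ) :
    p.eval x * (derivative (derivative p)).eval x ≤ (derivative p).eval x ^ 2 := by
  have key : ∀ s : Multiset ℝ, (s.map (X - C ·)).prod.eval x
      * (derivative (derivative (s.map (X - C ·)).prod)).eval x
      ≤ (derivative (s.map (X - C ·)).prod).eval x ^ 2 := by
    intro s
    induction s using Multiset.induction_on with
    | empty => simp
    | cons a s ih =>
      simp only [Multiset.map_cons, Multiset.prod_cons, derivative_mul, derivative_sub,
        derivative_X, derivative_C, derivative_add, eval_add, eval_mul, eval_sub, eval_X, eval_C,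
        sub_zero, one_mul] at ih ⊢
      set P := (s.map (X - C ·)).prod.eval x
      -- For `p = (x - a) P` one has `p'² - p p'' = P² + (x - a)² (P'² - P P'')`.
      nlinarith [mul_le_mul_of_nonneg_left ih (sq_nonneg (x - a)), sq_nonneg P]
  rw [hp.eq_prod_roots]
  simp only [derivative_C_mul, eval_mul, eval_C]
  nlinarith [mul_le_mul_of_nonneg_left (key p.roots) (sq_nonneg p.leadingCoeff)]

theorem splits_prod_one_add {ι : Type*} (S : Finset ι) (l : ι → ℝ) :
    (∏ i ∈ S, (1 + X * C (l i))).Splits := by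
  refine Splits.prod fun i _ => ?_
  refine Splits.of_natDegree_le_one ?_
  refine (natDegree_add_le _ _).trans ?_
  simp only [natDegree_one, zero_le, sup_of_le_right]
  exact (natDegree_mul_le).trans (by simp [natDegree_X])

/-- Newton's inequality, in a weak form. -/
theorem newton {ι : Type*} [DecidableEq ι] (S : Finset ι) (k : ℕ) (l : ι → ℝ) :
    esym S k l * esym S (k + 2) l ≤ esym S (k + 1) l ^ 2 := by
  -- Up to factorials, the values at `0` of the `k`-th, `(k+1)`-st and `(k+2)`-nd derivatives are
  -- `σ_k`, `σ_{k+1}` and `σ_{k+2}`.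
  have h := laguerre (splits_iterate_derivative (splits_prod_one_add S l) k) 0
  rw [← Function.iterate_succ_apply' derivative, ← Function.iterate_succ_apply' derivative] at h
  simp only [← coeff_zero_eq_eval_zero, coeff_iterate_derivative, coeff_prod_one_add, zero_add,
    Nat.descFactorial_self, nsmul_eq_mul, Nat.factorial_succ, Nat.succ_eq_add_one] at h
  push_cast at h
  have hf : (0 : ℝ) < (k.factorial : ℝ) ^ 2 := by positivity
  have h2 : (k + 2 : ℝ) * (esym S k l * esym S (k + 2) l) ≤ (k + 1) * esym S (k + 1) l ^ 2 := by
    have h1 : 0 < (k.factorial : ℝ) ^ 2 * (k + 1) := by positivity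
    refine le_of_mul_le_mul_left ?_ h1
    ring_nf at h ⊢
    linarith
  rcases le_or_gt (esym S k l * esym S (k + 2) l) 0 with h0 | h0
  · exact h0.trans (sq_nonneg _)
  · have : (0 : ℝ) ≤ k := Nat.cast_nonneg k
    nlinarith

end newton

/-! ### The Gårding cone -/

/-- The Gårding cone `Γ_k` for the entries indexed by `S`. -/
def InCone {ι : Type*} (S : Finset ι) (k : ℕ) (l : ι → ℝ) : Prop :=
  ∀ m ≤ k, 0 < esym S m l

section cone

variable {ι : Type*}

theorem InCone.mono {S : Finset ι} {k m : ℕ} {l : ι → ℝ} (h : InCone S k l) (hm : m ≤ k) :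
    InCone S m l := fun j hj => h j (hj.trans hm)

variable [DecidableEq ι]

/-- Suppose `b = σ_{k+1;i} ≤ 0` while `a = σ_{k;i} > 0`. Positivity of `σ_{k+1} = b + lᵢ a` forces
`lᵢ a > -b ≥ 0`, and positivity of `σ_{k+2} = c + lᵢ b` then gives `a c > -lᵢ a b ≥ b²`, against
Newton. This is the ellipticity of `σ_k` on `Γ_k`. -/
theorem InCone.erase {S : Finset ι} {k : ℕ} {l : ι → ℝ} (h : InCone S (k + 1) l) {i : ι}
    (hi : i ∈ S) : InCone (S.erase i) k l := by
  induction k with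
  | zero => intro m hm; obtain rfl : m = 0 := by omega
            simp
  | succ k ih =>
    have ih := ih (h.mono (by omega))
    intro m hm
    rcases Nat.lt_or_ge m (k + 1) with hm' | hm'
    · exact ih m (by omega)
    obtain rfl : m = k + 1 := by omega
    have h1 := h (k + 2) le_rfl
    have h2 := h (k + 1) (by omega)
    rw [esym_erase hi] at h1 h2
    have h3 := ih k le_rfl
    have h4 := newton (S.erase i) k l
    by_contra! h5
    set a := esym (S.erase i) k l
    set b := esym (S.erase i) (k + 1) l
    set c := esym (S.erase i) (k + 2) l
    have h6 : 0 < l i := by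
      by_contra! h7
      nlinarith
    nlinarith [mul_pos h1 h3]

theorem InCone.le_esym_one {S : Finset ι} {k : ℕ} {l : ι → ℝ} (h : InCone S (k + 2) l) {i : ι}
    (hi : i ∈ S) : l i < esym S 1 l := by
  have h1 := h.erase hi 1 (by omega)
  have := esym_erase hi 0 l
  simp only [zero_add, esym_zero, mul_one] at this
  linarith

/-- If `lᵢ` is the largest entry then `lᵢ σ_{k;i} ≥ ((k+1)/|S|) σ_{k+1}`. -/
theorem InCone.mul_esym_erase_ge {S : Finset ι} {k : ℕ} {l : ι → ℝ} (h : InCone S (k + 1) l)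
    {i : ι} (hi : i ∈ S) (hmax : ∀ j ∈ S, l j ≤ l i) :
    (k + 1) * esym S (k + 1) l ≤ S.card * (l i * esym (S.erase i) k l) := by
  have hcard : (k : ℝ) + 1 ≤ S.card := by
    by_contra! hc
    have : S.card < k + 1 := by exact_mod_cast hc
    exact (h (k + 1) le_rfl).ne' (esym_eq_zero_of_card_lt this l)
  have h0 := h (k + 1) le_rfl
  have h1 := esym_erase hi k l
  have hk : (0 : ℝ) ≤ k := Nat.cast_nonneg k
  -- If `σ_{k+1;i} ≤ 0`, then already `lᵢ σ_{k;i} ≥ σ_{k+1}`. Otherwise the remaining entries lie in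
  -- `Γ_{k+1}`, and in Euler's identity for `σ_{k+1;i}` each `l_j` may be replaced by `lᵢ`.
  rcases le_or_gt (esym (S.erase i) (k + 1) l) 0 with hn | hp
  · nlinarith
  · have hc : InCone (S.erase i) (k + 1) l := by
      intro m hm
      rcases Nat.lt_or_ge m (k + 1) with hm' | hm'
      · exact h.erase hi m (by omega)
      · obtain rfl : m = k + 1 := by omega
        exact hp
    have h2 := sum_mul_esym_erase (S.erase i) k l
    have h3 := sum_esym_erase (S.erase i) k l
    have h4 : ∑ j ∈ S.erase i, l j * esym ((S.erase i).erase j) k l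
        ≤ ∑ j ∈ S.erase i, l i * esym ((S.erase i).erase j) k l :=
      Finset.sum_le_sum fun j hj => mul_le_mul_of_nonneg_right
        (hmax j (Finset.mem_of_mem_erase hj)) (hc.erase hj k le_rfl).le
    rw [← Finset.mul_sum, h2, h3, Finset.card_erase_of_mem hi,
      Nat.cast_sub (Finset.card_pos.2 ⟨i, hi⟩)] at h4
    push_cast at h4
    rw [h1]
    nlinarith

end cone

end SumHessian

namespace SumHessian
open Filter Topology

/-! ### Second order jets of functions of one real variable -/

/-- `f` is twice differentiable at `0`, with value `c`, first derivative `a` and second derivative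
`b` there. -/
def Jet2 (f : ℝ → ℝ) (c a b : ℝ) : Prop :=
  f 0 = c ∧ ∃ g : ℝ → ℝ, (∀ᶠ t in 𝓝 0, HasDerivAt f (g t) t) ∧ g 0 = a ∧ HasDerivAt g b 0

namespace Jet2

variable {f g : ℝ → ℝ} {c a b c' a' b' : ℝ}

theorem hasDerivAt (h : Jet2 f c a b) : HasDerivAt f a 0 := by
  obtain ⟨-, f', h1, rfl, -⟩ := h
  exact h1.self_of_nhds

theorem continuousAt (h : Jet2 f c a b) : ContinuousAt f 0 := h.hasDerivAt.continuousAt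

theorem congr (h : Jet2 f c a b) (hfg : f =ᶠ[𝓝 0] g) : Jet2 g c a b := by
  obtain ⟨h0, f', h1, h2, h3⟩ := h
  refine ⟨hfg.self_of_nhds ▸ h0, f', ?_, h2, h3⟩
  filter_upwards [h1, eventually_eventually_nhds.2 hfg] with t ht ht'
  exact ht.congr_of_eventuallyEq (EventuallyEq.symm ht')

theorem cast (h : Jet2 f c a b) (hc : c = c') (ha : a = a') (hb : b = b') :
    Jet2 f c' a' b' := by
  subst hc ha hb; exact h

theorem unique (h : Jet2 f c a b) (h' : Jet2 f c' a' b') : c = c' ∧ a = a' ∧ b = b' := by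
  obtain ⟨h0, f', h1, h2, h3⟩ := h
  obtain ⟨k0, g', k1, k2, k3⟩ := h'
  have e : f' =ᶠ[𝓝 0] g' := by
    filter_upwards [h1, k1] with t ht kt using ht.unique kt
  refine ⟨h0.symm.trans k0, ?_, ?_⟩
  · rw [← h2, ← k2]; exact e.self_of_nhds
  · exact h3.unique (k3.congr_of_eventuallyEq e)

theorem affine (p q : ℝ) : Jet2 (fun t => p + q * t) p q 0 := by
  refine ⟨by simp, fun _ => q, .of_forall fun t => ?_, rfl, hasDerivAt_const _ _⟩
  simpa using ((hasDerivAt_id t).const_mul q).const_add p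

theorem const (p : ℝ) : Jet2 (fun _ => p) p 0 0 := by
  simpa using affine p 0

theorem add (h : Jet2 f c a b) (h' : Jet2 g c' a' b') :
    Jet2 (fun t => f t + g t) (c + c') (a + a') (b + b') := by
  obtain ⟨h0, f', h1, h2, h3⟩ := h
  obtain ⟨k0, g', k1, k2, k3⟩ := h'
  refine ⟨by simp only [h0, k0], fun t => f' t + g' t, ?_, by simp only [h2, k2], h3.add k3⟩
  filter_upwards [h1, k1] with t ht kt using ht.add kt

theorem mul (h : Jet2 f c a b) (h' : Jet2 g c' a' b') :
    Jet2 (fun t => f t * g t) (c * c') (a * c' + c * a') (b * c' + 2 * (a * a') + c * b') := by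
  have hf := h.hasDerivAt
  have hg := h'.hasDerivAt
  obtain ⟨h0, f', h1, h2, h3⟩ := h
  obtain ⟨k0, g', k1, k2, k3⟩ := h'
  refine ⟨by simp only [h0, k0], fun t => f' t * g t + f t * g' t, ?_, by simp only [h0, h2, k0, k2], ?_⟩
  · filter_upwards [h1, k1] with t ht kt using ht.mul kt
  · refine ((h3.mul hg).add (hf.mul k3)).congr_deriv ?_
    rw [h0, k0, h2, k2]; ring

theorem const_mul (h : Jet2 f c a b) (p : ℝ) :
    Jet2 (fun t => p * f t) (p * c) (p * a) (p * b) :=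
  ((const p).mul h).cast rfl (by ring) (by ring)

theorem neg (h : Jet2 f c a b) : Jet2 (fun t => -f t) (-c) (-a) (-b) := by
  simpa using h.const_mul (-1)

theorem sub (h : Jet2 f c a b) (h' : Jet2 g c' a' b') :
    Jet2 (fun t => f t - g t) (c - c') (a - a') (b - b') := by
  simpa only [sub_eq_add_neg] using h.add h'.neg

theorem sum {ι : Type*} (S : Finset ι) {f : ι → ℝ → ℝ} {c a b : ι → ℝ}
    (h : ∀ i ∈ S, Jet2 (f i) (c i) (a i) (b i)) :
    Jet2 (fun t => ∑ i ∈ S, f i t) (∑ i ∈ S, c i) (∑ i ∈ S, a i) (∑ i ∈ S, b i) := by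
  classical
  induction S using Finset.induction_on with
  | empty => simpa using const 0
  | insert i S hi ih =>
    simp only [Finset.sum_insert hi]
    exact (h i (Finset.mem_insert_self _ _)).add
      (ih fun j hj => h j (Finset.mem_insert_of_mem hj))

/-- The second order Leibniz rule, written with erased products so that factors may vanish. -/
theorem prod {ι : Type*} [DecidableEq ι] (S : Finset ι) {f : ι → ℝ → ℝ} {c a b : ι → ℝ}
    (h : ∀ i ∈ S, Jet2 (f i) (c i) (a i) (b i)) :
    Jet2 (fun t => ∏ i ∈ S, f i t) (∏ i ∈ S, c i) (∑ i ∈ S, a i * ∏ j ∈ S.erase i, c j)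
      (∑ i ∈ S, (b i * ∏ j ∈ S.erase i, c j +
        ∑ j ∈ S.erase i, a i * a j * ∏ l ∈ (S.erase i).erase j, c l)) := by
  induction S using Finset.induction_on with
  | empty => simpa using const 1
  | insert i S hi ih =>
    have hne : ∀ j ∈ S, i ≠ j := by rintro j hj rfl; exact hi hj
    have e1 : ∀ j ∈ S, (insert i S).erase j = insert i (S.erase j) := fun j hj =>
      Finset.erase_insert_of_ne (hne j hj)
    have n1 : ∀ j, i ∉ S.erase j := fun j hj => hi (Finset.mem_of_mem_erase hj)
    have e2 : ∀ j ∈ S, ∀ l ∈ S.erase j, ∏ m ∈ ((insert i S).erase j).erase l, c m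
        = c i * ∏ m ∈ (S.erase j).erase l, c m := fun j hj l hl => by
      rw [e1 j hj, Finset.erase_insert_of_ne (hne l (Finset.mem_of_mem_erase hl)),
        Finset.prod_insert fun hm => n1 j (Finset.mem_of_mem_erase hm)]
    simp only [Finset.prod_insert hi]
    refine ((h i (Finset.mem_insert_self _ _)).mul
      (ih fun j hj => h j (Finset.mem_insert_of_mem hj))).cast rfl ?_ ?_
    · rw [Finset.sum_insert hi, Finset.erase_insert hi, Finset.mul_sum]
      congr 1
      refine Finset.sum_congr rfl fun j hj => ?_
      rw [e1 j hj, Finset.prod_insert (n1 j)]; ring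
    · rw [Finset.sum_insert hi, Finset.erase_insert hi, Finset.mul_sum, Finset.mul_sum,
        Finset.mul_sum]
      have e3 : ∀ j ∈ S, b j * ∏ l ∈ (insert i S).erase j, c l + ∑ l ∈ (insert i S).erase j,
          a j * a l * ∏ m ∈ ((insert i S).erase j).erase l, c m
          = a i * a j * (∏ m ∈ S.erase j, c m) + c i * (b j * ∏ l ∈ S.erase j, c l +
            ∑ l ∈ S.erase j, a j * a l * ∏ m ∈ (S.erase j).erase l, c m) := fun j hj => by
        rw [Finset.sum_congr (e1 j hj) fun _ _ => rfl, Finset.sum_insert (n1 j), mul_add,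
          Finset.mul_sum, Finset.sum_congr rfl fun l hl => by rw [e2 j hj l hl], e1 j hj,
          Finset.prod_insert (n1 j), Finset.erase_insert (n1 j)]
        have : ∀ l ∈ S.erase j, a j * a l * (c i * ∏ m ∈ (S.erase j).erase l, c m)
          = c i * (a j * a l * ∏ m ∈ (S.erase j).erase l, c m) := fun l _ => by ring
        rw [Finset.sum_congr rfl this]; ring
      rw [Finset.sum_congr rfl e3, Finset.sum_add_distrib]
      have e4 : ∀ j ∈ S, 2 * (a i * (a j * ∏ m ∈ S.erase j, c m))
        = a i * a j * (∏ m ∈ S.erase j, c m) + a i * a j * ∏ m ∈ S.erase j, c m :=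
        fun j _ => by ring
      rw [Finset.sum_congr rfl e4, Finset.sum_add_distrib]
      ring

theorem inv (h : Jet2 f c a b) (hc : c ≠ 0) :
    Jet2 (fun t => (f t)⁻¹) c⁻¹ (-a / c ^ 2) (-b / c ^ 2 + 2 * a ^ 2 / c ^ 3) := by
  have hf := h.hasDerivAt
  obtain ⟨h0, f', h1, h2, h3⟩ := h
  have hne : f 0 ≠ 0 := by rwa [h0]
  refine ⟨by simp only [h0], fun t => -f' t / f t ^ 2, ?_, by simp only [h0, h2], ?_⟩
  · filter_upwards [h1, hf.continuousAt.eventually_ne hne] with t ht ht' using ht.inv ht'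
  · refine ((h3.neg).div (hf.pow 2) (pow_ne_zero 2 hne)).congr_deriv ?_
    simp only [Pi.pow_apply, Pi.neg_apply, h0, h2]
    field_simp
    ring

theorem log (h : Jet2 f c a b) (hc : c ≠ 0) :
    Jet2 (fun t => Real.log (f t)) (Real.log c) (a / c) (b / c - a ^ 2 / c ^ 2) := by
  have hf := h.hasDerivAt
  obtain ⟨h0, f', h1, h2, h3⟩ := h
  have hne : f 0 ≠ 0 := by rwa [h0]
  refine ⟨by simp only [h0], fun t => f' t / f t, ?_, by simp only [h0, h2], ?_⟩
  · filter_upwards [h1, hf.continuousAt.eventually_ne hne] with t ht ht' using ht.log ht'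
  · refine (h3.div hf hne).congr_deriv ?_
    rw [h0, h2]
    field_simp

/-- The second derivative test at a local minimum. -/
theorem of_isLocalMin (h : Jet2 f c a b) (hm : IsLocalMin f 0) : a = 0 ∧ 0 ≤ b := by
  have ha : a = 0 := hm.hasDerivAt_eq_zero h.hasDerivAt
  refine ⟨ha, ?_⟩
  have hf := h.continuousAt
  by_contra! hb
  obtain ⟨h0, f', h1, h2, h3⟩ := h
  have hd : deriv f =ᶠ[𝓝 0] f' := by filter_upwards [h1] with t ht using ht.deriv
  -- With `b < 0` the point would be a local maximum too, so `f` would be locally constant and `b =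
  -- 0`.
  have hmax : IsLocalMax f 0 := by
    refine isLocalMax_of_deriv_deriv_neg ?_ ?_ hf
    · rw [hd.deriv_eq, h3.deriv]; exact hb
    · rw [hd.self_of_nhds, h2, ha]
  have hc : f =ᶠ[𝓝 0] fun _ => c := by
    filter_upwards [hm, hmax] with t ht ht'
    rw [← h0]; exact le_antisymm ht' ht
  have := (Jet2.congr ⟨h0, f', h1, h2, h3⟩ hc).unique (const c)
  linarith [this.2.2]

theorem of_isLocalMax (h : Jet2 f c a b) (hm : IsLocalMax f 0) : a = 0 ∧ b ≤ 0 := by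
  obtain ⟨h1, h2⟩ := h.neg.of_isLocalMin hm.neg
  exact ⟨by linarith, by linarith⟩

/-- Comparison of second derivatives for functions touching at `0`. -/
theorem le_of_eventually_le (hf : Jet2 f c a b) (hg : Jet2 g c a' b') {r : ℝ → ℝ} {r₀ : ℝ}
    (hr : Tendsto r (𝓝[≠] 0) (𝓝 r₀)) (h : ∀ᶠ t in 𝓝[≠] 0, g t - r t * t ^ 2 ≤ f t) :
    b' - 2 * r₀ ≤ b := by
  refine le_of_forall_pos_le_add fun e he => ?_
  -- Adding `(r₀ + e/2) t²` to the difference outweighs the error `r t²` near `0` and creates a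
  -- local minimum.
  have hq : Jet2 (fun t => (r₀ + e / 2) * (t * t)) 0 0 ((r₀ + e / 2) * 2) := by
    have := ((affine 0 1).mul (affine 0 1)).const_mul (r₀ + e / 2)
    simp only [zero_add, one_mul] at this
    exact this.cast (by ring) (by ring) (by ring)
  have h1 := (hf.sub hg).add hq
  have hm : IsLocalMin (fun t => f t - g t + (r₀ + e / 2) * (t * t)) 0 := by
    have h2 : ∀ᶠ t in 𝓝[≠] (0 : ℝ), 0 ≤ f t - g t + (r₀ + e / 2) * (t * t) := by
      filter_upwards [h, hr.eventually (eventually_lt_nhds (show r₀ < r₀ + e / 2 by linarith))]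
        with t ht ht'
      nlinarith [sq_nonneg t]
    have h3 : ∀ᶠ t in 𝓝 (0 : ℝ), t ≠ 0 → 0 ≤ f t - g t + (r₀ + e / 2) * (t * t) :=
      eventually_nhdsWithin_iff.1 h2
    filter_upwards [h3] with t ht
    rcases eq_or_ne t 0 with rfl | h0
    · exact le_rfl
    · simp only [hf.1, hg.1, mul_zero, sub_self, add_zero]
      exact ht h0
  have := (h1.of_isLocalMin hm).2
  linarith

/-- The second derivative of a concave function is nonpositive. -/
theorem nonpos_of_midpoint (hf : Jet2 f c a b) (h : ∀ᶠ t in 𝓝 0, f t + f (-t) ≤ 2 * f 0) :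
    b ≤ 0 := by
  have h' : Jet2 (fun t => f (-t)) c (-a) b := by
    obtain ⟨h0, f', h1, h2, h3⟩ := hf
    have htend : Tendsto (fun t : ℝ => -t) (𝓝 0) (𝓝 0) := by
      simpa using (continuous_neg (G := ℝ)).tendsto 0
    refine ⟨by simpa using h0, fun t => -f' (-t), ?_, by simp [h2], ?_⟩
    · filter_upwards [htend.eventually h1] with t ht
      exact (ht.scomp t (hasDerivAt_neg t)).congr_deriv (by simp)
    · have h3' : HasDerivAt f' b (-0) := by simpa using h3
      exact (h3'.scomp 0 (hasDerivAt_neg 0)).neg.congr_deriv (by simp)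
  have hm : IsLocalMax (fun t => f t + f (-t)) 0 := by
    filter_upwards [h] with t ht
    simp only [neg_zero]; linarith
  have := ((hf.add h').of_isLocalMax hm).2
  linarith

end Jet2

end SumHessian

namespace SumHessian
open Filter Topology

/-! ### Concavity of the quotients `σ_{k+1} / σ_k` and of `σ_k ^ (1 / k)` -/

/-- The function `x y / (x + y)` is concave and homogeneous of degree one on `x + y > 0`, hence
superadditive, and it is nondecreasing in `y`. -/
theorem mul_div_add_superadditive {x y x' y' z : ℝ} (h : 0 < x + y) (h' : 0 < x' + y')
    (hz : y + y' ≤ z) :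
    x * y / (x + y) + x' * y' / (x' + y') ≤ (x + x') * z / (x + x' + z) := by
  have hpos : 0 < x + x' + z := by linarith
  rw [div_add_div _ _ h.ne' h'.ne', div_le_div_iff₀ (mul_pos h h') hpos]
  nlinarith [mul_nonneg (mul_pos h h').le (mul_nonneg (sq_nonneg (x + x')) (sub_nonneg.2 hz)),
    sq_nonneg (x * y' - x' * y), mul_nonneg (sub_nonneg.2 hz) (sq_nonneg (x * y' - x' * y)),
    mul_nonneg (sub_nonneg.2 hz) (sq_nonneg (x * (x' + y') + x' * (x + y))),
    mul_nonneg (sub_nonneg.2 hz) (sq_nonneg (x * (x' + y') - x' * (x + y)))]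

section
variable {ι : Type*}

theorem esym_const_mul (S : Finset ι) (k : ℕ) (c : ℝ) (l : ι → ℝ) :
    esym S k (fun i => c * l i) = c ^ k * esym S k l := by
  unfold esym
  rw [Finset.mul_sum]
  refine Finset.sum_congr rfl fun T hT => ?_
  rw [Finset.prod_mul_distrib, Finset.prod_const, (Finset.mem_powersetCard.1 hT).2]

theorem jet2_esym_one (S : Finset ι) (l w : ι → ℝ) :
    Jet2 (fun t => esym S 1 (fun i => l i + w i * t)) (esym S 1 l) (∑ i ∈ S, w i) 0 := by
  simp only [esym_one, Finset.sum_add_distrib, ← Finset.sum_mul]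
  exact Jet2.affine _ _

variable [DecidableEq ι]

/-- Being homogeneous of degree one, the quotient is concave exactly when it is superadditive.
Convexity of the cone is proved in the same induction, since positivity of the next quotient of a
sum follows from superadditivity. -/
theorem InCone.superadditive (k : ℕ) (S : Finset ι) {l m : ι → ℝ} (hl : InCone S k l)
    (hm : InCone S k m) :
    InCone S k (fun i => l i + m i) ∧
      esym S (k + 1) l / esym S k l + esym S (k + 1) m / esym S k m
        ≤ esym S (k + 1) (fun i => l i + m i) / esym S k (fun i => l i + m i) := by
  induction k generalizing S with
  | zero =>
    refine ⟨fun j hj => ?_, ?_⟩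
    · obtain rfl : j = 0 := by omega
      simp
    · simp [esym_one, Finset.sum_add_distrib]
  | succ k ih =>
    obtain ⟨c1, c2⟩ := ih S (hl.mono (by omega)) (hm.mono (by omega))
    have hlm : InCone S (k + 1) (fun i => l i + m i) := by
      intro j hj
      rcases Nat.lt_or_ge j (k + 1) with hj' | hj'
      · exact c1 j (by omega)
      obtain rfl : j = k + 1 := by omega
      have h1 := div_pos (hl (k + 1) le_rfl) (hl k (by omega))
      have h2 := div_pos (hm (k + 1) le_rfl) (hm k (by omega))
      have h3 := c1 k le_rfl
      have h4 : 0 < esym S (k + 1) (fun i => l i + m i) / esym S k (fun i => l i + m i) := by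
        linarith
      exact (div_pos_iff_of_pos_right h3).1 h4
    refine ⟨hlm, ?_⟩
    -- With `qᵢ = σ_{k+1;i} / σ_{k;i}`, one has `pᵢ + qᵢ = σ_{k+1} / σ_{k;i}`. Euler's identity thus
    -- writes the quotient through the lower quotients `qᵢ`, to which the induction hypothesis
    -- applies.
    have key : ∀ p : ι → ℝ, InCone S (k + 1) p →
        ((k + 1 : ℕ) + 1 : ℝ) * (esym S (k + 1 + 1) p / esym S (k + 1) p)
          = ∑ i ∈ S, p i * (esym (S.erase i) (k + 1) p / esym (S.erase i) k p) /
            (p i + esym (S.erase i) (k + 1) p / esym (S.erase i) k p) ∧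
        ∀ i ∈ S, 0 < p i + esym (S.erase i) (k + 1) p / esym (S.erase i) k p := by
      intro p hp
      have hi0 : ∀ i ∈ S, 0 < esym (S.erase i) k p := fun i hi => hp.erase hi k le_rfl
      have hs : ∀ i ∈ S, p i + esym (S.erase i) (k + 1) p / esym (S.erase i) k p
          = esym S (k + 1) p / esym (S.erase i) k p := fun i hi => by
        rw [esym_erase hi k, eq_div_iff (hi0 i hi).ne', add_mul,
          div_mul_cancel₀ _ (hi0 i hi).ne']; ring
      refine ⟨?_, fun i hi => ?_⟩
      · rw [← mul_div_assoc, ← sum_mul_esym_erase, Finset.sum_div]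
        refine Finset.sum_congr rfl fun i hi => ?_
        rw [hs i hi]
        have h1 := (hi0 i hi).ne'
        have h2 := (hp (k + 1) le_rfl).ne'
        field_simp
      · rw [hs i hi]; exact div_pos (hp _ le_rfl) (hi0 i hi)
    obtain ⟨l1, l2⟩ := key l hl
    obtain ⟨m1, m2⟩ := key m hm
    obtain ⟨s1, -⟩ := key _ hlm
    have hk : (0 : ℝ) < (k + 1 : ℕ) + 1 := by positivity
    refine le_of_mul_le_mul_left ?_ hk
    rw [mul_add, l1, m1, s1, ← Finset.sum_add_distrib]
    exact Finset.sum_le_sum fun i hi => mul_div_add_superadditive (l2 i hi) (m2 i hi)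
      (ih (S.erase i) (hl.erase hi) (hm.erase hi)).2

theorem hasDerivAt_esym (S : Finset ι) (k : ℕ) (l w : ι → ℝ) (t : ℝ) :
    HasDerivAt (fun t => esym S (k + 1) (fun i => l i + w i * t))
      (∑ i ∈ S, w i * esym (S.erase i) k (fun i => l i + w i * t)) t := by
  induction S using Finset.induction_on generalizing k with
  | empty => simpa [esym_empty_succ] using hasDerivAt_const t (0 : ℝ)
  | insert i S hi ih =>
    have e1 : ∀ j ∈ S, (insert i S).erase j = insert i (S.erase j) := fun j hj => by
      rw [Finset.erase_insert_of_ne]; rintro rfl; exact hi hj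
    have n1 : ∀ j, i ∉ S.erase j := fun j hj => hi (Finset.mem_of_mem_erase hj)
    have hw : HasDerivAt (fun t => l i + w i * t) (w i) t := by
      simpa using ((hasDerivAt_id t).const_mul (w i)).const_add (l i)
    simp only [esym_insert hi]
    rw [Finset.sum_insert hi, Finset.erase_insert hi]
    cases k with
    | zero =>
      simp only [esym_zero, mul_one] at ih ⊢
      exact ((ih 0).add hw).congr_deriv (by simp [add_comm])
    | succ k =>
      refine ((ih (k + 1)).add (hw.mul (ih k))).congr_deriv ?_
      rw [Finset.mul_sum, add_left_comm, ← Finset.sum_add_distrib]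
      congr 1
      exact Finset.sum_congr rfl fun j hj => by rw [e1 j hj, esym_insert (n1 j)]; ring

theorem jet2_esym (S : Finset ι) (k : ℕ) (l w : ι → ℝ) :
    Jet2 (fun t => esym S (k + 2) (fun i => l i + w i * t)) (esym S (k + 2) l)
      (∑ i ∈ S, w i * esym (S.erase i) (k + 1) l)
      (∑ i ∈ S, w i * ∑ j ∈ S.erase i, w j * esym ((S.erase i).erase j) k l) := by
  refine ⟨by simp, _, .of_forall fun t => hasDerivAt_esym S (k + 1) l w t, by simp, ?_⟩
  refine (HasDerivAt.fun_sum fun i _ =>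
    (hasDerivAt_esym (S.erase i) k l w 0).const_mul (w i)).congr_deriv ?_
  simp

/-- The points `l + tw` and `l - tw` add up to `2l`, so superadditivity together with homogeneity is
midpoint concavity along the line. -/
theorem InCone.jet2_quotient_nonpos {S : Finset ι} {k : ℕ} {l : ι → ℝ} (h : InCone S k l)
    (w : ι → ℝ) {c a b : ℝ}
    (hj : Jet2 (fun t => esym S (k + 1) (fun i => l i + w i * t) *
      (esym S k (fun i => l i + w i * t))⁻¹) c a b) : b ≤ 0 := by
  refine hj.nonpos_of_midpoint ?_
  have hcont : ∀ m, Continuous fun t : ℝ => esym S m (fun i => l i + w i * t) := fun m => by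
    unfold esym
    fun_prop
  have hev : ∀ᶠ t in 𝓝 (0 : ℝ), InCone S k (fun i => l i + w i * t) := by
    have : ∀ᶠ t in 𝓝 (0 : ℝ), ∀ m ∈ Set.Iic k, 0 < esym S m (fun i => l i + w i * t) := by
      refine (Filter.eventually_all_finite (Set.finite_Iic k)).2 fun m hm => ?_
      exact (hcont m).continuousAt.eventually (lt_mem_nhds (by simpa using h m hm))
    filter_upwards [this] with t ht m hm using ht m hm
  have htend : Tendsto (fun t : ℝ => -t) (𝓝 0) (𝓝 0) := by
    simpa using (continuous_neg (G := ℝ)).tendsto 0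
  filter_upwards [hev, htend.eventually hev] with t h1 h2
  have h3 := (InCone.superadditive k S h1 h2).2
  have e : (fun i => l i + w i * t + (l i + w i * -t)) = fun i => 2 * l i := by
    ext i; ring
  rw [e, esym_const_mul, esym_const_mul, pow_succ, mul_assoc, mul_div_mul_left _ _ (by positivity),
    mul_div_assoc] at h3
  simpa [div_eq_mul_inv] using h3

/-- This is `(σ_{k+1}^{1/(k+1)})'' ≤ 0` cleared of denominators. The induction uses `σ_{k+2} =
σ_{k+1} · q` with `q` a concave quotient. -/
theorem InCone.jet2_concave {S : Finset ι} {l : ι → ℝ} (w : ι → ℝ) (k : ℕ)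
    (h : InCone S (k + 1) l) {c a b : ℝ}
    (hj : Jet2 (fun t => esym S (k + 1) (fun i => l i + w i * t)) c a b) :
    (k + 1) * (c * b) ≤ k * a ^ 2 := by
  induction k generalizing c a b with
  | zero =>
    have := (hj.unique (jet2_esym_one S l w)).2.2
    simp [this]
  | succ k ih =>
    obtain ⟨s, s1, s2, hs⟩ : ∃ s s1 s2,
        Jet2 (fun t => esym S (k + 1) (fun i => l i + w i * t)) s s1 s2 := by
      cases k with
      | zero => exact ⟨_, _, _, jet2_esym_one S l w⟩
      | succ k => exact ⟨_, _, _, jet2_esym S k l w⟩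
    have h1 := ih (h.mono (by omega)) hs
    have hs0 : 0 < s := by
      rw [← hs.1]; simpa using h (k + 1) (by omega)
    have hq := hj.mul (hs.inv hs0.ne')
    have h2 := (h.mono (by omega)).jet2_quotient_nonpos w hq
    set q2 := b * s⁻¹ + 2 * (a * (-s1 / s ^ 2)) + c * (-s2 / s ^ 2 + 2 * s1 ^ 2 / s ^ 3) with hq2
    set q1 := a * s⁻¹ + c * (-s1 / s ^ 2) with hq1
    obtain ⟨q, hqc⟩ : ∃ q, c = s * q := ⟨c / s, by field_simp⟩
    have hc0 : 0 < c := by rw [← hj.1]; simpa using h (k + 1 + 1) le_rfl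
    have hqpos : 0 < q := by
      rw [hqc] at hc0; exact (pos_iff_pos_of_mul_pos hc0).1 hs0
    have ea : a = s1 * q + s * q1 := by rw [hq1, hqc]; field_simp; ring
    have eb : b = s2 * q + 2 * s1 * q1 + s * q2 := by rw [hq2, hqc, ea]; field_simp; ring
    rw [ea, eb, hqc]
    push_cast
    have hk : (0 : ℝ) < k + 1 := by positivity
    -- After using the induction hypothesis and `q2 ≤ 0`, the two sides differ by at least `(s1 q -
    -- (k+1) s q1)²`.
    have h3 : (k + 1) * ((k + 1 + 1) * (s * q * (s2 * q + 2 * s1 * q1 + s * q2)))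
        ≤ (k + 1) * ((k + 1) * (s1 * q + s * q1) ^ 2) := by
      have t1 := mul_le_mul_of_nonneg_left h1
        (mul_nonneg (by positivity : (0 : ℝ) ≤ k + 1 + 1) (sq_nonneg q))
      have t2 := mul_le_mul_of_nonneg_left h2
        (by positivity : (0 : ℝ) ≤ (k + 1) * (k + 1 + 1) * (s * q * s))
      nlinarith [sq_nonneg (s1 * q - (k + 1) * (s * q1))]
    exact le_of_mul_le_mul_left h3 hk

/-- The second derivative form of the concavity of `σ_{k+2} ^ (1 / (k+2))` on `Γ_{k+2}`. -/
theorem InCone.concave {S : Finset ι} {l : ι → ℝ} (w : ι → ℝ) (k : ℕ) (h : InCone S (k + 2) l) :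
    (k + 2) * (esym S (k + 2) l *
        ∑ i ∈ S, w i * ∑ j ∈ S.erase i, w j * esym ((S.erase i).erase j) k l)
      ≤ (k + 1) * (∑ i ∈ S, w i * esym (S.erase i) (k + 1) l) ^ 2 := by
  have := InCone.jet2_concave w (k + 1) h (jet2_esym S k l w)
  push_cast at this
  linarith

end

end SumHessian

namespace SumHessian
open Filter Topology Matrix

/-! ### Second order expansion of symmetric functions of a matrix at a diagonal matrix -/

section det
variable {ι : Type*} [DecidableEq ι]

theorem perm_eq_one_of_forall_ne {σ : Equiv.Perm ι} {i : ι} (h : ∀ j ≠ i, σ j = j) : σ = 1 := by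
  ext j
  rcases eq_or_ne j i with rfl | hj
  · by_contra hne
    exact hne (σ.injective (h _ hne))
  · exact h j hj

theorem perm_eq_one_or_swap {σ : Equiv.Perm ι} {i j : ι} (hij : i ≠ j)
    (h : ∀ l, l ≠ i → l ≠ j → σ l = l) : σ = 1 ∨ σ = Equiv.swap i j := by
  have hi : σ i = i ∨ σ i = j := by
    by_contra! hc
    exact hc.1 (σ.injective (h _ hc.1 hc.2))
  rcases hi with hi | hi
  · left
    refine perm_eq_one_of_forall_ne (i := j) fun l hl => ?_
    rcases eq_or_ne l i with rfl | hli
    · exact hi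
    · exact h l hli hl
  · right
    have hj : σ j = i := by
      by_contra hc
      rcases eq_or_ne (σ j) j with hc' | hc'
      · exact hij (σ.injective (hi.trans hc'.symm))
      · exact hc' (σ.injective (h _ hc hc'))
    ext l
    rcases eq_or_ne l i with rfl | hli
    · rw [hi, Equiv.swap_apply_left]
    rcases eq_or_ne l j with rfl | hlj
    · rw [hj, Equiv.swap_apply_right]
    · rw [h l hli hlj, Equiv.swap_apply_of_ne_of_ne hli hlj]

variable [Fintype ι]

/-- In the Leibniz expansion at a diagonal matrix, at most two entries are differentiated and all
others must be diagonal. Only the identity and transpositions contribute. -/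
theorem jet2_det {H : ℝ → Matrix ι ι ℝ} {d : ι → ℝ} {A B : Matrix ι ι ℝ}
    (hH : ∀ i j, Jet2 (fun t => H t i j) (diagonal d i j) (A i j) (B i j)) :
    Jet2 (fun t => (H t).det) (∏ i, d i) (∑ i, A i i * ∏ j ∈ Finset.univ.erase i, d j)
      (∑ i, (B i i * ∏ j ∈ Finset.univ.erase i, d j + ∑ j ∈ Finset.univ.erase i,
        (A i i * A j j - A i j * A j i) * ∏ l ∈ (Finset.univ.erase i).erase j, d l)) := by
  -- A nontrivial permutation moves at least two indices, so an off-diagonal zero survives the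
  -- removal of one factor.
  have hone : ∀ i : ι, ∀ σ : Equiv.Perm ι, σ ≠ 1 →
      ∏ j ∈ Finset.univ.erase i, diagonal d (σ j) j = 0 := by
    intro i σ hσ
    obtain ⟨j, hj, hne⟩ : ∃ j ≠ i, σ j ≠ j := by
      by_contra! hc
      exact hσ (perm_eq_one_of_forall_ne hc)
    exact Finset.prod_eq_zero (Finset.mem_erase.2 ⟨hj, Finset.mem_univ _⟩)
      (diagonal_apply_ne _ hne)
  simp only [det_apply']
  refine (Jet2.sum Finset.univ fun σ _ => (Jet2.prod Finset.univ fun i _ =>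
    hH (σ i) i).const_mul _).cast ?_ ?_ ?_
  · rw [← det_diagonal, det_apply']
  · simp only [Finset.mul_sum]
    rw [Finset.sum_comm]
    refine Finset.sum_congr rfl fun i _ => ?_
    rw [Finset.sum_eq_single 1 (fun σ _ hσ => by rw [hone i σ hσ]; ring) (by simp)]
    simp
  · simp only [Finset.mul_sum, mul_add]
    rw [Finset.sum_comm]
    refine Finset.sum_congr rfl fun i _ => ?_
    rw [Finset.sum_add_distrib, Finset.sum_comm]
    congr 1
    · rw [Finset.sum_eq_single 1 (fun σ _ hσ => by rw [hone i σ hσ]; ring) (by simp)]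
      simp
    · refine Finset.sum_congr rfl fun j hj => ?_
      have hij : i ≠ j := (Finset.ne_of_mem_erase hj).symm
      have hs : (1 : Equiv.Perm ι) ≠ Equiv.swap i j := by
        intro h
        have := congrArg (fun σ : Equiv.Perm ι => σ i) h
        simp only [Equiv.Perm.coe_one, id_eq, Equiv.swap_apply_left] at this
        exact hij this
      rw [← Finset.sum_subset (Finset.subset_univ {1, Equiv.swap i j}), Finset.sum_pair hs]
      · have e : ∏ l ∈ (Finset.univ.erase i).erase j, diagonal d (Equiv.swap i j l) l
            = ∏ l ∈ (Finset.univ.erase i).erase j, d l :=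
          Finset.prod_congr rfl fun l hl => by
            rw [Equiv.swap_apply_of_ne_of_ne (Finset.ne_of_mem_erase (Finset.mem_of_mem_erase hl))
              (Finset.ne_of_mem_erase hl), diagonal_apply_eq]
        rw [e]
        simp [Equiv.Perm.sign_swap hij]
        ring
      · intro σ _ hσ
        simp only [Finset.mem_insert, Finset.mem_singleton, not_or] at hσ
        obtain ⟨l, hli, hlj, hne⟩ : ∃ l, l ≠ i ∧ l ≠ j ∧ σ l ≠ l := by
          by_contra! hc
          rcases perm_eq_one_or_swap hij hc with h | h
          · exact hσ.1 h
          · exact hσ.2 h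
        have hz : ∏ m ∈ (Finset.univ.erase i).erase j, diagonal d (σ m) m = 0 :=
          Finset.prod_eq_zero (i := l) (by simp [hli, hlj]) (diagonal_apply_ne _ hne)
        rw [hz]
        ring

end det

/-! ### Recovering a coefficient from values of a polynomial -/

section interpolation
open Polynomial

/-- A coefficient of a polynomial of bounded degree is a fixed linear combination of its values. -/
theorem exists_coeff_eq_sum_eval (N k : ℕ) : ∃ c s : Fin (N + 1) → ℝ,
    ∀ p : ℝ[X], p.natDegree ≤ N → ∑ j, c j * p.eval (s j) = p.coeff k := by
  have hinj : Set.InjOn (fun j : Fin (N + 1) => (j : ℝ)) (Finset.univ : Finset (Fin (N + 1))) := by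
    intro i _ j _ h
    simp only [Nat.cast_inj] at h
    exact Fin.ext h
  refine ⟨fun j => (Lagrange.basis Finset.univ (fun j : Fin (N + 1) => (j : ℝ)) j).coeff k,
    fun j => j, fun p hp => ?_⟩
  have hdeg : p.degree < (Finset.univ : Finset (Fin (N + 1))).card := by
    rw [Finset.card_univ, Fintype.card_fin]
    exact degree_le_natDegree.trans_lt (by exact_mod_cast Nat.lt_succ_of_le hp)
  conv_rhs => rw [Lagrange.eq_interpolate hinj hdeg, Lagrange.interpolate_apply, finsetSum_coeff]
  refine Finset.sum_congr rfl fun j _ => ?_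
  rw [coeff_C_mul, mul_comm]

theorem eval_prod_one_add {ι : Type*} (S : Finset ι) (l : ι → ℝ) (s : ℝ) :
    (∏ i ∈ S, (1 + X * C (l i))).eval s = ∏ i ∈ S, (1 + s * l i) := by
  simp only [eval_prod, eval_add, eval_one, eval_mul, eval_X, eval_C]

theorem natDegree_prod_one_add_le {ι : Type*} (S : Finset ι) (l : ι → ℝ) :
    (∏ i ∈ S, (1 + X * C (l i))).natDegree ≤ S.card := by
  refine (natDegree_prod_le _ _).trans ?_
  rw [Finset.card_eq_sum_ones]
  refine Finset.sum_le_sum fun i _ => (natDegree_add_le _ _).trans ?_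
  simp only [natDegree_one, zero_le, sup_of_le_right]
  exact natDegree_mul_le.trans (by simp [natDegree_X])

end interpolation

/-! ### The operator as one elementary symmetric function of `n + 1` entries -/

/-- The entries `l` with the extra entry `α`. -/
def withExtra {n : ℕ} (α : ℝ) (l : Fin n → ℝ) : Option (Fin n) → ℝ := fun o => o.elim α l

@[simp] theorem withExtra_none {n : ℕ} (α : ℝ) (l : Fin n → ℝ) : withExtra α l none = α := rfl
@[simp] theorem withExtra_some {n : ℕ} (α : ℝ) (l : Fin n → ℝ) (i : Fin n) :
    withExtra α l (some i) = l i := rfl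

theorem erase_some {n : ℕ} (S : Finset (Fin n)) (i : Fin n) :
    (Finset.insertNone S).erase (some i) = Finset.insertNone (S.erase i) := by
  ext o
  cases o <;> simp

theorem insertNone_univ {n : ℕ} :
    Finset.insertNone (Finset.univ : Finset (Fin n)) = Finset.univ := by
  ext o
  simp [Finset.mem_insertNone]

theorem esym_insertNone {n : ℕ} (S : Finset (Fin n)) (k : ℕ) (α : ℝ) (l : Fin n → ℝ) :
    esym (Finset.insertNone S) (k + 1) (withExtra α l) = esym S (k + 1) l + α * esym S k l := by
  have h : Finset.insertNone S = insert none (S.map Function.Embedding.some) := by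
    ext o
    cases o <;> simp
  have hn : (none : Option (Fin n)) ∉ S.map Function.Embedding.some := by simp
  have hm : ∀ k, esym (S.map Function.Embedding.some) k (withExtra α l) = esym S k l := by
    intro k
    unfold esym
    rw [Finset.powersetCard_map, Finset.sum_map]
    refine Finset.sum_congr rfl fun T _ => ?_
    simp
  rw [h, esym_insert hn, hm, hm]
  rfl

-- The eigenvalues `μ t` need not be differentiable in `t`, but `det(1 + s H t)` is for each fixed
-- `s`. Interpolation turns these determinants, each multiplied by `1 + sα`, into `σ_{k+2}(μ t, α)`.
open Polynomial in
theorem jet2_esym_of_det {n : ℕ} {H : ℝ → Matrix (Fin n) (Fin n) ℝ} {d : Fin n → ℝ}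
    {A B : Matrix (Fin n) (Fin n) ℝ}
    (hH : ∀ i j, Jet2 (fun t => H t i j) (diagonal d i j) (A i j) (B i j))
    {μ : ℝ → Fin n → ℝ} (hμ : ∀ᶠ t in 𝓝 0, ∀ s : ℝ, (1 + s • H t).det = ∏ i, (1 + s * μ t i))
    (α : ℝ) (k : ℕ) :
    Jet2 (fun t => esym Finset.univ (k + 2) (withExtra α (μ t)))
      (esym Finset.univ (k + 2) (withExtra α d))
      (∑ i, A i i * esym (Finset.univ.erase (some i)) (k + 1) (withExtra α d))
      (∑ i, (B i i * esym (Finset.univ.erase (some i)) (k + 1) (withExtra α d) +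
        ∑ j ∈ Finset.univ.erase i, (A i i * A j j - A i j * A j i) *
          esym ((Finset.univ.erase (some i)).erase (some j)) k (withExtra α d))) := by
  -- The degree is `n + 1` and not `n` because of the extra factor `1 + sα`.
  obtain ⟨c, s, hcs⟩ := exists_coeff_eq_sum_eval (n + 1) (k + 2)
  have hprod : ∀ (S : Finset (Fin n)) (l : Fin n → ℝ) (r : ℝ),
      (1 + r * α) * ∏ i ∈ S, (1 + r * l i)
        = ∏ o ∈ Finset.insertNone S, (1 + r * withExtra α l o) := by
    intro S l r
    rw [Finset.prod_insertNone]
    simp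
  have hcard : ∀ S : Finset (Fin n), (Finset.insertNone S).card ≤ n + 1 := by
    intro S
    simpa using Finset.card_le_univ S
  have h0 : ∀ l : Fin n → ℝ, ∑ j, c j * ((1 + s j * α) * ∏ i, (1 + s j * l i))
      = esym Finset.univ (k + 2) (withExtra α l) := by
    intro l
    simp only [hprod]
    simp only [← eval_prod_one_add]
    rw [hcs _ ((natDegree_prod_one_add_le _ _).trans (hcard _)), coeff_prod_one_add,
      insertNone_univ]
  have h1 : ∀ i, ∑ j, c j * (s j * ((1 + s j * α) * ∏ l ∈ Finset.univ.erase i, (1 + s j * d l)))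
      = esym (Finset.univ.erase (some i)) (k + 1) (withExtra α d) := by
    intro i
    have hd : (X * ∏ o ∈ Finset.insertNone (Finset.univ.erase i),
        (1 + X * C (withExtra α d o)) : ℝ[X]).natDegree ≤ n + 1 := by
      refine natDegree_mul_le.trans ?_
      have := natDegree_prod_one_add_le (Finset.insertNone (Finset.univ.erase i)) (withExtra α d)
      rw [Finset.card_insertNone, Finset.card_erase_of_mem (Finset.mem_univ _), Finset.card_univ,
        Fintype.card_fin] at this
      have hn := i.pos
      rw [natDegree_X]
      omega
    have := hcs _ hd
    simp only [eval_mul, eval_X, eval_prod_one_add, coeff_X_mul, coeff_prod_one_add] at this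
    simp only [hprod]
    rw [this, ← erase_some, insertNone_univ]
  have h2 : ∀ i, ∀ j ∈ Finset.univ.erase i, ∑ m, c m * (s m ^ 2 * ((1 + s m * α) *
      ∏ l ∈ (Finset.univ.erase i).erase j, (1 + s m * d l)))
      = esym ((Finset.univ.erase (some i)).erase (some j)) k (withExtra α d) := by
    intro i j hj
    have hd : (X ^ 2 * ∏ o ∈ Finset.insertNone ((Finset.univ.erase i).erase j),
        (1 + X * C (withExtra α d o)) : ℝ[X]).natDegree ≤ n + 1 := by
      refine natDegree_mul_le.trans ?_
      have := natDegree_prod_one_add_le (Finset.insertNone ((Finset.univ.erase i).erase j))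
        (withExtra α d)
      have hc : (2 : ℕ) ≤ n := by
        have h3 := Finset.card_pos.2 ⟨j, hj⟩
        rw [Finset.card_erase_of_mem (Finset.mem_univ _), Finset.card_univ,
          Fintype.card_fin] at h3
        omega
      rw [Finset.card_insertNone, Finset.card_erase_of_mem hj,
        Finset.card_erase_of_mem (Finset.mem_univ _), Finset.card_univ, Fintype.card_fin] at this
      rw [natDegree_pow, natDegree_X]
      omega
    have := hcs _ hd
    simp only [eval_mul, eval_pow, eval_X, eval_prod_one_add, coeff_X_pow_mul,
      coeff_prod_one_add] at this
    simp only [hprod]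
    rw [this, ← erase_some, ← erase_some, insertNone_univ]
  have hs : ∀ r : ℝ, Jet2 (fun t => (1 + r • H t).det) (∏ i, (1 + r * d i))
      (∑ i, r * A i i * ∏ j ∈ Finset.univ.erase i, (1 + r * d j))
      (∑ i, (r * B i i * ∏ j ∈ Finset.univ.erase i, (1 + r * d j) + ∑ j ∈ Finset.univ.erase i,
        (r * A i i * (r * A j j) - r * A i j * (r * A j i)) *
          ∏ l ∈ (Finset.univ.erase i).erase j, (1 + r * d l))) := by
    intro r
    refine (jet2_det (H := fun t => 1 + r • H t) (d := fun i => 1 + r * d i) (A := r • A)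
      (B := r • B) fun i j => ?_).cast rfl (by simp) (by simp)
    simp only [Matrix.add_apply, Matrix.smul_apply, smul_eq_mul]
    refine ((Jet2.const _).add ((hH i j).const_mul r)).cast ?_ (by simp) (by simp)
    rcases eq_or_ne i j with rfl | hij
    · simp
    · simp [hij]
  have hfin := Jet2.sum Finset.univ fun j _ => ((hs (s j)).const_mul (1 + s j * α)).const_mul (c j)
  refine (hfin.congr ?_).cast (h0 d) ?_ ?_
  · filter_upwards [hμ] with t ht
    simp only [ht, h0]
  · simp only [← h1, Finset.mul_sum]
    rw [Finset.sum_comm]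
    exact Finset.sum_congr rfl fun i _ => Finset.sum_congr rfl fun j _ => by ring
  · simp only [← h1, Finset.mul_sum, mul_add, Finset.sum_add_distrib]
    congr 1
    · rw [Finset.sum_comm]
      exact Finset.sum_congr rfl fun i _ => Finset.sum_congr rfl fun j _ => by ring
    · rw [Finset.sum_comm]
      refine Finset.sum_congr rfl fun i _ => ?_
      rw [Finset.sum_comm]
      refine Finset.sum_congr rfl fun j hj => ?_
      rw [← h2 i j hj, Finset.mul_sum]
      exact Finset.sum_congr rfl fun m _ => by ring

end SumHessian

namespace SumHessian
open Filter Topology Matrix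

/-! ### Directional derivatives -/

section dirDeriv
variable {V : Type*} [NormedAddCommGroup V] [NormedSpace ℝ V]

/-- The derivative of `f` in the direction `v`. -/
noncomputable def dirDeriv (v : V) (f : V → ℝ) : V → ℝ := fun x => fderiv ℝ f x v

variable {Ω : Set V} {f g : V → ℝ} {x : V}

theorem contDiffOn_dirDeriv (hΩ : IsOpen Ω) {m : ℕ} (hf : ContDiffOn ℝ (m + 1 : ℕ) f Ω) (v : V) :
    ContDiffOn ℝ m (dirDeriv v f) Ω := by
  have : ContDiffOn ℝ m (fderiv ℝ f) Ω := hf.fderiv_of_isOpen hΩ (by norm_cast)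
  exact this.clm_apply contDiffOn_const

theorem dirDeriv_congr (hΩ : IsOpen Ω) (h : ∀ y ∈ Ω, f y = g y) (hx : x ∈ Ω) (v : V) :
    dirDeriv v f x = dirDeriv v g x := by
  have : f =ᶠ[𝓝 x] g := by filter_upwards [hΩ.mem_nhds hx] with y hy using h y hy
  simp [dirDeriv, this.fderiv_eq]

theorem dirDeriv_dirDeriv (hΩ : IsOpen Ω) (hf : ContDiffOn ℝ 2 f Ω) (hx : x ∈ Ω) (v w : V) :
    dirDeriv v (dirDeriv w f) x = fderiv ℝ (fderiv ℝ f) x v w := by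
  have h1 : ContDiffOn ℝ 1 (fderiv ℝ f) Ω := hf.fderiv_of_isOpen hΩ (by norm_num)
  have h2 : DifferentiableAt ℝ (fderiv ℝ f) x :=
    (h1.contDiffAt (hΩ.mem_nhds hx)).differentiableAt (by norm_num)
  unfold dirDeriv
  rw [fderiv_clm_apply h2 (differentiableAt_const w)]
  simp

theorem dirDeriv_comm (hΩ : IsOpen Ω) (hf : ContDiffOn ℝ 2 f Ω) (hx : x ∈ Ω) (v w : V) :
    dirDeriv v (dirDeriv w f) x = dirDeriv w (dirDeriv v f) x := by
  rw [dirDeriv_dirDeriv hΩ hf hx, dirDeriv_dirDeriv hΩ hf hx]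
  exact (hf.contDiffAt (hΩ.mem_nhds hx)).isSymmSndFDerivAt (by simp) v w

theorem hasDerivAt_line {t : ℝ} {v : V} (h : DifferentiableAt ℝ f (x + t • v)) :
    HasDerivAt (fun t : ℝ => f (x + t • v)) (dirDeriv v f (x + t • v)) t := by
  have h1 : HasDerivAt (fun t : ℝ => x + t • v) v t := by
    simpa using ((hasDerivAt_id t).smul_const v).const_add x
  exact h.hasFDerivAt.comp_hasDerivAt t h1

theorem eventually_line_mem (hΩ : IsOpen Ω) (hx : x ∈ Ω) (v : V) :
    ∀ᶠ t : ℝ in 𝓝 0, x + t • v ∈ Ω := by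
  have h : ContinuousAt (fun t : ℝ => x + t • v) 0 := by fun_prop
  exact h.eventually (hΩ.mem_nhds (by simpa using hx))

theorem jet2_line (hΩ : IsOpen Ω) (hf : ContDiffOn ℝ 2 f Ω) (hx : x ∈ Ω) (v : V) :
    Jet2 (fun t : ℝ => f (x + t • v)) (f x) (dirDeriv v f x) (dirDeriv v (dirDeriv v f) x) := by
  refine ⟨by simp, fun t => dirDeriv v f (x + t • v), ?_, by simp, ?_⟩
  · filter_upwards [eventually_line_mem hΩ hx v] with t ht
    exact hasDerivAt_line ((hf.contDiffAt (hΩ.mem_nhds ht)).differentiableAt (by norm_num))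
  · have h1 : ContDiffOn ℝ 1 (dirDeriv v f) Ω := contDiffOn_dirDeriv (m := 1) hΩ hf v
    have h2 := hasDerivAt_line (f := dirDeriv v f) (x := x) (v := v) (t := 0)
      ((h1.contDiffAt (hΩ.mem_nhds (by simpa using hx))).differentiableAt (by norm_num))
    simpa using h2

/-- For a `C⁴` function, pairs of directional derivatives commute. -/
theorem dirDeriv_comm_pairs (hΩ : IsOpen Ω) (hf : ContDiffOn ℝ 4 f Ω) (hx : x ∈ Ω) (v w : V) :
    dirDeriv v (dirDeriv v (dirDeriv w (dirDeriv w f))) x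
      = dirDeriv w (dirDeriv w (dirDeriv v (dirDeriv v f))) x := by
  have h3 : ∀ a, ContDiffOn ℝ 3 (dirDeriv a f) Ω := fun a => contDiffOn_dirDeriv (m := 3) hΩ hf a
  have h2 : ∀ a b, ContDiffOn ℝ 2 (dirDeriv a (dirDeriv b f)) Ω := fun a b =>
    contDiffOn_dirDeriv (m := 2) hΩ (h3 b) a
  have e1 : ∀ y ∈ Ω, dirDeriv v (dirDeriv w (dirDeriv w f)) y
      = dirDeriv w (dirDeriv w (dirDeriv v f)) y := fun y hy => by
    rw [dirDeriv_comm hΩ ((h3 w).of_le (by norm_num)) hy]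
    exact dirDeriv_congr hΩ (fun z hz => dirDeriv_comm hΩ (hf.of_le (by norm_num)) hz v w) hy w
  rw [dirDeriv_congr hΩ e1 hx, dirDeriv_comm hΩ (h2 w v) hx]
  refine dirDeriv_congr hΩ (fun y hy => ?_) hx w
  rw [dirDeriv_comm hΩ ((h3 v).of_le (by norm_num)) hy]

/-- For a `C³` function, `∂_v ∂_w ∂_w f = ∂_w ∂_w ∂_v f`. -/
theorem dirDeriv_comm_triple (hΩ : IsOpen Ω) (hf : ContDiffOn ℝ 3 f Ω) (hx : x ∈ Ω) (v w : V) :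
    dirDeriv v (dirDeriv w (dirDeriv w f)) x = dirDeriv w (dirDeriv w (dirDeriv v f)) x := by
  rw [dirDeriv_comm hΩ (contDiffOn_dirDeriv (m := 2) hΩ hf w) hx]
  exact dirDeriv_congr hΩ (fun z hz => dirDeriv_comm hΩ (hf.of_le (by norm_num)) hz v w) hx w

end dirDeriv

/-! ### The Hessian in an orthonormal basis -/

section hess
variable {n : ℕ} {u : EuclideanSpace ℝ (Fin n) → ℝ} {Ω : Set (EuclideanSpace ℝ (Fin n))}
  {x : EuclideanSpace ℝ (Fin n)}

local notation "E" => EuclideanSpace ℝ (Fin n)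

/-- The Hessian matrix in the orthonormal basis `b`. -/
noncomputable def hessianIn (b : OrthonormalBasis (Fin n) ℝ E) (u : E → ℝ) (x : E) :
    Matrix (Fin n) (Fin n) ℝ :=
  Matrix.of fun i j => dirDeriv (b i) (dirDeriv (b j) u) x

theorem hessianIn_apply (b : OrthonormalBasis (Fin n) ℝ E) (u : E → ℝ) (x : E) (i j : Fin n) :
    hessianIn b u x i j = dirDeriv (b i) (dirDeriv (b j) u) x := rfl

theorem fderiv_fderiv_eq_hessian (u : E → ℝ) (x v w : E) :
    fderiv ℝ (fderiv ℝ u) x v w = v.ofLp ⬝ᵥ hessian u x *ᵥ w.ofLp := by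
  have hv : ∀ v : E, v = ∑ p, v p • EuclideanSpace.single p (1 : ℝ) := fun v => by
    ext i
    simp [Pi.single_apply]
  conv_lhs => rw [hv v, hv w]
  simp only [map_sum, map_smul, _root_.sum_apply, _root_.smul_apply,
    smul_eq_mul, dotProduct, mulVec, hessian, Matrix.of_apply, iteratedFDeriv_two_apply]
  simp only [Finset.mul_sum]
  rw [Finset.sum_comm]
  refine Finset.sum_congr rfl fun p _ => Finset.sum_congr rfl fun q _ => ?_
  simp
  ring

theorem inner_eq_dotProduct (v w : E) : inner ℝ v w = v.ofLp ⬝ᵥ w.ofLp := by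
  rw [EuclideanSpace.inner_eq_star_dotProduct, star_trivial, dotProduct_comm]

/-- The two Hessians are conjugate by the orthogonal matrix whose rows are the basis vectors. -/
theorem det_one_add_hessianIn (hΩ : IsOpen Ω) (hu : ContDiffOn ℝ 2 u Ω) (hx : x ∈ Ω)
    (b : OrthonormalBasis (Fin n) ℝ E) (s : ℝ) :
    (1 + s • hessianIn b u x).det = (1 + s • hessian u x).det := by
  let Q : Matrix (Fin n) (Fin n) ℝ := Matrix.of fun i p => b i p
  have hQ : Q * Qᵀ = 1 := by
    ext i j
    have := orthonormal_iff_ite.1 b.orthonormal i j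
    rw [inner_eq_dotProduct] at this
    rw [Matrix.mul_apply, Matrix.one_apply, ← this]
    rfl
  have hH : hessianIn b u x = Q * hessian u x * Qᵀ := by
    ext i j
    rw [hessianIn_apply, dirDeriv_dirDeriv hΩ hu hx, fderiv_fderiv_eq_hessian, mul_assoc,
      Matrix.mul_apply]
    simp only [dotProduct, mulVec, Matrix.mul_apply, Matrix.transpose_apply]
    rfl
  have h1 : 1 + s • hessianIn b u x = Q * (1 + s • hessian u x) * Qᵀ := by
    rw [mul_add, add_mul, mul_one, hQ, hH]
    simp [mul_assoc]
  rw [h1, det_mul, det_mul, mul_right_comm, ← det_mul, hQ, det_one, one_mul]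

theorem exists_eigenbasis (hΩ : IsOpen Ω) (hu : ContDiffOn ℝ 2 u Ω) (hx : x ∈ Ω) :
    ∃ b : OrthonormalBasis (Fin n) ℝ E,
      hessianIn b u x = diagonal (hessianEigenvalues u x) := by
  have hH := hessian_isHermitian (hu.contDiffAt (hΩ.mem_nhds hx))
  refine ⟨hH.eigenvectorBasis, ?_⟩
  ext i j
  rw [hessianIn_apply, dirDeriv_dirDeriv hΩ hu hx, fderiv_fderiv_eq_hessian,
    hH.mulVec_eigenvectorBasis, hessianEigenvalues, dif_pos hH, dotProduct_smul,
    ← inner_eq_dotProduct, orthonormal_iff_ite.1 hH.eigenvectorBasis.orthonormal i j,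
    diagonal_apply]
  rcases eq_or_ne i j with rfl | h
  · simp
  · simp [h]

theorem det_one_add_hessianIn_eq_prod (hΩ : IsOpen Ω) (hu : ContDiffOn ℝ 2 u Ω) (hx : x ∈ Ω)
    (b : OrthonormalBasis (Fin n) ℝ E) (s : ℝ) :
    (1 + s • hessianIn b u x).det = ∏ i, (1 + s * hessianEigenvalues u x i) := by
  obtain ⟨e, he⟩ := exists_eigenbasis hΩ hu hx
  rw [det_one_add_hessianIn hΩ hu hx, ← det_one_add_hessianIn hΩ hu hx e, he]
  have : (1 : Matrix (Fin n) (Fin n) ℝ) + s • diagonal (hessianEigenvalues u x)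
      = diagonal fun i => 1 + s * hessianEigenvalues u x i := by
    rw [← diagonal_one, ← diagonal_smul, diagonal_add]
    rfl
  rw [this, det_diagonal]

open scoped Laplacian in
theorem laplacian_eq_sum_eigenvalues (hΩ : IsOpen Ω) (hu : ContDiffOn ℝ 2 u Ω) (hx : x ∈ Ω) :
    Δ u x = ∑ i, hessianEigenvalues u x i := by
  obtain ⟨e, he⟩ := exists_eigenbasis hΩ hu hx
  rw [InnerProductSpace.laplacian_eq_iteratedFDeriv_orthonormalBasis u e]
  refine Finset.sum_congr rfl fun i _ => ?_
  have := congrFun (congrFun he i) i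
  rw [hessianIn_apply, dirDeriv_dirDeriv hΩ hu hx, diagonal_apply_eq] at this
  rw [iteratedFDeriv_two_apply, ← this]
  rfl

theorem sigma_eq_esym (k : ℕ) (l : Fin n → ℝ) : sigma k l = esym Finset.univ k l := rfl

theorem esym_withExtra_univ (k : ℕ) (α : ℝ) (l : Fin n → ℝ) :
    esym Finset.univ (k + 1) (withExtra α l) = sigma (k + 1) l + α * sigma k l := by
  rw [← insertNone_univ, esym_insertNone]
  rfl

end hess

end SumHessian

namespace SumHessian
open Filter Topology

/-! ### Second order lower bounds for compositions with `C^{1,1}` functions -/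

/-- The second order Taylor bound from below for the `k`-th power; it turns a tangent line for
`f^{1/k}` into a quadratic lower bound for `f`. -/
theorem one_add_pow_ge (k : ℕ) : ∃ C : ℝ, 0 ≤ C ∧ ∀ w : ℝ, -1 ≤ w → w ≤ 1 →
    1 + k * w + k * (k - 1) / 2 * w ^ 2 - C * |w| ^ 3 ≤ (1 + w) ^ k := by
  induction k with
  | zero => exact ⟨0, le_rfl, fun w _ _ => by simp⟩
  | succ k ih =>
    obtain ⟨C, hC, h⟩ := ih
    refine ⟨2 * C + k * k / 2 + k / 2, by positivity, fun w h1 h2 => ?_⟩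
    have h3 := mul_le_mul_of_nonneg_left (h w h1 h2) (by linarith : 0 ≤ 1 + w)
    rw [pow_succ' (1 + w)]
    refine le_trans ?_ h3
    have h4 : 0 ≤ |w| ^ 3 := by positivity
    have h5 : -(w ^ 3) ≤ |w| ^ 3 := by rw [← abs_pow]; exact neg_le_abs _
    have h5' : w ^ 3 ≤ |w| ^ 3 := by rw [← abs_pow]; exact le_abs_self _
    have h6 : 0 ≤ C * |w| ^ 3 := by positivity
    have hk : (0 : ℝ) ≤ k := Nat.cast_nonneg k
    push_cast
    nlinarith [mul_nonneg (mul_nonneg hk hk) h4, mul_nonneg hk h4,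
      mul_le_mul_of_nonneg_left h5 (mul_nonneg hk hk), mul_le_mul_of_nonneg_left h5' hk,
      mul_nonneg h6 (by linarith : 0 ≤ 1 - w)]

section
variable {n : ℕ} {Ω : Set (EuclideanSpace ℝ (Fin n))}
  {f : EuclideanSpace ℝ (Fin n) × ℝ × EuclideanSpace ℝ (Fin n) → ℝ}

local notation "E" => EuclideanSpace ℝ (Fin n)

theorem IsC11.differentiableAt (hf : IsC11 Ω f) (hΩ : IsOpen Ω) {X : E × ℝ × E} (hX : X.1 ∈ Ω) :
    DifferentiableAt ℝ f X := by
  have h : Ω ×ˢ (Set.univ : Set (ℝ × E)) ∈ 𝓝 X :=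
    (hΩ.prod isOpen_univ).mem_nhds ⟨hX, trivial⟩
  exact (hf.contDiffOn.contDiffAt h).differentiableAt (by norm_num)

theorem taylor_bound_of_lipschitz_fderiv (hf : IsC11 Ω f) (hΩ : IsOpen Ω) {R : ℝ} {L : NNReal}
    (hL : LipschitzOnWith L (fderiv ℝ f) (Ω ×ˢ Metric.closedBall 0 R)) {X₀ : E × ℝ × E}
    (hX : X₀.1 ∈ Ω) (hR : ‖X₀.2‖ < R) :
    ∀ᶠ X in 𝓝 X₀, X.1 ∈ Ω ∧ f X₀ + fderiv ℝ f X₀ (X - X₀) - L * ‖X - X₀‖ ^ 2 ≤ f X ∧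
      ‖fderiv ℝ f X - fderiv ℝ f X₀‖ ≤ L * ‖X - X₀‖ := by
  have hopen : IsOpen (Ω ×ˢ Metric.ball (0 : ℝ × E) R) := hΩ.prod Metric.isOpen_ball
  have hmem : X₀ ∈ Ω ×ˢ Metric.ball (0 : ℝ × E) R := ⟨hX, by simpa using hR⟩
  obtain ⟨r, hr, hball⟩ := Metric.isOpen_iff.1 hopen X₀ hmem
  filter_upwards [Metric.ball_mem_nhds X₀ hr] with X hXr
  have hlip : ∀ Y ∈ Metric.ball X₀ r,
      ‖fderiv ℝ f Y - fderiv ℝ f X₀‖ ≤ L * ‖Y - X₀‖ := fun Y hY => by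
    have h1 := hball hY
    have h2 := hL.dist_le_mul Y ⟨h1.1, Metric.ball_subset_closedBall h1.2⟩ X₀
      ⟨hmem.1, Metric.ball_subset_closedBall hmem.2⟩
    simpa [dist_eq_norm] using h2
  refine ⟨(hball hXr).1, ?_, hlip X hXr⟩
  have hseg : ∀ Y ∈ segment ℝ X₀ X, Y ∈ Metric.ball X₀ r ∧ ‖Y - X₀‖ ≤ ‖X - X₀‖ := by
    intro Y hY
    refine ⟨(convex_ball X₀ r).segment_subset (Metric.mem_ball_self hr) hXr hY, ?_⟩
    obtain ⟨s, hs, rfl⟩ := (segment_eq_image' ℝ X₀ X ▸ hY)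
    rw [add_sub_cancel_left, norm_smul, Real.norm_of_nonneg hs.1]
    exact mul_le_of_le_one_left (norm_nonneg _) hs.2
  have h := (convex_segment X₀ X).norm_image_sub_le_of_norm_fderiv_le' (𝕜 := ℝ) (f := f)
    (φ := fderiv ℝ f X₀) (C := L * ‖X - X₀‖)
    (fun Y hY => hf.differentiableAt hΩ (hball (hseg Y hY).1).1)
    (fun Y hY => (hlip Y (hseg Y hY).1).trans (by gcongr; exact (hseg Y hY).2))
    (left_mem_segment ℝ X₀ X) (right_mem_segment ℝ X₀ X)
  rw [Real.norm_eq_abs] at h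
  nlinarith [(abs_le.1 h).1]

/-- The linear Taylor polynomial of `f` minus `L‖X - X₀‖²` touches `f` from below, and along the
curve `‖X t - X 0‖² / t²` tends to `‖X'‖²`. -/
theorem jet2_comp_ge (hf : IsC11 Ω f) (hΩ : IsOpen Ω) {R : ℝ} {L : NNReal}
    (hL : LipschitzOnWith L (fderiv ℝ f) (Ω ×ˢ Metric.closedBall 0 R)) {X : ℝ → E × ℝ × E}
    {X' : E × ℝ × E} (hX : (X 0).1 ∈ Ω) (hR : ‖(X 0).2‖ < R) (hd : HasDerivAt X X' 0)
    {c h₁ h₂ a₁ a₂ : ℝ} (hh : Jet2 (fun t => f (X t)) c h₁ h₂)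
    (ha : Jet2 (fun t => fderiv ℝ f (X 0) (X t - X 0)) 0 a₁ a₂) :
    a₂ - 2 * (L * ‖X'‖ ^ 2) ≤ h₂ := by
  have hslope := hasDerivAt_iff_tendsto_slope.1 hd
  refine Jet2.le_of_eventually_le hh (((Jet2.const c).add ha).cast (add_zero c) rfl (zero_add _))
    (r := fun t => L * ‖slope X 0 t‖ ^ 2) ((hslope.norm.pow 2).const_mul _) ?_
  have hev := hd.continuousAt.tendsto.eventually
    (taylor_bound_of_lipschitz_fderiv hf hΩ hL hX hR)
  filter_upwards [hev.filter_mono nhdsWithin_le_nhds, self_mem_nhdsWithin] with t ht ht0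
  have ht0 : t ≠ 0 := ht0
  have e : ‖X t - X 0‖ ^ 2 = ‖slope X 0 t‖ ^ 2 * t ^ 2 := by
    rw [slope_def_module, sub_zero, norm_smul, mul_pow, norm_inv, inv_pow, Real.norm_eq_abs,
      sq_abs]
    field_simp
  have := ht.2.1
  rw [e] at this
  rw [← hh.1]
  linarith

/-- The tangent line inequality for the `k`-th root of a positive function convex in `p`. -/
theorem convex_root_tangent (hf : IsC11 Ω f) (hΩ : IsOpen Ω)
    (hpos : ∀ x ∈ closure Ω, ∀ (z : ℝ) (p : E), 0 < f (x, z, p)) {k : ℕ} (hk : 0 < k)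
    (hconv : ∀ x ∈ closure Ω, ∀ z : ℝ,
      ConvexOn ℝ Set.univ (fun p : E => f (x, z, p) ^ (1 / (k : ℝ))))
    {x : E} (hx : x ∈ Ω) (z : ℝ) (p q : E)
    (hw : 0 ≤ 1 + fderiv ℝ f (x, z, p) (0, 0, q) / (k * f (x, z, p))) :
    f (x, z, p) * (1 + fderiv ℝ f (x, z, p) (0, 0, q) / (k * f (x, z, p))) ^ k
      ≤ f (x, z, p + q) := by
  have hxc := subset_closure hx
  have hk0 : (k : ℝ) ≠ 0 := by positivity
  have h0 := hpos x hxc z p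
  have hline : HasDerivAt (fun s : ℝ => ((x, z, p + s • q) : E × ℝ × E)) (0, 0, q) 0 := by
    have h1 : HasDerivAt (fun s : ℝ => p + s • q) q 0 := by
      simpa using ((hasDerivAt_id (0 : ℝ)).smul_const q).const_add p
    exact (hasDerivAt_const _ _).prodMk ((hasDerivAt_const _ _).prodMk h1)
  have hfd : HasDerivAt (fun s : ℝ => f (x, z, p + s • q)) (fderiv ℝ f (x, z, p) (0, 0, q)) 0 := by
    have hdiff := (hf.differentiableAt hΩ (X := (x, z, p + (0 : ℝ) • q)) hx).hasFDerivAt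
    have := hdiff.comp_hasDerivAt (0 : ℝ) hline
    exact this.congr_deriv (by simp)
  have hg : HasDerivAt (fun s : ℝ => f (x, z, p + s • q) ^ (1 / (k : ℝ)))
      (f (x, z, p) ^ (1 / (k : ℝ)) * (fderiv ℝ f (x, z, p) (0, 0, q) / (k * f (x, z, p)))) 0 := by
    have h1 := hfd.rpow_const (p := 1 / (k : ℝ)) (Or.inl (by simpa using h0.ne'))
    refine h1.congr_deriv ?_
    simp only [zero_smul, add_zero]
    rw [Real.rpow_sub_one h0.ne']
    field_simp
  have hc : ConvexOn ℝ Set.univ (fun s : ℝ => f (x, z, p + s • q) ^ (1 / (k : ℝ))) := by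
    have := (hconv x hxc z).comp_affineMap (AffineMap.lineMap p (p + q) : ℝ →ᵃ[ℝ] E)
    refine this.congr fun s _ => ?_
    simp [AffineMap.lineMap_apply, add_comm]
  have ht := hc.le_slope_of_hasDerivAt (Set.mem_univ 0) (Set.mem_univ 1) zero_lt_one hg
  rw [slope_def_field] at ht
  simp only [zero_smul, add_zero, one_smul, sub_zero, div_one] at ht
  set w := fderiv ℝ f (x, z, p) (0, 0, q) / (k * f (x, z, p))
  have h1 : f (x, z, p) ^ (1 / (k : ℝ)) * (1 + w) ≤ f (x, z, p + q) ^ (1 / (k : ℝ)) := by linarith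
  have h2 := pow_le_pow_left₀ (mul_nonneg (Real.rpow_nonneg h0.le _) hw) h1 k
  have h3 : ∀ a : ℝ, 0 ≤ a → (a ^ (1 / (k : ℝ))) ^ k = a := fun a ha => by
    rw [← Real.rpow_natCast, ← Real.rpow_mul ha, one_div, inv_mul_cancel₀ hk0, Real.rpow_one]
  rwa [mul_pow, h3 _ h0.le, h3 _ (hpos x hxc z _).le] at h2

/-- The point is that the error contains no `‖p'‖²`, the only term that is quadratic in the Hessian.
First `(x, z)` moves with `p` frozen, at cost `L‖(x', z')‖²`; then `p` moves, where convexity of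
`f^{1/k}` replaces Taylor's formula. Evaluating the `p`-derivative at the moved base point costs
only the mixed term. -/
theorem jet2_comp_ge_of_convex_root (hf : IsC11 Ω f) (hΩ : IsOpen Ω)
    (hpos : ∀ x ∈ closure Ω, ∀ (z : ℝ) (p : E), 0 < f (x, z, p)) {k : ℕ} (hk : 0 < k)
    (hconv : ∀ x ∈ closure Ω, ∀ z : ℝ,
      ConvexOn ℝ Set.univ (fun p : E => f (x, z, p) ^ (1 / (k : ℝ)))) {R : ℝ} {L : NNReal}
    (hL : LipschitzOnWith L (fderiv ℝ f) (Ω ×ˢ Metric.closedBall 0 R)) {x : ℝ → E} {z : ℝ → ℝ}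
    {p : ℝ → E} {x' : E} {z' : ℝ} {p' : E} (hX : x 0 ∈ Ω) (hR : ‖(z 0, p 0)‖ < R)
    (hx : HasDerivAt x x' 0) (hz : HasDerivAt z z' 0) (hp : HasDerivAt p p' 0)
    {c h₁ h₂ a₁ a₂ : ℝ} (hh : Jet2 (fun t => f (x t, z t, p t)) c h₁ h₂)
    (ha : Jet2 (fun t => fderiv ℝ f (x 0, z 0, p 0) ((x t, z t, p t) - (x 0, z 0, p 0))) 0 a₁ a₂) :
    a₂ - 2 * L * (‖(x', z')‖ ^ 2 + ‖(x', z')‖ * ‖p'‖)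
      + (k - 1) / k * fderiv ℝ f (x 0, z 0, p 0) (0, 0, p') ^ 2 / c ≤ h₂ := by
  obtain ⟨C, hC, hpow⟩ := one_add_pow_ge k
  have hc : f (x 0, z 0, p 0) = c := hh.1
  have hc0 : 0 < c := hc ▸ hpos _ (subset_closure hX) _ _
  have hk0 : (0 : ℝ) < k := by exact_mod_cast hk
  let W : ℝ → E × ℝ × E := fun t => (x t, z t, p 0)
  have hWd : HasDerivAt W (x', z', 0) 0 := hx.prodMk (hz.prodMk (hasDerivAt_const _ _))
  have hW' : ‖((x', z', 0) : E × ℝ × E)‖ = ‖(x', z')‖ := by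
    simp [Prod.norm_def]
  have hsW := hasDerivAt_iff_tendsto_slope.1 hWd
  have hsp := hasDerivAt_iff_tendsto_slope.1 hp
  have hdf : Tendsto (fun t => fderiv ℝ f (W t)) (𝓝[≠] 0) (𝓝 (fderiv ℝ f (W 0))) := by
    have hcont : ContinuousAt (fderiv ℝ f) (W 0) :=
      (hf.contDiffOn.contDiffAt ((hΩ.prod isOpen_univ).mem_nhds
        ⟨hX, trivial⟩)).continuousAt_fderiv (by norm_num)
    exact (hcont.tendsto.comp hWd.continuousAt.tendsto).mono_left nhdsWithin_le_nhds
  have hfW : Tendsto (fun t => f (W t)) (𝓝[≠] 0) (𝓝 c) := by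
    have hcont : ContinuousAt f (W 0) := (hf.differentiableAt hΩ (X := W 0) hX).continuousAt
    rw [← hc]
    exact (hcont.tendsto.comp hWd.continuousAt.tendsto).mono_left nhdsWithin_le_nhds
  let D : ℝ → ℝ := fun t => fderiv ℝ f (W t) (0, 0, slope p 0 t)
  have hD : Tendsto D (𝓝[≠] 0) (𝓝 (fderiv ℝ f (W 0) (0, 0, p'))) :=
    (isBoundedBilinearMap_apply.continuous.tendsto
      (fderiv ℝ f (W 0), ((0, 0, p') : E × ℝ × E))).comp (hdf.prodMk_nhds
        (tendsto_const_nhds.prodMk_nhds (tendsto_const_nhds.prodMk_nhds hsp)))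
  let ω : ℝ → ℝ := fun t => D t / (k * f (W t))
  have hω : Tendsto ω (𝓝[≠] 0) (𝓝 (fderiv ℝ f (W 0) (0, 0, p') / (k * c))) :=
    hD.div (hfW.const_mul _) (by positivity)
  have hid : Tendsto (fun t : ℝ => t) (𝓝[≠] 0) (𝓝 0) := tendsto_id.mono_left nhdsWithin_le_nhds
  have hw0 : Tendsto (fun t => t * ω t) (𝓝[≠] 0) (𝓝 0) := by simpa using hid.mul hω
  -- The error per `t²`: Lipschitz terms, minus the quadratic gain from the `k`-th power, plus a
  -- cubic remainder whose extra factor `|t|` makes it vanish in the limit.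
  let r : ℝ → ℝ := fun t => L * (‖slope W 0 t‖ ^ 2 + ‖slope W 0 t‖ * ‖slope p 0 t‖)
    - (k - 1) / (2 * k) * D t ^ 2 / f (W t) + C * (f (W t) * (|t| * |ω t| ^ 3))
  have hr : Tendsto r (𝓝[≠] 0) (𝓝 (L * (‖(x', z')‖ ^ 2 + ‖(x', z')‖ * ‖p'‖)
      - (k - 1) / (2 * k) * fderiv ℝ f (W 0) (0, 0, p') ^ 2 / c)) := by
    have h1 : Tendsto (fun t => C * (f (W t) * (|t| * |ω t| ^ 3))) (𝓝[≠] 0) (𝓝 0) := by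
      have := (hfW.mul (hid.abs.mul (hω.abs.pow 3))).const_mul C
      simpa using this
    have h2 := ((((hsW.norm.pow 2).add (hsW.norm.mul hsp.norm)).const_mul (L : ℝ)).sub
      (((hD.pow 2).const_mul ((k - 1) / (2 * k) : ℝ)).div hfW hc0.ne')).add h1
    rw [hW', add_zero] at h2
    exact h2
  have key := Jet2.le_of_eventually_le hh
    (((Jet2.const c).add ha).cast (add_zero c) rfl (zero_add _)) hr ?_
  · refine le_trans (le_of_eq ?_) key
    change _ + (k - 1) / k * fderiv ℝ f (W 0) (0, 0, p') ^ 2 / c = _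
    field_simp
    ring
  have hev := hWd.continuousAt.tendsto.eventually
    (taylor_bound_of_lipschitz_fderiv hf hΩ hL (X₀ := W 0) hX hR)
  filter_upwards [hev.filter_mono nhdsWithin_le_nhds, self_mem_nhdsWithin,
    hw0.eventually (eventually_ge_nhds (show (-1 : ℝ) < 0 by norm_num)),
    hw0.eventually (eventually_le_nhds (show (0 : ℝ) < 1 by norm_num))] with t ht ht0 hw1 hw2
  have ht0 : t ≠ 0 := ht0
  obtain ⟨htΩ, ht1, ht2⟩ := ht
  have hfp : 0 < f (W t) := hpos _ (subset_closure htΩ) _ _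
  have hpt : p t = p 0 + t • slope p 0 t := by
    rw [slope_def_module, sub_zero, smul_smul, mul_inv_cancel₀ ht0, one_smul]; abel
  have hDt : fderiv ℝ f (W t) (0, 0, t • slope p 0 t) = t * D t := by
    have : ((0, 0, t • slope p 0 t) : E × ℝ × E) = t • (0, 0, slope p 0 t) := by simp
    rw [this, map_smul, smul_eq_mul]
  have hwt : fderiv ℝ f (W t) (0, 0, t • slope p 0 t) / (k * f (W t)) = t * ω t := by
    rw [hDt]; simp only [ω]; ring
  have htan := convex_root_tangent hf hΩ hpos hk hconv htΩ (z t) (p 0) (t • slope p 0 t)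
    (by rw [show ((x t, z t, p 0) : E × ℝ × E) = W t from rfl, hwt]; linarith)
  rw [show ((x t, z t, p 0) : E × ℝ × E) = W t from rfl, hwt, ← hpt] at htan
  have hexp := mul_le_mul_of_nonneg_left (hpow (t * ω t) hw1 hw2) hfp.le
  have e1 : f (W t) * (k * (t * ω t)) = t * D t := by
    simp only [ω]; field_simp
  have e2 : f (W t) * (k * (k - 1) / 2 * (t * ω t) ^ 2)
      = ((k - 1) / (2 * k) * D t ^ 2 / f (W t)) * t ^ 2 := by
    simp only [ω]; field_simp
  have e3 : f (W t) * (C * |t * ω t| ^ 3) = C * (f (W t) * (|t| * |ω t| ^ 3)) * t ^ 2 := by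
    rw [abs_mul, mul_pow, pow_succ |t|, sq_abs]; ring
  have e4 : ‖W t - W 0‖ = ‖slope W 0 t‖ * |t| := by
    rw [slope_def_module, sub_zero, norm_smul, norm_inv, Real.norm_eq_abs]
    field_simp
  have hsplit : ((x t, z t, p t) : E × ℝ × E) - (x 0, z 0, p 0)
      = (W t - W 0) + t • (0, 0, slope p 0 t) := by
    rw [hpt]
    simp [W]
  have hDcmp : fderiv ℝ f (W 0) (0, 0, slope p 0 t) * t
      - L * ‖slope W 0 t‖ * ‖slope p 0 t‖ * t ^ 2 ≤ t * D t := by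
    have h1 : |t * (D t - fderiv ℝ f (W 0) (0, 0, slope p 0 t))|
        ≤ |t| * (L * (‖slope W 0 t‖ * |t|) * ‖slope p 0 t‖) := by
      rw [abs_mul]
      refine mul_le_mul_of_nonneg_left ?_ (abs_nonneg t)
      have h2 := ContinuousLinearMap.le_of_opNorm_le (fderiv ℝ f (W t) - fderiv ℝ f (W 0)) ht2
        ((0, 0, slope p 0 t) : E × ℝ × E)
      rw [e4] at h2
      simpa [Prod.norm_def, D] using h2
    have h3 : |t| * (L * (‖slope W 0 t‖ * |t|) * ‖slope p 0 t‖)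
        = L * ‖slope W 0 t‖ * ‖slope p 0 t‖ * t ^ 2 := by
      rw [← sq_abs t]; ring
    have h4 := (abs_le.1 h1).1
    rw [h3] at h4
    linarith
  rw [hsplit, map_add, map_smul, smul_eq_mul]
  rw [e4] at ht1
  change c + (fderiv ℝ f (W 0) (W t - W 0) + t * fderiv ℝ f (W 0) (0, 0, slope p 0 t))
    - r t * t ^ 2 ≤ _
  have hcW : f (W 0) = c := hc
  rw [hcW, mul_pow, sq_abs] at ht1
  simp only [r]
  rw [mul_sub, mul_add, mul_add, mul_one, e1, e2, e3] at hexp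
  linarith

end

end SumHessian

namespace SumHessian

/-! ### The algebraic inequality at a maximum point -/

/-- A direction in which the third order term is controlled by the first order condition. -/
theorem third_order_bound_of_large {F F₁ lam lam₁ T g x ν β N m M₁ R κ c₀ : ℝ} (hF : 0 < F)
    (hν : 0 < ν) (hβ : 0 < β) (hN : 0 < N) (hm : 0 ≤ m)
    (hg : g ^ 2 ≤ M₁ ^ 2) (hx : x ^ 2 ≤ R ^ 2)
    (hC : T / lam₁ - β * g / ν + N * g * lam + m * x = 0)
    (hNM : 3 * N * M₁ ^ 2 ≤ 1 / 4) (hκ0 : 0 ≤ κ)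
    (hκ : (3 * β ^ 2 + β) * M₁ ^ 2 + 3 * m ^ 2 * R ^ 2 * ν ^ 2 ≤ κ * (ν * lam₁) ^ 2)
    (hc : F * lam₁ ^ 2 ≤ c₀ * (F * lam ^ 2 + F₁ * lam₁ ^ 2)) :
    F * (T ^ 2 / lam₁ ^ 2 + β * g ^ 2 / ν ^ 2)
      ≤ N / 4 * (F * lam ^ 2) + κ * c₀ * (F * lam ^ 2 + F₁ * lam₁ ^ 2) + m / 2 * F := by
  set a := β * (g / ν) with ha
  have hT : T / lam₁ = a - N * g * lam - m * x := by rw [ha]; linarith [mul_div_assoc β g ν]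
  have h1 : (T / lam₁) ^ 2 ≤ 3 * a ^ 2 + 3 * (N * g * lam) ^ 2 + 3 * (m * x) ^ 2 := by
    rw [hT]
    nlinarith [sq_nonneg (a + N * g * lam), sq_nonneg (a + m * x),
      sq_nonneg (N * g * lam - m * x)]
  -- This term is quadratic in `N` while the available good term is linear in it, so `N` small
  -- against `M₁⁻²` suffices.
  have h2 : 3 * (N * g * lam) ^ 2 ≤ N / 4 * lam ^ 2 := by
    have : 3 * N * g ^ 2 ≤ 1 / 4 := le_trans (by nlinarith) hNM
    nlinarith [mul_le_mul_of_nonneg_right this (mul_nonneg hN.le (sq_nonneg lam))]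
  have h3 : 3 * a ^ 2 + β * (g / ν) ^ 2 + 3 * (m * x) ^ 2 ≤ κ * lam₁ ^ 2 := by
    have hν2 : 0 < ν ^ 2 := by positivity
    refine le_of_mul_le_mul_left ?_ hν2
    have e : ν ^ 2 * (3 * a ^ 2 + β * (g / ν) ^ 2 + 3 * (m * x) ^ 2)
        = (3 * β ^ 2 + β) * g ^ 2 + 3 * m ^ 2 * x ^ 2 * ν ^ 2 := by
      rw [ha]; field_simp
    rw [e]
    have h4 : (3 * β ^ 2 + β) * g ^ 2 ≤ (3 * β ^ 2 + β) * M₁ ^ 2 :=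
      mul_le_mul_of_nonneg_left hg (by positivity)
    have h5 : 3 * m ^ 2 * ν ^ 2 * x ^ 2 ≤ 3 * m ^ 2 * ν ^ 2 * R ^ 2 :=
      mul_le_mul_of_nonneg_left hx (by positivity)
    nlinarith
  have h6 : T ^ 2 / lam₁ ^ 2 + β * g ^ 2 / ν ^ 2 ≤ N / 4 * lam ^ 2 + κ * lam₁ ^ 2 := by
    have e1 : T ^ 2 / lam₁ ^ 2 = (T / lam₁) ^ 2 := (div_pow _ _ _).symm
    have e2 : β * g ^ 2 / ν ^ 2 = β * (g / ν) ^ 2 := by rw [div_pow]; ring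
    rw [e1, e2]
    linarith
  have h7 := mul_le_mul_of_nonneg_left h6 hF.le
  have h8 := mul_le_mul_of_nonneg_left hc hκ0
  have h9 : 0 ≤ m / 2 * F := by positivity
  linarith

/-- A direction in which the third order term is controlled by the concavity of the operator. -/
theorem third_order_bound_of_small {F F₁ G lam lam₁ T g x ν β N m M₁ R ε θ η : ℝ} (hF : 0 < F)
    (hlam₁ : 0 < lam₁) (hν : 0 < ν) (hβ : 1 ≤ β) (hN : 0 < N) (hη : 0 < η)
    (hε : 0 < ε) (hε1 : ε < 1) (hg : g ^ 2 ≤ M₁ ^ 2) (hx : x ^ 2 ≤ R ^ 2)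
    (hC : T / lam₁ - β * g / ν + N * g * lam + m * x = 0)
    (hβθ : 1 + (1 + η) / β ≤ 2 * (1 - θ) / (1 + ε))
    (hNM : 2 * (1 + 1 / η) * N * M₁ ^ 2 ≤ 1 / 4) (hm : 0 ≤ m)
    (hmR : 2 * (1 + 1 / η) * m * R ^ 2 ≤ β / 2)
    (hG : G * (lam₁ - lam) = F - F₁) (hG0 : 0 ≤ G) (hlam : |lam| < ε * lam₁) (hFF : F₁ < θ * F) :
    F * (T ^ 2 / lam₁ ^ 2 + β * g ^ 2 / ν ^ 2) - 2 / lam₁ * G * T ^ 2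
      ≤ N / 4 * (F * lam ^ 2) + m / 2 * F := by
  have hβ0 : 0 < β := by linarith
  set τ := T / lam₁ with hτ
  have hT : T = τ * lam₁ := by rw [hτ]; field_simp
  set b := N * g * lam + m * x with hb
  -- Here the first order condition is solved for `g / ν`, opposite to the other case: the good term
  -- of the operator controls `T`, so everything is expressed through `τ = T / λ₁`.
  have hgν : g / ν = (τ + b) / β := by
    field_simp
    have := mul_div_assoc β g ν
    have h : β * (g / ν) = τ + b := by rw [hb]; linarith
    field_simp at h
    linarith
  have h1 : (τ + b) ^ 2 ≤ (1 + η) * τ ^ 2 + (1 + 1 / η) * b ^ 2 := by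
    have : (1 + η) * τ ^ 2 + (1 + 1 / η) * b ^ 2 - (τ + b) ^ 2 = (η * τ - b) ^ 2 / η := by
      field_simp; ring
    have h : 0 ≤ (η * τ - b) ^ 2 / η := by positivity
    linarith
  have h2 : b ^ 2 ≤ 2 * (N * g * lam) ^ 2 + 2 * (m * x) ^ 2 := by
    rw [hb]; nlinarith [sq_nonneg (N * g * lam - m * x)]
  have hη' : 0 < 1 + 1 / η := by positivity
  have h3 : (1 + 1 / η) * (2 * (N * g * lam) ^ 2) ≤ N / 4 * lam ^ 2 * β := by
    have : 2 * (1 + 1 / η) * N * g ^ 2 ≤ 1 / 4 :=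
      le_trans (mul_le_mul_of_nonneg_left hg (by positivity)) hNM
    linarith [mul_le_mul_of_nonneg_right this (mul_nonneg hN.le (sq_nonneg lam)),
      mul_nonneg (mul_nonneg hN.le (sq_nonneg lam)) (sub_nonneg.2 hβ)]
  have h4 : (1 + 1 / η) * (2 * (m * x) ^ 2) ≤ m / 2 * β := by
    have : 2 * (1 + 1 / η) * m * x ^ 2 ≤ β / 2 :=
      le_trans (mul_le_mul_of_nonneg_left hx (by positivity)) hmR
    linarith [mul_le_mul_of_nonneg_right this hm]
  have h5 : β * g ^ 2 / ν ^ 2 ≤ (1 + η) / β * τ ^ 2 + N / 4 * lam ^ 2 + m / 2 := by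
    have e : β * g ^ 2 / ν ^ 2 = (τ + b) ^ 2 / β := by
      rw [mul_div_assoc, ← div_pow, hgν]; field_simp
    rw [e, div_le_iff₀ hβ0]
    have e2 : ((1 + η) / β * τ ^ 2 + N / 4 * lam ^ 2 + m / 2) * β
        = (1 + η) * τ ^ 2 + N / 4 * lam ^ 2 * β + m / 2 * β := by field_simp
    rw [e2]
    linarith [mul_le_mul_of_nonneg_left h2 hη'.le]
  -- The numerator `F - F₁` is at least `(1 - θ) F`, and `λ₁ - λ ≤ (1 + ε) λ₁`.
  have h6 : 2 * (1 - θ) / (1 + ε) * F ≤ 2 * G * lam₁ := by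
    rw [div_mul_eq_mul_div, div_le_iff₀ (by linarith)]
    have h7 := (abs_lt.1 hlam).1
    have := mul_le_mul_of_nonneg_left (show lam₁ - lam ≤ lam₁ * (1 + ε) by linarith) hG0
    linarith
  have h8 : 2 / lam₁ * G * T ^ 2 = 2 * G * lam₁ * τ ^ 2 := by rw [hT]; field_simp
  have h9 : T ^ 2 / lam₁ ^ 2 = τ ^ 2 := by rw [hτ, div_pow]
  rw [h8, h9]
  have h10 := mul_le_mul_of_nonneg_right h6 (sq_nonneg τ)
  have h11 := mul_le_mul_of_nonneg_left h5 hF.le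
  have h12 := mul_le_mul_of_nonneg_right hβθ (mul_nonneg hF.le (sq_nonneg τ))
  linarith

/-! ### The linearised operator and the summation over all directions -/

section
variable {n : ℕ} {K : ℕ} {α : ℝ} {lam : Fin n → ℝ}

/-- The first derivative of `σ_{K+2}(·, α)` in the `i`-th eigenvalue. -/
noncomputable def opD (K : ℕ) (α : ℝ) (lam : Fin n → ℝ) (i : Fin n) : ℝ :=
  esym (Finset.univ.erase (some i)) (K + 1) (withExtra α lam)

/-- The mixed second derivative of `σ_{K+2}(·, α)` in the `i`-th and `j`-th eigenvalues. -/
noncomputable def opDD (K : ℕ) (α : ℝ) (lam : Fin n → ℝ) (i j : Fin n) : ℝ :=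
  esym ((Finset.univ.erase (some i)).erase (some j)) K (withExtra α lam)

theorem opD_pos (h : InCone Finset.univ (K + 2) (withExtra α lam)) (i : Fin n) :
    0 < opD K α lam i := h.erase (Finset.mem_univ _) _ le_rfl

theorem opDD_pos (h : InCone Finset.univ (K + 2) (withExtra α lam)) {i j : Fin n} (hij : i ≠ j) :
    0 < opDD K α lam i j :=
  (h.erase (Finset.mem_univ (some i))).erase (i := some j) (by simp [hij.symm]) _ le_rfl

theorem opDD_comm (i j : Fin n) : opDD K α lam i j = opDD K α lam j i := by
  unfold opDD
  rw [Finset.erase_right_comm]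

theorem opDD_mul_sub {i j : Fin n} (hij : i ≠ j) :
    opDD K α lam i j * (lam i - lam j) = opD K α lam j - opD K α lam i := by
  have h1 := esym_erase (S := Finset.univ.erase (some i)) (i := some j) (by simp [hij.symm]) K
    (withExtra α lam)
  have h2 := esym_erase (S := Finset.univ.erase (some j)) (i := some i) (by simp [hij]) K
    (withExtra α lam)
  rw [Finset.erase_right_comm] at h2
  simp only [withExtra_some] at h1 h2
  unfold opD opDD
  rw [h1, h2]
  ring

/-- Euler's identity over all `n + 1` entries, with the nonnegative contribution of the entry `α`
dropped. -/
theorem sum_mul_opD_le (hα : 0 ≤ α) (h : InCone Finset.univ (K + 2) (withExtra α lam)) :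
    ∑ i, lam i * opD K α lam i ≤ (K + 2) * esym Finset.univ (K + 2) (withExtra α lam) := by
  have h1 := sum_mul_esym_erase (Finset.univ : Finset (Option (Fin n))) (K + 1) (withExtra α lam)
  rw [Fintype.sum_option] at h1
  have h2 : 0 < esym (Finset.univ.erase none) (K + 1) (withExtra α lam) :=
    h.erase (Finset.mem_univ none) _ le_rfl
  simp only [withExtra_none, withExtra_some] at h1
  push_cast at h1
  have h3 := mul_nonneg hα h2.le
  have h4 : ∑ i, lam i * opD K α lam i
      = ∑ x, lam x * esym (Finset.univ.erase (some x)) (K + 1) (withExtra α lam) := rfl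
  rw [h4]
  linarith

theorem op_concave (h : InCone Finset.univ (K + 2) (withExtra α lam)) (w : Fin n → ℝ) :
    ∑ i, ∑ j ∈ Finset.univ.erase i, w i * w j * opDD K α lam i j
      ≤ (K + 1) / (K + 2) * (∑ i, w i * opD K α lam i) ^ 2
        / esym Finset.univ (K + 2) (withExtra α lam) := by
  have h0 := h _ le_rfl
  -- The entry `α` is constant, so its variation is `0`.
  have h1 := h.concave (withExtra 0 w) K
  rw [Fintype.sum_option, Fintype.sum_option] at h1
  simp only [withExtra_none, withExtra_some, zero_mul, zero_add] at h1
  have e : ∀ i : Fin n, ∑ o ∈ Finset.univ.erase (some i), withExtra 0 w o *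
      esym ((Finset.univ.erase (some i)).erase o) K (withExtra α lam)
      = ∑ j ∈ Finset.univ.erase i, w j * opDD K α lam i j := fun i => by
    rw [← insertNone_univ, erase_some, Finset.sum_insertNone]
    simp only [withExtra_none, withExtra_some, zero_mul, zero_add]
    refine Finset.sum_congr rfl fun j _ => ?_
    rw [opDD, ← insertNone_univ, erase_some, erase_some, erase_some]
  simp only [e] at h1
  have e2 : ∑ i, ∑ j ∈ Finset.univ.erase i, w i * w j * opDD K α lam i j
      = ∑ i, w i * ∑ j ∈ Finset.univ.erase i, w j * opDD K α lam i j := by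
    simp only [Finset.mul_sum, mul_assoc]
  rw [e2, le_div_iff₀ h0, div_mul_eq_mul_div, le_div_iff₀ (by positivity)]
  have e3 : ∑ i, w i * opD K α lam i
      = ∑ i, w i * esym (Finset.univ.erase (some i)) (K + 1) (withExtra α lam) := rfl
  rw [e3]
  linarith

theorem third_order_sum_bound (hcone : InCone Finset.univ (K + 2) (withExtra α lam)) {i₁ : Fin n}
    (hlam₁ : 0 < lam i₁) {g x T : Fin n → ℝ} {ν β N m M₁ R κ c₀ ε θ η : ℝ}
    (hν : 0 < ν) (hβ : 1 ≤ β) (hN : 0 < N) (hm : 0 ≤ m) (hη : 0 < η) (hε : 0 < ε) (hε1 : ε < 1)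
    (hg : ∀ i, g i ^ 2 ≤ M₁ ^ 2) (hx : ∀ i, x i ^ 2 ≤ R ^ 2)
    (hC : ∀ i, T i / lam i₁ - β * g i / ν + N * g i * lam i + m * x i = 0)
    (hβθ : 1 + (1 + η) / β ≤ 2 * (1 - θ) / (1 + ε))
    (hNM : 3 * N * M₁ ^ 2 ≤ 1 / 4) (hNM' : 2 * (1 + 1 / η) * N * M₁ ^ 2 ≤ 1 / 4)
    (hmR : 2 * (1 + 1 / η) * m * R ^ 2 ≤ β / 2) (hκ0 : 0 ≤ κ)
    (hκ : (3 * β ^ 2 + β) * M₁ ^ 2 + 3 * m ^ 2 * R ^ 2 * ν ^ 2 ≤ κ * (ν * lam i₁) ^ 2)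
    (hc₀ : 1 ≤ c₀) (hc₀ε : 1 ≤ c₀ * ε ^ 2) (hc₀θ : 1 ≤ c₀ * θ)
    (hκN : κ * c₀ * (n + 1) ≤ N / 4) :
    ∑ i, opD K α lam i * (T i ^ 2 / lam i₁ ^ 2 + β * g i ^ 2 / ν ^ 2)
        - 2 / lam i₁ * ∑ j ∈ Finset.univ.erase i₁, opDD K α lam i₁ j * T j ^ 2
      ≤ N / 2 * ∑ i, opD K α lam i * lam i ^ 2 + m / 2 * ∑ i, opD K α lam i := by
  have hF := opD_pos hcone
  have hβ0 : 0 < β := by linarith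
  have hc0 : 0 < c₀ := by linarith
  set F := opD K α lam
  let G : Fin n → ℝ := fun j => if j = i₁ then 0 else opDD K α lam i₁ j
  have hGsum : ∑ j ∈ Finset.univ.erase i₁, opDD K α lam i₁ j * T j ^ 2 = ∑ j, G j * T j ^ 2 := by
    rw [← Finset.add_sum_erase Finset.univ _ (Finset.mem_univ i₁)]
    simp only [G, if_true, zero_mul, zero_add]
    refine Finset.sum_congr rfl fun j hj => ?_
    rw [if_neg (Finset.ne_of_mem_erase hj)]
  have hG0 : ∀ j, 0 ≤ G j := fun j => by
    simp only [G]
    split_ifs with h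
    · exact le_rfl
    · exact (opDD_pos hcone (Ne.symm h)).le
  have hF₁ : 0 ≤ F i₁ * lam i₁ ^ 2 := mul_nonneg (hF i₁).le (sq_nonneg _)
  have hκc : 0 ≤ κ * c₀ := by positivity
  have hi : ∀ i, F i * (T i ^ 2 / lam i₁ ^ 2 + β * g i ^ 2 / ν ^ 2) - 2 / lam i₁ * (G i * T i ^ 2)
      ≤ N / 4 * (F i * lam i ^ 2) + κ * c₀ * (F i * lam i ^ 2 + F i₁ * lam i₁ ^ 2)
        + m / 2 * F i := by
    intro i
    have hFi : 0 ≤ F i * lam i ^ 2 := mul_nonneg (hF i).le (sq_nonneg _)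
    have hGT : 0 ≤ 2 / lam i₁ * (G i * T i ^ 2) := by have := hG0 i; positivity
    -- Outside the good case, one of `i = i₁`, `|λ_i| ≥ ε λ₁`, `F₁ ≥ θ F_i` holds, and each bounds
    -- `F_i λ₁²` by `c₀ (F_i λ_i² + F₁ λ₁²)`.
    by_cases hgood : i ≠ i₁ ∧ |lam i| < ε * lam i₁ ∧ F i₁ < θ * F i
    · obtain ⟨h1, h2, h3⟩ := hgood
      have hGi : G i = opDD K α lam i₁ i := if_neg h1
      have := third_order_bound_of_small (hF i) hlam₁ hν hβ hN hη hε hε1 (hg i) (hx i) (hC i)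
        hβθ hNM' hm hmR (G := G i) (by rw [hGi]; exact opDD_mul_sub (Ne.symm h1)) (hG0 i) h2 h3
      have h4 : 0 ≤ κ * c₀ * (F i * lam i ^ 2 + F i₁ * lam i₁ ^ 2) :=
        mul_nonneg hκc (by linarith)
      linarith
    · have hcF : F i * lam i₁ ^ 2 ≤ c₀ * (F i * lam i ^ 2 + F i₁ * lam i₁ ^ 2) := by
        rcases eq_or_ne i i₁ with rfl | h1
        · nlinarith
        rcases le_or_gt (ε * lam i₁) |lam i| with h2 | h2
        · have h3 : ε ^ 2 * lam i₁ ^ 2 ≤ lam i ^ 2 := by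
            rw [← sq_abs (lam i), ← mul_pow]
            exact pow_le_pow_left₀ (by positivity) h2 2
          have h4 := mul_le_mul_of_nonneg_left h3 (mul_nonneg hc0.le (hF i).le)
          have h5 := mul_le_mul_of_nonneg_right hc₀ε (mul_nonneg (hF i).le (sq_nonneg (lam i₁)))
          nlinarith
        · have h3 : θ * F i ≤ F i₁ := by
            by_contra! h4
            exact hgood ⟨h1, h2, h4⟩
          have h4 := mul_le_mul_of_nonneg_left h3 (mul_nonneg hc0.le (sq_nonneg (lam i₁)))
          have h5 := mul_le_mul_of_nonneg_right hc₀θ (mul_nonneg (hF i).le (sq_nonneg (lam i₁)))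
          nlinarith
      have := third_order_bound_of_large (hF i) hν hβ0 hN hm (hg i) (hx i) (hC i) hNM hκ0
        hκ hcF
      linarith
  have hsum := Finset.sum_le_sum fun i (_ : i ∈ Finset.univ) => hi i
  simp only [Finset.sum_add_distrib, Finset.sum_sub_distrib, ← Finset.mul_sum, mul_add,
    Finset.sum_const, Finset.card_univ, Fintype.card_fin, nsmul_eq_mul] at hsum
  rw [hGsum]
  simp only [mul_add, Finset.sum_add_distrib]
  have h1 : F i₁ * lam i₁ ^ 2 ≤ ∑ i, F i * lam i ^ 2 :=
    Finset.single_le_sum (f := fun i => F i * lam i ^ 2)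
      (fun i _ => mul_nonneg (hF i).le (sq_nonneg _)) (Finset.mem_univ i₁)
  have h2 : n * (κ * c₀ * (F i₁ * lam i₁ ^ 2)) ≤ n * (κ * c₀ * ∑ i, F i * lam i ^ 2) := by
    gcongr
  have h3 := mul_le_mul_of_nonneg_right hκN (hF₁.trans h1)
  linarith

/-- The consequence of the second derivative test and of the twice differentiated equation. -/
theorem max_point_inequality (hα : 0 ≤ α)
    (hcone : InCone Finset.univ (K + 2) (withExtra α lam)) {i₁ : Fin n}
    (hlam₁ : 0 < lam i₁) {g x D : Fin n → ℝ} {A V : Matrix (Fin n) (Fin n) ℝ}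
    {ν β N m M₁ R κ c₀ ε θ η h₂ : ℝ}
    (hν : 0 < ν) (hβ : 1 ≤ β) (hN : 0 < N) (hm : 0 ≤ m) (hη : 0 < η) (hε : 0 < ε) (hε1 : ε < 1)
    (hg : ∀ i, g i ^ 2 ≤ M₁ ^ 2) (hx : ∀ i, x i ^ 2 ≤ R ^ 2) (hA : ∀ i j, A i j = A j i)
    (hC : ∀ i, A i₁ i / lam i₁ - β * g i / ν + N * g i * lam i + m * x i = 0)
    (hS : ∀ i, D i / lam i₁ - A i₁ i ^ 2 / lam i₁ ^ 2 - β * lam i / ν - β * g i ^ 2 / ν ^ 2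
      + N * (lam i ^ 2 + ∑ j, g j * V j i) + m ≤ 0)
    (hβθ : 1 + (1 + η) / β ≤ 2 * (1 - θ) / (1 + ε))
    (hNM : 3 * N * M₁ ^ 2 ≤ 1 / 4) (hNM' : 2 * (1 + 1 / η) * N * M₁ ^ 2 ≤ 1 / 4)
    (hmR : 2 * (1 + 1 / η) * m * R ^ 2 ≤ β / 2) (hκ0 : 0 ≤ κ)
    (hκ : (3 * β ^ 2 + β) * M₁ ^ 2 + 3 * m ^ 2 * R ^ 2 * ν ^ 2 ≤ κ * (ν * lam i₁) ^ 2)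
    (hc₀ : 1 ≤ c₀) (hc₀ε : 1 ≤ c₀ * ε ^ 2) (hc₀θ : 1 ≤ c₀ * θ)
    (hκN : κ * c₀ * (n + 1) ≤ N / 4)
    (hh₂ : h₂ = ∑ i, (D i * opD K α lam i + ∑ j ∈ Finset.univ.erase i,
      (A i i * A j j - A i j * A j i) * opDD K α lam i j)) :
    (h₂ - (K + 1) / (K + 2) * (∑ i, A i i * opD K α lam i) ^ 2
        / esym Finset.univ (K + 2) (withExtra α lam)) / lam i₁
      + N * ∑ j, g j * ∑ i, V j i * opD K α lam i
      + N / 2 * ∑ i, opD K α lam i * lam i ^ 2 + m / 2 * ∑ i, opD K α lam i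
      ≤ β * ((K + 2) * esym Finset.univ (K + 2) (withExtra α lam)) / ν := by
  have hF := opD_pos hcone
  have hthird := third_order_sum_bound hcone hlam₁ hν hβ hN hm hη hε hε1 hg hx hC hβθ hNM
    hNM' hmR hκ0 hκ hc₀ hc₀ε hc₀θ hκN
  have hconc := op_concave hcone fun i => A i i
  have hsumF := sum_mul_opD_le hα hcone
  set F := opD K α lam
  set G := opDD K α lam
  set h := esym Finset.univ (K + 2) (withExtra α lam)
  -- All off-diagonal terms are nonnegative by symmetry of `A`; only the pairs `(i₁, j)` and `(j,
  -- i₁)` are kept, whence the factor `2`.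
  have hoff : 2 * ∑ j ∈ Finset.univ.erase i₁, G i₁ j * A i₁ j ^ 2
      ≤ ∑ i, ∑ j ∈ Finset.univ.erase i, A i j * A j i * G i j := by
    have hnn : ∀ i, ∀ j ∈ Finset.univ.erase i, 0 ≤ A i j * A j i * G i j := fun i j hj => by
      rw [hA j i]
      exact mul_nonneg (mul_self_nonneg _) (opDD_pos hcone (Finset.ne_of_mem_erase hj).symm).le
    rw [← Finset.add_sum_erase Finset.univ _ (Finset.mem_univ i₁), two_mul]
    refine add_le_add (le_of_eq ?_) ?_
    · exact Finset.sum_congr rfl fun j _ => by rw [hA j i₁]; ring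
    · refine Finset.sum_le_sum fun i hi => ?_
      have hi₁ : i₁ ∈ Finset.univ.erase i := by simp [(Finset.ne_of_mem_erase hi).symm]
      refine le_trans (le_of_eq ?_) (Finset.single_le_sum (hnn i) hi₁)
      rw [hA i i₁, show G i₁ i = G i i₁ from opDD_comm _ _]; ring
  have hD : h₂ - (K + 1) / (K + 2) * (∑ i, A i i * F i) ^ 2 / h
      + 2 * ∑ j ∈ Finset.univ.erase i₁, G i₁ j * A i₁ j ^ 2 ≤ ∑ i, D i * F i := by
    have e : h₂ = ∑ i, D i * F i + (∑ i, ∑ j ∈ Finset.univ.erase i, A i i * A j j * G i j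
        - ∑ i, ∑ j ∈ Finset.univ.erase i, A i j * A j i * G i j) := by
      rw [hh₂]
      simp only [sub_mul, Finset.sum_add_distrib, Finset.sum_sub_distrib]
    linarith
  have hsum : ∑ i, F i * (D i / lam i₁ - A i₁ i ^ 2 / lam i₁ ^ 2 - β * lam i / ν
      - β * g i ^ 2 / ν ^ 2 + N * (lam i ^ 2 + ∑ j, g j * V j i) + m) ≤ 0 :=
    Finset.sum_nonpos fun i _ => mul_nonpos_of_nonneg_of_nonpos (hF i).le (hS i)
  have e : ∑ i, F i * (D i / lam i₁ - A i₁ i ^ 2 / lam i₁ ^ 2 - β * lam i / ν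
      - β * g i ^ 2 / ν ^ 2 + N * (lam i ^ 2 + ∑ j, g j * V j i) + m)
      = (∑ i, D i * F i) / lam i₁ - ∑ i, F i * (A i₁ i ^ 2 / lam i₁ ^ 2 + β * g i ^ 2 / ν ^ 2)
        - β / ν * ∑ i, lam i * F i + N * ∑ i, F i * lam i ^ 2
        + N * (∑ j, g j * ∑ i, V j i * F i) + m * ∑ i, F i := by
    have e1 : ∑ j, g j * ∑ i, V j i * F i = ∑ i, F i * ∑ j, g j * V j i := by
      simp only [Finset.mul_sum]
      rw [Finset.sum_comm]
      exact Finset.sum_congr rfl fun i _ => Finset.sum_congr rfl fun j _ => by ring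
    rw [e1, Finset.sum_div, Finset.mul_sum, Finset.mul_sum, Finset.mul_sum, Finset.mul_sum,
      ← Finset.sum_sub_distrib, ← Finset.sum_sub_distrib, ← Finset.sum_add_distrib,
      ← Finset.sum_add_distrib, ← Finset.sum_add_distrib]
    exact Finset.sum_congr rfl fun i _ => by ring
  rw [e] at hsum
  have h1 : β / ν * ∑ i, lam i * F i ≤ β * ((K + 2) * h) / ν := by
    rw [mul_div_right_comm]
    exact mul_le_mul_of_nonneg_left hsumF (by positivity)
  have h2 := div_le_div_of_nonneg_right hD hlam₁.le
  rw [add_div] at h2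
  have h3 : 2 * (∑ j ∈ Finset.univ.erase i₁, G i₁ j * A i₁ j ^ 2) / lam i₁
      = 2 / lam i₁ * ∑ j ∈ Finset.univ.erase i₁, G i₁ j * A i₁ j ^ 2 := by ring
  rw [h3] at h2
  linarith

end

end SumHessian

namespace SumHessian
open Filter Topology Matrix

/-! ### The differential inequalities at a maximum point -/

section
variable {n : ℕ} {Ω : Set (EuclideanSpace ℝ (Fin n))} {u : EuclideanSpace ℝ (Fin n) → ℝ}
  {x₀ : EuclideanSpace ℝ (Fin n)}

local notation "E" => EuclideanSpace ℝ (Fin n)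

theorem gradient_eq_sum (b : OrthonormalBasis (Fin n) ℝ E) (u : E → ℝ) (x : E) :
    gradient u x = ∑ j, dirDeriv (b j) u x • b j := by
  rw [← b.sum_repr' (gradient u x)]
  refine Finset.sum_congr rfl fun j _ => ?_
  rw [real_inner_comm, gradient, InnerProductSpace.toDual_symm_apply]
  rfl

theorem sum_sq_dirDeriv (b : OrthonormalBasis (Fin n) ℝ E) (u : E → ℝ) (x : E) :
    ∑ j, dirDeriv (b j) u x ^ 2 = ‖gradient u x‖ ^ 2 := by
  rw [← b.sum_sq_norm_inner_right]
  refine Finset.sum_congr rfl fun j _ => ?_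
  rw [real_inner_comm, gradient, InnerProductSpace.toDual_symm_apply, Real.norm_eq_abs, sq_abs]
  rfl

theorem abs_dirDeriv_le (b : OrthonormalBasis (Fin n) ℝ E) (u : E → ℝ) (x : E) (j : Fin n) :
    |dirDeriv (b j) u x| ≤ ‖gradient u x‖ := by
  refine abs_le_of_sq_le_sq ?_ (norm_nonneg _)
  rw [← sum_sq_dirDeriv b]
  exact Finset.single_le_sum (f := fun j => dirDeriv (b j) u x ^ 2) (fun _ _ => sq_nonneg _)
    (Finset.mem_univ j)

/-- The matrix of third derivatives `∂₁ ∂ᵢ ∂ⱼ u`. -/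
noncomputable def thirdDeriv (b : OrthonormalBasis (Fin n) ℝ E) (v : E) (u : E → ℝ) (x : E) :
    Matrix (Fin n) (Fin n) ℝ :=
  Matrix.of fun i j => dirDeriv v (dirDeriv (b i) (dirDeriv (b j) u)) x

theorem thirdDeriv_symm (hΩ : IsOpen Ω) (hu : ContDiffOn ℝ 4 u Ω) (hx₀ : x₀ ∈ Ω)
    (b : OrthonormalBasis (Fin n) ℝ E) (v : E) (i j : Fin n) :
    thirdDeriv b v u x₀ i j = thirdDeriv b v u x₀ j i :=
  dirDeriv_congr hΩ (fun _ hy => dirDeriv_comm hΩ (hu.of_le (by norm_num)) hy _ _) hx₀ v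

/-- First and second order conditions at a maximum of the test function. -/
theorem max_conditions (hΩ : IsOpen Ω) (hu : ContDiffOn ℝ 4 u Ω) (hx₀ : x₀ ∈ Ω)
    {b : OrthonormalBasis (Fin n) ℝ E} {lam : Fin n → ℝ}
    (hb : hessianIn b u x₀ = diagonal lam) {i₁ : Fin n} (hlam₁ : 0 < lam i₁) {β N m e : ℝ}
    (hν : 0 < -u x₀ - e) (i : Fin n)
    (hmax : IsLocalMax (fun t : ℝ =>
      Real.log (dirDeriv (b i₁) (dirDeriv (b i₁) u) (x₀ + t • b i))
        + β * Real.log (-u (x₀ + t • b i) - e)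
        + N / 2 * ∑ j, dirDeriv (b j) u (x₀ + t • b i) ^ 2
        + m / 2 * ‖x₀ + t • b i‖ ^ 2) 0) :
    thirdDeriv b (b i₁) u x₀ i₁ i / lam i₁ - β * dirDeriv (b i) u x₀ / (-u x₀ - e)
        + N * dirDeriv (b i) u x₀ * lam i + m * inner ℝ x₀ (b i) = 0 ∧
    dirDeriv (b i₁) (dirDeriv (b i₁) (dirDeriv (b i) (dirDeriv (b i) u))) x₀ / lam i₁
      - thirdDeriv b (b i₁) u x₀ i₁ i ^ 2 / lam i₁ ^ 2 - β * lam i / (-u x₀ - e)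
      - β * dirDeriv (b i) u x₀ ^ 2 / (-u x₀ - e) ^ 2
      + N * (lam i ^ 2 + ∑ j, dirDeriv (b j) u x₀ *
          dirDeriv (b i) (dirDeriv (b i) (dirDeriv (b j) u)) x₀) + m ≤ 0 := by
  have h3 : ∀ a, ContDiffOn ℝ 3 (dirDeriv a u) Ω := fun a => contDiffOn_dirDeriv (m := 3) hΩ hu a
  have h2 : ∀ a c, ContDiffOn ℝ 2 (dirDeriv a (dirDeriv c u)) Ω := fun a c =>
    contDiffOn_dirDeriv (m := 2) hΩ (h3 c) a
  have hent : ∀ p q, dirDeriv (b p) (dirDeriv (b q) u) x₀ = diagonal lam p q := fun p q => by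
    rw [← hb]; rfl
  have j1 := (jet2_line hΩ (h2 (b i₁) (b i₁)) hx₀ (b i)).log (by
    rw [hent, diagonal_apply_eq]; exact hlam₁.ne')
  have j2 := (((jet2_line hΩ (hu.of_le (by norm_num)) hx₀ (b i)).neg.sub (Jet2.const e)).log
    hν.ne').const_mul β
  have j3 := (Jet2.sum Finset.univ fun j _ => ((jet2_line hΩ ((h3 (b j)).of_le (by norm_num))
    hx₀ (b i)).mul (jet2_line hΩ ((h3 (b j)).of_le (by norm_num)) hx₀ (b i)))).const_mul (N / 2)
  have j4 : Jet2 (fun t : ℝ => m / 2 * ‖x₀ + t • b i‖ ^ 2) (m / 2 * ‖x₀‖ ^ 2)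
      (m / 2 * (2 * inner ℝ x₀ (b i))) (m / 2 * 2) := by
    refine Jet2.const_mul ?_ _
    have := ((Jet2.affine (‖x₀‖ ^ 2) (2 * inner ℝ x₀ (b i))).add
      ((Jet2.affine 0 1).mul (Jet2.affine 0 1)))
    refine (this.congr (.of_forall fun t => ?_)).cast (by ring) (by ring) (by ring)
    rw [norm_add_sq_real, norm_smul, b.norm_eq_one, inner_smul_right, Real.norm_eq_abs, mul_one,
      sq_abs]
    ring
  have j := ((j1.add j2).add j3).add j4
  simp only [← pow_two] at j
  obtain ⟨hC, hS⟩ := j.of_isLocalMax hmax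
  rw [dirDeriv_comm_triple hΩ (hu.of_le (by norm_num)) hx₀] at hC hS
  have hT : ∀ j, dirDeriv (b i₁) (dirDeriv (b i₁) (dirDeriv (b j) u)) x₀
    = thirdDeriv b (b i₁) u x₀ i₁ j := fun j => rfl
  have hsingle : ∀ c : Fin n → ℝ, ∑ j, c j * diagonal lam i j = c i * lam i := fun c => by
    rw [Finset.sum_eq_single i (fun j _ hj => by rw [diagonal_apply_ne _ hj.symm, mul_zero])
      (by simp), diagonal_apply_eq]
  have hsq : ∀ p : Fin n, diagonal lam i p ^ 2 = diagonal lam i p * diagonal lam i p :=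
    fun p => sq _
  -- The test function produces `u_11ii` differentiated twice along `b i`; the differentiated
  -- equation needs the order along `b i₁`.
  rw [dirDeriv_comm_pairs hΩ hu hx₀] at hS
  simp only [hT, hent, diagonal_apply_eq] at hC hS
  constructor
  · rw [← hC]
    have : ∑ j, (diagonal lam i j * dirDeriv (b j) u x₀ + dirDeriv (b j) u x₀ * diagonal lam i j)
        = 2 * (dirDeriv (b i) u x₀ * lam i) := by
      rw [← hsingle fun j => dirDeriv (b j) u x₀, Finset.mul_sum]
      exact Finset.sum_congr rfl fun j _ => by ring
    rw [this]
    ring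
  · refine le_trans (le_of_eq ?_) hS
    have : ∑ j, (dirDeriv (b i) (dirDeriv (b i) (dirDeriv (b j) u)) x₀ * dirDeriv (b j) u x₀
        + 2 * diagonal lam i j ^ 2
        + dirDeriv (b j) u x₀ * dirDeriv (b i) (dirDeriv (b i) (dirDeriv (b j) u)) x₀)
        = 2 * (lam i ^ 2 + ∑ j, dirDeriv (b j) u x₀ *
          dirDeriv (b i) (dirDeriv (b i) (dirDeriv (b j) u)) x₀) := by
      have e : lam i ^ 2 = ∑ j, diagonal lam i j * diagonal lam i j := by
        rw [hsingle, diagonal_apply_eq, sq]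
      rw [e, ← Finset.sum_add_distrib, Finset.mul_sum]
      exact Finset.sum_congr rfl fun j _ => by ring
    rw [this]
    ring

variable {K : ℕ} {α : ℝ}
  {f : EuclideanSpace ℝ (Fin n) × ℝ × EuclideanSpace ℝ (Fin n) → ℝ}

theorem IsDirichletSolution.equation_esym (hu : IsDirichletSolution (K + 2) α f Ω u)
    {x : E} (hx : x ∈ Ω) :
    esym Finset.univ (K + 2) (withExtra α (hessianEigenvalues u x))
      = f (x, u x, gradient u x) := by
  rw [esym_withExtra_univ, ← hu.equation x hx]
  rfl

/-- Below order `K + 2` positivity follows from `(K+1)`-convexity and `α > 0`; the top order is the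
equation with `f > 0`. -/
theorem IsDirichletSolution.inCone (hu : IsDirichletSolution (K + 2) α f Ω u) (hα : 0 < α)
    (hpos : ∀ x ∈ closure Ω, ∀ (z : ℝ) (p : E), 0 < f (x, z, p)) {x : E} (hx : x ∈ Ω) :
    InCone Finset.univ (K + 2) (withExtra α (hessianEigenvalues u x)) := by
  have hs : ∀ j ≤ K + 1, 0 < sigma j (hessianEigenvalues u x) := fun j hj => by
    rcases Nat.eq_zero_or_pos j with rfl | h
    · simp [sigma_eq_esym]
    · exact hu.convex.2 x hx j h (by omega)
  intro j hj
  rcases j with - | j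
  · simp
  rcases Nat.lt_or_ge j (K + 1) with h | h
  · rw [esym_withExtra_univ]
    have h1 := hs (j + 1) (by omega)
    have h2 := hs j (by omega)
    positivity
  · obtain rfl : j = K + 1 := by omega
    rw [hu.equation_esym hx]
    exact hpos x (subset_closure hx) _ _

/-- The equation differentiated twice along a line. -/
theorem IsDirichletSolution.jet2_equation (hu : IsDirichletSolution (K + 2) α f Ω u)
    (hΩ : IsOpen Ω) (hx₀ : x₀ ∈ Ω) {b : OrthonormalBasis (Fin n) ℝ E} {lam : Fin n → ℝ}
    (hb : hessianIn b u x₀ = diagonal lam) (v : E) :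
    Jet2 (fun t : ℝ => f (x₀ + t • v, u (x₀ + t • v), gradient u (x₀ + t • v)))
      (esym Finset.univ (K + 2) (withExtra α lam))
      (∑ i, thirdDeriv b v u x₀ i i * opD K α lam i)
      (∑ i, (dirDeriv v (dirDeriv v (dirDeriv (b i) (dirDeriv (b i) u))) x₀ * opD K α lam i
        + ∑ j ∈ Finset.univ.erase i, (thirdDeriv b v u x₀ i i * thirdDeriv b v u x₀ j j
          - thirdDeriv b v u x₀ i j * thirdDeriv b v u x₀ j i) * opDD K α lam i j)) := by
  have hu4 := hu.contDiffOn
  have hjet : ∀ i j, Jet2 (fun t : ℝ => hessianIn b u (x₀ + t • v) i j) (diagonal lam i j)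
      (thirdDeriv b v u x₀ i j)
      ((Matrix.of fun i j => dirDeriv v (dirDeriv v (dirDeriv (b i) (dirDeriv (b j) u))) x₀ :
        Matrix (Fin n) (Fin n) ℝ) i j) := by
    intro i j
    rw [← hb]
    exact jet2_line hΩ (contDiffOn_dirDeriv (m := 2) hΩ
      (contDiffOn_dirDeriv (m := 3) hΩ hu4 _) _) hx₀ v
  have := jet2_esym_of_det hjet (μ := fun t => hessianEigenvalues u (x₀ + t • v)) (by
    filter_upwards [eventually_line_mem hΩ hx₀ v] with t ht s
    exact det_one_add_hessianIn_eq_prod hΩ (hu4.of_le (by norm_num)) ht b s) α K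
  -- The equation transfers the 2-jet of the operator to the right-hand side, although `f` itself
  -- has no second derivative.
  refine this.congr ?_
  filter_upwards [eventually_line_mem hΩ hx₀ v] with t ht
  exact hu.equation_esym ht

theorem hasDerivAt_gradient_line (hΩ : IsOpen Ω) (hu : ContDiffOn ℝ 4 u Ω) (hx₀ : x₀ ∈ Ω)
    {b : OrthonormalBasis (Fin n) ℝ E} {lam : Fin n → ℝ}
    (hb : hessianIn b u x₀ = diagonal lam) (i : Fin n) :
    HasDerivAt (fun t : ℝ => gradient u (x₀ + t • b i)) (lam i • b i) 0 := by
  have h3 : ∀ a, ContDiffOn ℝ 3 (dirDeriv a u) Ω := fun a => contDiffOn_dirDeriv (m := 3) hΩ hu a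
  have h : HasDerivAt (fun t : ℝ => ∑ j, dirDeriv (b j) u (x₀ + t • b i) • b j)
      (∑ j, dirDeriv (b i) (dirDeriv (b j) u) x₀ • b j) 0 :=
    HasDerivAt.fun_sum fun j _ =>
      ((jet2_line hΩ ((h3 (b j)).of_le (by norm_num)) hx₀ (b i)).hasDerivAt).smul_const _
  have e : ∑ j, dirDeriv (b i) (dirDeriv (b j) u) x₀ • b j = lam i • b i := by
    rw [Finset.sum_eq_single i]
    · have := congrFun (congrFun hb i) i
      rw [hessianIn_apply, diagonal_apply_eq] at this
      rw [this]
    · intro j _ hj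
      have := congrFun (congrFun hb i) j
      rw [hessianIn_apply, diagonal_apply_ne _ hj.symm] at this
      rw [this, zero_smul]
    · simp
  rw [e] at h
  refine h.congr_of_eventuallyEq (.of_forall fun t => ?_)
  exact gradient_eq_sum b u _

/-- The right-hand side of the equation, linearised, along a line. -/
theorem jet2_linearised (hΩ : IsOpen Ω) (hu : ContDiffOn ℝ 4 u Ω) (hx₀ : x₀ ∈ Ω)
    {b : OrthonormalBasis (Fin n) ℝ E} {lam : Fin n → ℝ}
    (hb : hessianIn b u x₀ = diagonal lam) (i : Fin n) (ℓ : E × ℝ × E →L[ℝ] ℝ) :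
    Jet2 (fun t : ℝ => ℓ ((x₀ + t • b i, u (x₀ + t • b i), gradient u (x₀ + t • b i))
        - (x₀ + (0 : ℝ) • b i, u (x₀ + (0 : ℝ) • b i), gradient u (x₀ + (0 : ℝ) • b i)))) 0
      (ℓ (b i, dirDeriv (b i) u x₀, lam i • b i))
      (lam i * ℓ (0, 1, 0) + ∑ j, ℓ (0, 0, b j) * thirdDeriv b (b i) u x₀ i j) := by
  have h3 : ∀ a, ContDiffOn ℝ 3 (dirDeriv a u) Ω := fun a => contDiffOn_dirDeriv (m := 3) hΩ hu a
  have hent : ∀ p q, dirDeriv (b p) (dirDeriv (b q) u) x₀ = diagonal lam p q := fun p q => by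
    rw [← hb]; rfl
  have j1 := Jet2.affine 0 (ℓ (b i, 0, 0))
  have j2 := ((jet2_line hΩ (hu.of_le (by norm_num)) hx₀ (b i)).sub
    (Jet2.const (u x₀))).const_mul (ℓ (0, 1, 0))
  have j3 := Jet2.sum Finset.univ fun j _ => ((jet2_line hΩ ((h3 (b j)).of_le (by norm_num))
    hx₀ (b i)).sub (Jet2.const (dirDeriv (b j) u x₀))).const_mul (ℓ (0, 0, b j))
  have hsplit : ∀ (v : E) (s : ℝ) (c : Fin n → ℝ), ℓ (v, s, ∑ j, c j • b j)
      = ℓ (v, 0, 0) + ℓ (0, 1, 0) * s + ∑ j, ℓ (0, 0, b j) * c j := by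
    intro v s c
    have e : ((v, s, ∑ j, c j • b j) : E × ℝ × E)
        = (v, 0, 0) + s • (0, 1, 0) + ∑ j, c j • (0, 0, b j) := by
      refine Prod.ext ?_ (Prod.ext ?_ ?_) <;> simp [Prod.fst_sum, Prod.snd_sum]
    rw [e, map_add, map_add, map_smul, map_sum]
    simp only [map_smul, smul_eq_mul]
    congr 1
    · ring
    · exact Finset.sum_congr rfl fun j _ => mul_comm _ _
  refine (((j1.add j2).add j3).congr (.of_forall fun t => ?_)).cast (by simp) ?_ ?_
  · simp only [zero_smul, add_zero, Prod.mk_sub_mk, add_sub_cancel_left]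
    rw [gradient_eq_sum b u (x₀ + t • b i), gradient_eq_sum b u x₀, ← Finset.sum_sub_distrib]
    simp only [← sub_smul]
    rw [hsplit]
    have : ((t • b i, 0, 0) : E × ℝ × E) = t • (b i, 0, 0) := by simp
    rw [this, map_smul, smul_eq_mul]
    ring
  · have e : lam i • b i = ∑ j, diagonal lam i j • b j := by
      rw [Finset.sum_eq_single i (fun j _ hj => by rw [diagonal_apply_ne _ hj.symm, zero_smul])
        (by simp), diagonal_apply_eq]
    rw [e, hsplit]
    simp only [hent, sub_zero]
  · simp only [hent, diagonal_apply_eq, sub_zero, zero_add]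
    congr 1
    exact mul_comm _ _

end

end SumHessian

namespace SumHessian
open Filter Topology Matrix

/-! ### Quantitative form of the inequality at a maximum point -/

section
variable {n : ℕ} {Ω : Set (EuclideanSpace ℝ (Fin n))} {u : EuclideanSpace ℝ (Fin n) → ℝ}
  {x₀ : EuclideanSpace ℝ (Fin n)} {K : ℕ} {α : ℝ}
  {f : EuclideanSpace ℝ (Fin n) × ℝ × EuclideanSpace ℝ (Fin n) → ℝ}

local notation "E" => EuclideanSpace ℝ (Fin n)

/-- Bounds for `f` and its derivative on `Ω × B_R`. -/
structure DataBounds (Ω : Set (EuclideanSpace ℝ (Fin n)))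
    (f : EuclideanSpace ℝ (Fin n) × ℝ × EuclideanSpace ℝ (Fin n) → ℝ)
    (R c C C₁ : ℝ) (L : NNReal) : Prop where
  lipschitz : LipschitzOnWith L (fderiv ℝ f) (Ω ×ˢ Metric.closedBall 0 R)
  pos : 0 < c
  nonneg : 0 ≤ C₁
  lower : ∀ X ∈ Ω ×ˢ Metric.closedBall (0 : ℝ × EuclideanSpace ℝ (Fin n)) R, c ≤ f X
  upper : ∀ X ∈ Ω ×ˢ Metric.closedBall (0 : ℝ × EuclideanSpace ℝ (Fin n)) R, f X ≤ C
  deriv : ∀ X ∈ Ω ×ˢ Metric.closedBall (0 : ℝ × EuclideanSpace ℝ (Fin n)) R, ‖fderiv ℝ f X‖ ≤ C₁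

theorem IsC11.exists_dataBounds (hf : IsC11 Ω f) (hne : Ω.Nonempty)
    (hbdd : Bornology.IsBounded Ω)
    (hpos : ∀ x ∈ closure Ω, ∀ (z : ℝ) (p : E), 0 < f (x, z, p)) {R : ℝ} (hR : 0 ≤ R) :
    ∃ c C C₁ L, DataBounds Ω f R c C C₁ L := by
  obtain ⟨L, hL⟩ := hf.lipschitz_fderiv R
  obtain ⟨a, ha⟩ := hne
  have hcomp : IsCompact (closure Ω ×ˢ Metric.closedBall (0 : ℝ × E) R) :=
    hbdd.isCompact_closure.prod (isCompact_closedBall _ _)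
  have hcont : ContinuousOn f (closure Ω ×ˢ Metric.closedBall (0 : ℝ × E) R) :=
    hf.continuousOn.mono (Set.prod_mono_right (Set.subset_univ _))
  have hmem : ((a, 0) : E × ℝ × E) ∈ closure Ω ×ˢ Metric.closedBall (0 : ℝ × E) R :=
    ⟨subset_closure ha, by simpa using hR⟩
  obtain ⟨X, hX, hmin⟩ := hcomp.exists_isMinOn ⟨_, hmem⟩ hcont
  obtain ⟨Y, hY, hmax⟩ := hcomp.exists_isMaxOn ⟨_, hmem⟩ hcont
  have hsub : Ω ×ˢ Metric.closedBall (0 : ℝ × E) R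
      ⊆ closure Ω ×ˢ Metric.closedBall (0 : ℝ × E) R := Set.prod_mono_left subset_closure
  -- The derivative is only controlled over the open set `Ω`, so compactness is replaced by its
  -- Lipschitz bound from one base point.
  obtain ⟨B, hB⟩ : ∃ B, ∀ X ∈ Ω ×ˢ Metric.closedBall (0 : ℝ × E) R, ‖fderiv ℝ f X‖ ≤ B := by
    have hbd : Bornology.IsBounded (Ω ×ˢ Metric.closedBall (0 : ℝ × E) R) :=
      hbdd.prod Metric.isBounded_closedBall
    obtain ⟨B, hB⟩ := hbd.exists_norm_le
    have hmem' : ((a, 0) : E × ℝ × E) ∈ Ω ×ˢ Metric.closedBall (0 : ℝ × E) R :=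
      ⟨ha, by simpa using hR⟩
    refine ⟨‖fderiv ℝ f (a, 0)‖ + L * (B + B), fun X hX => ?_⟩
    have h1 := hL.dist_le_mul X hX _ hmem'
    have h2 : dist X (a, 0) ≤ B + B :=
      (dist_le_norm_add_norm _ _).trans (add_le_add (hB _ hX) (hB _ hmem'))
    have h3 : ‖fderiv ℝ f X‖ ≤ ‖fderiv ℝ f (a, 0)‖ + dist (fderiv ℝ f X) (fderiv ℝ f (a, 0)) := by
      rw [dist_eq_norm]; exact norm_le_insert' _ _
    exact h3.trans (add_le_add_right (h1.trans (mul_le_mul_of_nonneg_left h2 L.2)) _)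
  refine ⟨f X, f Y, B, L, hL, hpos X.1 hX.1 X.2.1 X.2.2, ?_, fun Z hZ => hmin (hsub hZ),
    fun Z hZ => hmax (hsub hZ), hB⟩
  exact (norm_nonneg _).trans (hB (a, 0) ⟨ha, by simpa using hR⟩)

theorem abs_apply_le_of_norm_le {ℓ : E × ℝ × E →L[ℝ] ℝ} {C₁ : ℝ} (h : ‖ℓ‖ ≤ C₁) {v : E × ℝ × E}
    {r : ℝ} (hv : ‖v‖ ≤ r) : |ℓ v| ≤ C₁ * r := by
  have h1 := ℓ.le_of_opNorm_le h v
  rw [Real.norm_eq_abs] at h1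
  exact h1.trans (mul_le_mul_of_nonneg_left hv ((norm_nonneg _).trans h))

theorem norm_triple_le {v p : E} {s r : ℝ} (h1 : ‖v‖ ≤ r) (h2 : |s| ≤ r) (h3 : ‖p‖ ≤ r) :
    ‖((v, s, p) : E × ℝ × E)‖ ≤ r :=
  norm_prod_le_iff.2 ⟨h1, norm_prod_le_iff.2 ⟨h2, h3⟩⟩

variable {b : OrthonormalBasis (Fin n) ℝ (EuclideanSpace ℝ (Fin n))} {lam : Fin n → ℝ} {i₁ : Fin n}
  {R c C C₁ M₁ : ℝ} {L : NNReal}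

/-- Lower bound for the second derivative of the right-hand side, general `f`. -/
theorem rhs_second_derivative_ge (hu : IsDirichletSolution (K + 2) α f Ω u) (hΩ : IsOpen Ω)
    (hf : IsC11 Ω f) (hd : DataBounds Ω f R c C C₁ L) (hx₀ : x₀ ∈ Ω)
    (hR : ‖(u x₀, gradient u x₀)‖ < R) (hM₁ : ‖gradient u x₀‖ ≤ M₁)
    (hb : hessianIn b u x₀ = diagonal lam) (hlam : 0 ≤ lam i₁) :
    ∑ j, fderiv ℝ f (x₀, u x₀, gradient u x₀) (0, 0, b j) * thirdDeriv b (b i₁) u x₀ i₁ j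
      - (C₁ + 2 * L * (1 + M₁) ^ 2 + C₁ ^ 2 * (1 + M₁) ^ 2 / c) * (1 + lam i₁) ^ 2
    ≤ (∑ i, (dirDeriv (b i₁) (dirDeriv (b i₁) (dirDeriv (b i) (dirDeriv (b i) u))) x₀
          * opD K α lam i
        + ∑ j ∈ Finset.univ.erase i, (thirdDeriv b (b i₁) u x₀ i i * thirdDeriv b (b i₁) u x₀ j j
          - thirdDeriv b (b i₁) u x₀ i j * thirdDeriv b (b i₁) u x₀ j i) * opDD K α lam i j))
      - (K + 1) / (K + 2) * (∑ i, thirdDeriv b (b i₁) u x₀ i i * opD K α lam i) ^ 2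
        / esym Finset.univ (K + 2) (withExtra α lam) := by
  have hu4 := hu.contDiffOn
  set ℓ := fderiv ℝ f (x₀, u x₀, gradient u x₀) with hℓ
  set g := dirDeriv (b i₁) u x₀
  have hmem : ((x₀, u x₀, gradient u x₀) : E × ℝ × E) ∈ Ω ×ˢ Metric.closedBall (0 : ℝ × E) R :=
    ⟨hx₀, by simpa using hR.le⟩
  have hℓC : ‖ℓ‖ ≤ C₁ := hd.deriv _ hmem
  have hJ := hu.jet2_equation hΩ hx₀ hb (b i₁)
  have hlin := jet2_linearised hΩ hu4 hx₀ hb i₁ ℓ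
  have hgrad := hasDerivAt_gradient_line hΩ hu4 hx₀ hb i₁
  have hline : HasDerivAt (fun t : ℝ => x₀ + t • b i₁) (b i₁) 0 := by
    simpa using ((hasDerivAt_id (0 : ℝ)).smul_const (b i₁)).const_add x₀
  have huline := (jet2_line hΩ (hu4.of_le (by norm_num)) hx₀ (b i₁)).hasDerivAt
  have hXd := hline.prodMk (huline.prodMk hgrad)
  have h0 : ((x₀ + (0 : ℝ) • b i₁, u (x₀ + (0 : ℝ) • b i₁), gradient u (x₀ + (0 : ℝ) • b i₁)) :
      E × ℝ × E) = (x₀, u x₀, gradient u x₀) := by simp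
  have key := jet2_comp_ge hf hΩ hd.lipschitz (X := fun t : ℝ => (x₀ + t • b i₁,
    u (x₀ + t • b i₁), gradient u (x₀ + t • b i₁))) (by simpa using hx₀) (by simpa using hR) hXd hJ
    (by simp only [h0, ← hℓ]; simpa using hlin)
  -- The same first derivative is computed from the operator and by the chain rule for `f`; hence
  -- the concavity loss is a square of first derivatives of `f`, of order `(1 + λ₁)²`.
  have hH1 : ∑ i, thirdDeriv b (b i₁) u x₀ i i * opD K α lam i = ℓ (b i₁, g, lam i₁ • b i₁) := by
    have h1 := (hf.differentiableAt hΩ (X := (x₀ + (0 : ℝ) • b i₁, u (x₀ + (0 : ℝ) • b i₁),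
      gradient u (x₀ + (0 : ℝ) • b i₁))) (by simpa using hx₀)).hasFDerivAt.comp_hasDerivAt
      (0 : ℝ) hXd
    rw [h0] at h1
    exact hJ.hasDerivAt.unique h1
  have hc : c ≤ esym Finset.univ (K + 2) (withExtra α lam) := by
    rw [← hJ.1]; simpa using hd.lower _ hmem
  have hM0 : 0 ≤ M₁ := (norm_nonneg _).trans hM₁
  have hg : |g| ≤ M₁ := (abs_dirDeriv_le b u x₀ i₁).trans hM₁
  have hr : ‖((b i₁, g, lam i₁ • b i₁) : E × ℝ × E)‖ ≤ (1 + M₁) * (1 + lam i₁) := by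
    have hp := mul_nonneg hM0 hlam
    refine norm_triple_le ?_ ?_ ?_
    · rw [b.norm_eq_one]; nlinarith
    · nlinarith
    · rw [norm_smul, b.norm_eq_one, Real.norm_of_nonneg hlam]; nlinarith
  have hX2 : ‖((b i₁, g, lam i₁ • b i₁) : E × ℝ × E)‖ ^ 2 ≤ (1 + M₁) ^ 2 * (1 + lam i₁) ^ 2 := by
    rw [← mul_pow]; exact pow_le_pow_left₀ (norm_nonneg _) hr 2
  have hz : |ℓ (0, 1, 0)| ≤ C₁ * 1 := abs_apply_le_of_norm_le hℓC (by
    refine norm_triple_le ?_ ?_ ?_ <;> simp)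
  have hq : (ℓ (b i₁, g, lam i₁ • b i₁)) ^ 2 ≤ C₁ ^ 2 * (1 + M₁) ^ 2 * (1 + lam i₁) ^ 2 := by
    have := abs_apply_le_of_norm_le hℓC hr
    rw [← sq_abs]
    calc _ ≤ (C₁ * ((1 + M₁) * (1 + lam i₁))) ^ 2 := pow_le_pow_left₀ (abs_nonneg _) this 2
      _ = _ := by ring
  rw [hH1]
  have hsq : (K + 1) / (K + 2) * (ℓ (b i₁, g, lam i₁ • b i₁)) ^ 2
      / esym Finset.univ (K + 2) (withExtra α lam)
      ≤ C₁ ^ 2 * (1 + M₁) ^ 2 / c * (1 + lam i₁) ^ 2 := by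
    have h1 : ((K : ℝ) + 1) / (K + 2) ≤ 1 := by
      rw [div_le_one (by positivity)]; linarith
    rw [div_mul_eq_mul_div _ c]
    refine div_le_div₀ (by positivity) ?_ hd.pos hc
    refine le_trans (mul_le_of_le_one_left (sq_nonneg _) h1) hq
  have hL := mul_le_mul_of_nonneg_left hX2 L.2
  have hzz : -(C₁ * (1 + lam i₁) ^ 2) ≤ lam i₁ * ℓ (0, 1, 0) := by
    have h1 := (abs_le.1 hz).1
    have h2 := hd.nonneg
    nlinarith [mul_nonneg h2 hlam, mul_nonneg h2 (sq_nonneg (lam i₁))]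
  have key' : lam i₁ * ℓ (0, 1, 0)
      + ∑ j, ℓ (0, 0, b j) * thirdDeriv b (b i₁) u x₀ i₁ j
      - 2 * (L * ‖((b i₁, g, lam i₁ • b i₁) : E × ℝ × E)‖ ^ 2) ≤ _ := key
  have hL' : (L : ℝ) * ‖((b i₁, g, lam i₁ • b i₁) : E × ℝ × E)‖ ^ 2
      ≤ L * ((1 + M₁) ^ 2 * (1 + lam i₁) ^ 2) := hL
  linarith

/-- Lower bound for the second derivative of the right-hand side, `f ^ (1 / k)` convex in `p`. -/
theorem rhs_second_derivative_ge_of_convex (hu : IsDirichletSolution (K + 2) α f Ω u)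
    (hΩ : IsOpen Ω) (hf : IsC11 Ω f)
    (hpos : ∀ x ∈ closure Ω, ∀ (z : ℝ) (p : E), 0 < f (x, z, p))
    (hconv : ∀ x ∈ closure Ω, ∀ z : ℝ,
      ConvexOn ℝ Set.univ (fun p : E => f (x, z, p) ^ (1 / ((K + 2 : ℕ) : ℝ))))
    (hd : DataBounds Ω f R c C C₁ L) (hx₀ : x₀ ∈ Ω)
    (hR : ‖(u x₀, gradient u x₀)‖ < R) (hM₁ : ‖gradient u x₀‖ ≤ M₁)
    (hb : hessianIn b u x₀ = diagonal lam) (hlam : 0 ≤ lam i₁) :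
    ∑ j, fderiv ℝ f (x₀, u x₀, gradient u x₀) (0, 0, b j) * thirdDeriv b (b i₁) u x₀ i₁ j
      - (C₁ + 2 * L * (1 + M₁) ^ 2 + 2 * C₁ ^ 2 * (1 + M₁) ^ 2 / c) * (1 + lam i₁)
    ≤ (∑ i, (dirDeriv (b i₁) (dirDeriv (b i₁) (dirDeriv (b i) (dirDeriv (b i) u))) x₀
          * opD K α lam i
        + ∑ j ∈ Finset.univ.erase i, (thirdDeriv b (b i₁) u x₀ i i * thirdDeriv b (b i₁) u x₀ j j
          - thirdDeriv b (b i₁) u x₀ i j * thirdDeriv b (b i₁) u x₀ j i) * opDD K α lam i j))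
      - (K + 1) / (K + 2) * (∑ i, thirdDeriv b (b i₁) u x₀ i i * opD K α lam i) ^ 2
        / esym Finset.univ (K + 2) (withExtra α lam) := by
  have hu4 := hu.contDiffOn
  set ℓ := fderiv ℝ f (x₀, u x₀, gradient u x₀) with hℓ
  set g := dirDeriv (b i₁) u x₀
  have hmem : ((x₀, u x₀, gradient u x₀) : E × ℝ × E) ∈ Ω ×ˢ Metric.closedBall (0 : ℝ × E) R :=
    ⟨hx₀, by simpa using hR.le⟩
  have hℓC : ‖ℓ‖ ≤ C₁ := hd.deriv _ hmem
  have hJ := hu.jet2_equation hΩ hx₀ hb (b i₁)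
  have hlin := jet2_linearised hΩ hu4 hx₀ hb i₁ ℓ
  have hgrad := hasDerivAt_gradient_line hΩ hu4 hx₀ hb i₁
  have hline : HasDerivAt (fun t : ℝ => x₀ + t • b i₁) (b i₁) 0 := by
    simpa using ((hasDerivAt_id (0 : ℝ)).smul_const (b i₁)).const_add x₀
  have huline := (jet2_line hΩ (hu4.of_le (by norm_num)) hx₀ (b i₁)).hasDerivAt
  have hXd := hline.prodMk (huline.prodMk hgrad)
  have h0 : ((x₀ + (0 : ℝ) • b i₁, u (x₀ + (0 : ℝ) • b i₁), gradient u (x₀ + (0 : ℝ) • b i₁)) :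
      E × ℝ × E) = (x₀, u x₀, gradient u x₀) := by simp
  have key := jet2_comp_ge_of_convex_root hf hΩ hpos (k := K + 2) (by omega) hconv hd.lipschitz
    (x := fun t : ℝ => x₀ + t • b i₁) (z := fun t : ℝ => u (x₀ + t • b i₁))
    (p := fun t : ℝ => gradient u (x₀ + t • b i₁)) (by simpa using hx₀) (by simpa using hR)
    hline huline hgrad hJ (by simp only [h0, ← hℓ]; simpa using hlin)
  simp only [h0, ← hℓ] at key
  have hH1 : ∑ i, thirdDeriv b (b i₁) u x₀ i i * opD K α lam i = ℓ (b i₁, g, lam i₁ • b i₁) := by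
    have h1 := (hf.differentiableAt hΩ (X := (x₀ + (0 : ℝ) • b i₁, u (x₀ + (0 : ℝ) • b i₁),
      gradient u (x₀ + (0 : ℝ) • b i₁))) (by simpa using hx₀)).hasFDerivAt.comp_hasDerivAt
      (0 : ℝ) hXd
    rw [h0] at h1
    exact hJ.hasDerivAt.unique h1
  have hc : c ≤ esym Finset.univ (K + 2) (withExtra α lam) := by
    rw [← hJ.1]; simpa using hd.lower _ hmem
  have hM0 : 0 ≤ M₁ := (norm_nonneg _).trans hM₁
  have hg : |g| ≤ M₁ := (abs_dirDeriv_le b u x₀ i₁).trans hM₁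
  have hC0 := hd.nonneg
  have hlamM := mul_nonneg hM0 hlam
  have hY : ‖((b i₁, g) : E × ℝ)‖ ≤ 1 + M₁ := by
    refine norm_prod_le_iff.2 ⟨?_, ?_⟩
    · rw [b.norm_eq_one]; linarith
    · rw [Real.norm_eq_abs]; linarith
  have hp : ‖lam i₁ • b i₁‖ = lam i₁ := by
    rw [norm_smul, b.norm_eq_one, Real.norm_of_nonneg hlam, mul_one]
  have hz : |ℓ (0, 1, 0)| ≤ C₁ * 1 := abs_apply_le_of_norm_le hℓC (by
    refine norm_triple_le ?_ ?_ ?_ <;> simp)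
  set y := ℓ (b i₁, g, 0) with hy
  set q := ℓ (0, 0, lam i₁ • b i₁) with hq
  have hyq : ℓ (b i₁, g, lam i₁ • b i₁) = y + q := by
    rw [hy, hq, ← map_add]; simp
  have hyb : |y| ≤ C₁ * (1 + M₁) := abs_apply_le_of_norm_le hℓC (by
    refine norm_triple_le ?_ ?_ ?_
    · rw [b.norm_eq_one]; linarith
    · linarith
    · rw [norm_zero]; linarith)
  have hqb : |q| ≤ C₁ * lam i₁ := abs_apply_le_of_norm_le hℓC (by
    refine norm_triple_le ?_ ?_ hp.le <;> simpa using hlam)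
  -- The gain from convexity of `f^{1/k}` is the same multiple of `q²` as the concavity loss is of
  -- `(y + q)²`. The terms quadratic in `λ₁` cancel, leaving linear growth.
  have hdiff : (y + q) ^ 2 - q ^ 2 ≤ 2 * C₁ ^ 2 * (1 + M₁) ^ 2 * (1 + lam i₁) := by
    have h1 : y ^ 2 ≤ (C₁ * (1 + M₁)) ^ 2 := by
      rw [← sq_abs]; exact pow_le_pow_left₀ (abs_nonneg _) hyb 2
    have h2 : y * q ≤ C₁ * (1 + M₁) * (C₁ * lam i₁) := by
      refine (le_abs_self _).trans ?_
      rw [abs_mul]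
      exact mul_le_mul hyb hqb (abs_nonneg _) (by positivity)
    have h3 : 0 ≤ C₁ ^ 2 * (1 + M₁) * M₁ * lam i₁ := by positivity
    have h4 : 0 ≤ C₁ ^ 2 * (1 + M₁) ^ 2 := by positivity
    linarith [show 2 * C₁ ^ 2 * (1 + M₁) ^ 2 * (1 + lam i₁) - (C₁ * (1 + M₁)) ^ 2
      - 2 * (C₁ * (1 + M₁) * (C₁ * lam i₁)) = C₁ ^ 2 * (1 + M₁) ^ 2
        + 2 * (C₁ ^ 2 * (1 + M₁) * M₁ * lam i₁) by ring]
  set H0 := esym Finset.univ (K + 2) (withExtra α lam)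
  have hH0 : 0 < H0 := hd.pos.trans_le hc
  have hsq : (K + 1) / (K + 2) * (y + q) ^ 2 / H0 - (K + 1) / (K + 2) * q ^ 2 / H0
      ≤ 2 * C₁ ^ 2 * (1 + M₁) ^ 2 / c * (1 + lam i₁) := by
    have h1 : ((K : ℝ) + 1) / (K + 2) ≤ 1 := by
      rw [div_le_one (by positivity)]; linarith
    have h2 : (0 : ℝ) ≤ (K + 1) / (K + 2) := by positivity
    have h3 : 0 ≤ 2 * C₁ ^ 2 * (1 + M₁) ^ 2 * (1 + lam i₁) := by positivity
    rw [← sub_div, ← mul_sub, div_mul_eq_mul_div _ c]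
    refine div_le_div₀ h3 ?_ hd.pos hc
    exact (mul_le_mul_of_nonneg_left hdiff h2).trans (mul_le_of_le_one_left h3 h1)
  rw [hH1, hyq]
  have hL : (L : ℝ) * (‖((b i₁, g) : E × ℝ)‖ ^ 2 + ‖((b i₁, g) : E × ℝ)‖ * lam i₁)
      ≤ L * ((1 + M₁) ^ 2 * (1 + lam i₁)) := by
    refine mul_le_mul_of_nonneg_left ?_ L.2
    have h1 := pow_le_pow_left₀ (norm_nonneg _) hY 2
    have h2 := mul_le_mul_of_nonneg_right hY hlam
    have h5 : 0 ≤ M₁ * (M₁ * lam i₁) := mul_nonneg hM0 hlamM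
    linarith [show (1 + M₁) ^ 2 * (1 + lam i₁) = (1 + M₁) ^ 2 + (1 + M₁) * lam i₁
      + M₁ * lam i₁ + M₁ * (M₁ * lam i₁) by ring]
  have hzz : -(C₁ * (1 + lam i₁)) ≤ lam i₁ * ℓ (0, 1, 0) := by
    have h1 := mul_le_mul_of_nonneg_left (abs_le.1 hz).1 hlam
    linarith
  have hK : (((K + 2 : ℕ) : ℝ) - 1) / ((K + 2 : ℕ) : ℝ) = (K + 1) / (K + 2) := by
    push_cast; ring
  rw [hp, hK] at key
  have key' : lam i₁ * ℓ (0, 1, 0)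
      + ∑ j, ℓ (0, 0, b j) * thirdDeriv b (b i₁) u x₀ i₁ j
      - 2 * L * (‖((b i₁, g) : E × ℝ)‖ ^ 2 + ‖((b i₁, g) : E × ℝ)‖ * lam i₁)
      + (K + 1) / (K + 2) * q ^ 2 / H0 ≤ _ := key
  linarith

/-- The equation differentiated once along `b j`, needed for the third derivatives coming from
`|Du|²`. -/
theorem sum_thirdDeriv_mul_opD (hu : IsDirichletSolution (K + 2) α f Ω u) (hΩ : IsOpen Ω)
    (hf : IsC11 Ω f) (hx₀ : x₀ ∈ Ω) (hb : hessianIn b u x₀ = diagonal lam) (j : Fin n) :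
    ∑ i, dirDeriv (b i) (dirDeriv (b i) (dirDeriv (b j) u)) x₀ * opD K α lam i
      = fderiv ℝ f (x₀, u x₀, gradient u x₀) (b j, dirDeriv (b j) u x₀, 0)
        + lam j * fderiv ℝ f (x₀, u x₀, gradient u x₀) (0, 0, b j) := by
  have hu4 := hu.contDiffOn
  have hJ := hu.jet2_equation hΩ hx₀ hb (b j)
  have hgrad := hasDerivAt_gradient_line hΩ hu4 hx₀ hb j
  have hline : HasDerivAt (fun t : ℝ => x₀ + t • b j) (b j) 0 := by
    simpa using ((hasDerivAt_id (0 : ℝ)).smul_const (b j)).const_add x₀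
  have huline := (jet2_line hΩ (hu4.of_le (by norm_num)) hx₀ (b j)).hasDerivAt
  have hXd := hline.prodMk (huline.prodMk hgrad)
  have h1 := (hf.differentiableAt hΩ (X := (x₀ + (0 : ℝ) • b j, u (x₀ + (0 : ℝ) • b j),
    gradient u (x₀ + (0 : ℝ) • b j))) (by simpa using hx₀)).hasFDerivAt.comp_hasDerivAt
    (0 : ℝ) hXd
  have h0 : ((x₀ + (0 : ℝ) • b j, u (x₀ + (0 : ℝ) • b j), gradient u (x₀ + (0 : ℝ) • b j)) :
      E × ℝ × E) = (x₀, u x₀, gradient u x₀) := by simp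
  rw [h0] at h1
  have h2 := hJ.hasDerivAt.unique h1
  have e : ((b j, dirDeriv (b j) u x₀, lam j • b j) : E × ℝ × E)
      = (b j, dirDeriv (b j) u x₀, 0) + lam j • (0, 0, b j) := by simp
  rw [e, map_add, map_smul, smul_eq_mul] at h2
  rw [← h2]
  refine Finset.sum_congr rfl fun i _ => ?_
  rw [← dirDeriv_comm_triple hΩ (hu4.of_le (by norm_num)) hx₀]
  rfl

end

end SumHessian

namespace SumHessian
open Filter Topology Matrix

/-! ### The bound at a maximum point of the test function -/

section
variable {n : ℕ} {Ω : Set (EuclideanSpace ℝ (Fin n))} {u : EuclideanSpace ℝ (Fin n) → ℝ}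
  {x₀ : EuclideanSpace ℝ (Fin n)} {K : ℕ} {α : ℝ}
  {f : EuclideanSpace ℝ (Fin n) × ℝ × EuclideanSpace ℝ (Fin n) → ℝ}

local notation "E" => EuclideanSpace ℝ (Fin n)

/-- In the eigenbasis `b` of `D²u(x₀)`, whose largest eigenvalue is the `i₁`-th, the test function
`log u₁₁ + β log (-u - e) + N |Du|² / 2 + m |x|² / 2` has a local maximum at `x₀` along each
axis. -/
structure IsTestMax (u : EuclideanSpace ℝ (Fin n) → ℝ) (x₀ : EuclideanSpace ℝ (Fin n))
    (b : OrthonormalBasis (Fin n) ℝ (EuclideanSpace ℝ (Fin n))) (i₁ : Fin n)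
    (β N m e : ℝ) : Prop where
  below : 0 < -u x₀ - e
  diag : hessianIn b u x₀ = diagonal (hessianEigenvalues u x₀)
  le_max : ∀ j, hessianEigenvalues u x₀ j ≤ hessianEigenvalues u x₀ i₁
  max_pos : 0 < hessianEigenvalues u x₀ i₁
  localMax : ∀ i, IsLocalMax (fun t : ℝ =>
      Real.log (dirDeriv (b i₁) (dirDeriv (b i₁) u) (x₀ + t • b i))
        + β * Real.log (-u (x₀ + t • b i) - e)
        + N / 2 * ∑ j, dirDeriv (b j) u (x₀ + t • b i) ^ 2
        + m / 2 * ‖x₀ + t • b i‖ ^ 2) 0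

variable {b : OrthonormalBasis (Fin n) ℝ (EuclideanSpace ℝ (Fin n))} {i₁ : Fin n}
  {R c C C₁ M₀ M₁ r : ℝ} {L : NNReal} {β N m e ε θ η κ c₀ Q : ℝ}

theorem IsTestMax.inequality (hmax : IsTestMax u x₀ b i₁ β N m e)
    (hu : IsDirichletSolution (K + 2) α f Ω u) (hΩ : IsOpen Ω) (hα : 0 < α)
    (hf : IsC11 Ω f) (hpos : ∀ x ∈ closure Ω, ∀ (z : ℝ) (p : E), 0 < f (x, z, p))
    (hd : DataBounds Ω f R c C C₁ L) (hx₀ : x₀ ∈ Ω)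
    (hR : ‖(u x₀, gradient u x₀)‖ < R) (hM₁ : ‖gradient u x₀‖ ≤ M₁) (hr : ‖x₀‖ ≤ r)
    (hβ : 1 ≤ β) (hN : 0 < N) (hm : 0 ≤ m) (hη : 0 < η) (hε : 0 < ε) (hε1 : ε < 1)
    (hβθ : 1 + (1 + η) / β ≤ 2 * (1 - θ) / (1 + ε))
    (hNM : 3 * N * M₁ ^ 2 ≤ 1 / 4) (hNM' : 2 * (1 + 1 / η) * N * M₁ ^ 2 ≤ 1 / 4)
    (hmR : 2 * (1 + 1 / η) * m * r ^ 2 ≤ β / 2) (hκ0 : 0 ≤ κ)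
    (hκ : (3 * β ^ 2 + β) * M₁ ^ 2 + 3 * m ^ 2 * r ^ 2 * (-u x₀ - e) ^ 2
      ≤ κ * ((-u x₀ - e) * hessianEigenvalues u x₀ i₁) ^ 2)
    (hc₀ : 1 ≤ c₀) (hc₀ε : 1 ≤ c₀ * ε ^ 2) (hc₀θ : 1 ≤ c₀ * θ)
    (hκN : κ * c₀ * (n + 1) ≤ N / 4)
    (hQ : ∑ j, fderiv ℝ f (x₀, u x₀, gradient u x₀) (0, 0, b j) *
        thirdDeriv b (b i₁) u x₀ i₁ j - Q
      ≤ (∑ i, (dirDeriv (b i₁) (dirDeriv (b i₁) (dirDeriv (b i) (dirDeriv (b i) u))) x₀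
          * opD K α (hessianEigenvalues u x₀) i
        + ∑ j ∈ Finset.univ.erase i, (thirdDeriv b (b i₁) u x₀ i i * thirdDeriv b (b i₁) u x₀ j j
          - thirdDeriv b (b i₁) u x₀ i j * thirdDeriv b (b i₁) u x₀ j i)
            * opDD K α (hessianEigenvalues u x₀) i j))
      - (K + 1) / (K + 2) * (∑ i, thirdDeriv b (b i₁) u x₀ i i
          * opD K α (hessianEigenvalues u x₀) i) ^ 2
        / esym Finset.univ (K + 2) (withExtra α (hessianEigenvalues u x₀))) :
    N / 2 * ∑ i, opD K α (hessianEigenvalues u x₀) i * hessianEigenvalues u x₀ i ^ 2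
      + m / 2 * ∑ i, opD K α (hessianEigenvalues u x₀) i
    ≤ Q / hessianEigenvalues u x₀ i₁
      + (β * ((K + 2) * C) + n * (C₁ * (β * M₁))) / (-u x₀ - e)
      + n * (C₁ * (m * r)) + N * (n * (M₁ * (C₁ * (1 + M₁)))) := by
  have hu4 := hu.contDiffOn
  have hcone := hu.inCone hα hpos hx₀
  obtain ⟨hν, hb, -, hlam₁, hloc⟩ := hmax
  set lam := hessianEigenvalues u x₀
  set ν := -u x₀ - e
  set ℓ := fderiv ℝ f (x₀, u x₀, gradient u x₀)
  have hmem : ((x₀, u x₀, gradient u x₀) : E × ℝ × E) ∈ Ω ×ˢ Metric.closedBall (0 : ℝ × E) R :=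
    ⟨hx₀, by simpa using hR.le⟩
  have hℓC : ‖ℓ‖ ≤ C₁ := hd.deriv _ hmem
  have hcond := fun i => max_conditions hΩ hu4 hx₀ hb hlam₁ hν i (hloc i)
  have hM0 : 0 ≤ M₁ := (norm_nonneg _).trans hM₁
  have hr0 : 0 ≤ r := (norm_nonneg _).trans hr
  have hg : ∀ i, |dirDeriv (b i) u x₀| ≤ M₁ := fun i => (abs_dirDeriv_le b u x₀ i).trans hM₁
  have hx : ∀ i, |inner ℝ x₀ (b i)| ≤ r := fun i => by
    have := abs_real_inner_le_norm x₀ (b i)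
    rw [b.norm_eq_one, mul_one] at this
    exact this.trans hr
  have hsq : ∀ {a s : ℝ}, |a| ≤ s → a ^ 2 ≤ s ^ 2 := fun {a s} h => by
    rw [← sq_abs]; exact pow_le_pow_left₀ (abs_nonneg _) h 2
  have hmain := max_point_inequality (V := Matrix.of fun j i =>
      dirDeriv (b i) (dirDeriv (b i) (dirDeriv (b j) u)) x₀) hα.le hcone hlam₁ hν hβ hN hm hη hε hε1
    (fun i => hsq (hg i)) (fun i => hsq (hx i)) (thirdDeriv_symm hΩ hu4 hx₀ b (b i₁))
    (fun i => (hcond i).1) (fun i => (hcond i).2) hβθ hNM hNM' hmR hκ0 hκ hc₀ hc₀ε hc₀θ hκN rfl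
  simp only [Matrix.of_apply, sum_thirdDeriv_mul_opD hu hΩ hf hx₀ hb] at hmain
  -- The uncontrolled terms `f_{p_j} u_11j / λ₁` and `N u_j λ_j f_{p_j}` cancel through the first
  -- order condition, up to terms bounded by a constant times `1 + 1/ν`.
  have hcomb : (∑ j, ℓ (0, 0, b j) * thirdDeriv b (b i₁) u x₀ i₁ j) / lam i₁
      + N * ∑ j, dirDeriv (b j) u x₀ * (ℓ (b j, dirDeriv (b j) u x₀, 0) + lam j * ℓ (0, 0, b j))
      = (∑ j, ℓ (0, 0, b j) * (β * dirDeriv (b j) u x₀)) / ν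
        - ∑ j, ℓ (0, 0, b j) * (m * inner ℝ x₀ (b j))
        + N * ∑ j, dirDeriv (b j) u x₀ * ℓ (b j, dirDeriv (b j) u x₀, 0) := by
    rw [Finset.sum_div, Finset.mul_sum, Finset.sum_div, Finset.mul_sum, ← Finset.sum_add_distrib,
      ← Finset.sum_sub_distrib, ← Finset.sum_add_distrib]
    refine Finset.sum_congr rfl fun j _ => ?_
    have h1 := (hcond j).1
    have h2 : thirdDeriv b (b i₁) u x₀ i₁ j / lam i₁ = β * dirDeriv (b j) u x₀ / ν
        - N * dirDeriv (b j) u x₀ * lam j - m * inner ℝ x₀ (b j) := by linarith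
    rw [mul_div_assoc, h2]
    ring
  have hℓj : ∀ j, |ℓ (0, 0, b j)| ≤ C₁ := fun j => by
    have := abs_apply_le_of_norm_le hℓC (v := (0, 0, b j)) (r := 1)
      (norm_triple_le (by simp) (by simp) (b.norm_eq_one j).le)
    simpa using this
  have hsumle : ∀ (a : Fin n → ℝ) (s : ℝ), (∀ j, |a j| ≤ s) → -(n * s) ≤ ∑ j, a j := by
    intro a s ha
    have h1 : ∑ _j : Fin n, -s ≤ ∑ j, a j := Finset.sum_le_sum fun j _ => (abs_le.1 (ha j)).1
    simpa using h1
  have hC0 := hd.nonneg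
  have e1 : -(n * (C₁ * (β * M₁))) / ν ≤ (∑ j, ℓ (0, 0, b j) * (β * dirDeriv (b j) u x₀)) / ν := by
    refine div_le_div_of_nonneg_right (hsumle _ _ fun j => ?_) hν.le
    rw [abs_mul, abs_mul, abs_of_nonneg (by linarith : 0 ≤ β)]
    exact mul_le_mul (hℓj j) (mul_le_mul_of_nonneg_left (hg j) (by linarith)) (by positivity) hC0
  have e2 : -(n * (C₁ * (m * r))) ≤ -∑ j, ℓ (0, 0, b j) * (m * inner ℝ x₀ (b j)) := by
    rw [← Finset.sum_neg_distrib]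
    refine hsumle _ _ fun j => ?_
    rw [abs_neg, abs_mul, abs_mul, abs_of_nonneg hm]
    exact mul_le_mul (hℓj j) (mul_le_mul_of_nonneg_left (hx j) hm) (by positivity) hC0
  have e3 : N * -(n * (M₁ * (C₁ * (1 + M₁))))
      ≤ N * ∑ j, dirDeriv (b j) u x₀ * ℓ (b j, dirDeriv (b j) u x₀, 0) := by
    refine mul_le_mul_of_nonneg_left (hsumle _ _ fun j => ?_) hN.le
    rw [abs_mul]
    refine mul_le_mul (hg j) (abs_apply_le_of_norm_le hℓC ?_) (abs_nonneg _) hM0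
    refine norm_triple_le ?_ ?_ ?_
    · rw [b.norm_eq_one]; linarith
    · linarith [hg j]
    · rw [norm_zero]; linarith
  have e4 : β * ((K + 2) * esym Finset.univ (K + 2) (withExtra α lam)) / ν
      ≤ β * ((K + 2) * C) / ν := by
    have : esym Finset.univ (K + 2) (withExtra α lam) ≤ C := by
      rw [hu.equation_esym hx₀]; exact hd.upper _ hmem
    gcongr
  have e5 := div_le_div_of_nonneg_right hQ hlam₁.le
  rw [sub_div] at e5
  rw [neg_div] at e1
  rw [add_div]
  linarith

/-- At a maximum point, either the eigenvalue is bounded or the weighted eigenvalue is. -/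
def MaxPointBound (k : ℕ) (α : ℝ)
    (f : EuclideanSpace ℝ (Fin n) × ℝ × EuclideanSpace ℝ (Fin n) → ℝ)
    (Ω : Set (EuclideanSpace ℝ (Fin n))) (M₀ M₁ β N m : ℝ) : Prop :=
  ∃ B : ℝ, ∀ u : EuclideanSpace ℝ (Fin n) → ℝ, IsDirichletSolution k α f Ω u →
    (∀ x ∈ Ω, |u x| ≤ M₀) → (∀ x ∈ Ω, ‖gradient u x‖ ≤ M₁) → ∀ x₀ ∈ Ω, ∀ b i₁, ∀ e > (0 : ℝ),
      IsTestMax u x₀ b i₁ β N m e →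
        (-u x₀ - e) * hessianEigenvalues u x₀ i₁ ≤ B ∨ hessianEigenvalues u x₀ i₁ ≤ B

/-- The trace is `(n - K - 1) σ_{K+1}(λ, α) + α σ_K(λ)`. It dominates `λ₁` because a first symmetric
function appears in it: `σ_1(λ, α)` when `K = 0`, where `n ≥ 2` makes its coefficient positive, and
`α σ_1(λ)` when `K = 1`. -/
theorem opD_sum_ge (hα : 0 < α) {lam : Fin n → ℝ}
    (h : InCone Finset.univ (K + 2) (withExtra α lam)) (hK : K = 0 ∧ 2 ≤ n ∨ K = 1) (i₁ : Fin n) :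
    min 1 α * max (lam i₁) 0 ≤ ∑ i, opD K α lam i := by
  have hsum := sum_esym_erase (Finset.univ : Finset (Option (Fin n))) (K + 1) (withExtra α lam)
  rw [Fintype.sum_option, Finset.card_univ, Fintype.card_option, Fintype.card_fin] at hsum
  have he := esym_erase (Finset.mem_univ (none : Option (Fin n))) K (withExtra α lam)
  rw [withExtra_none] at he
  have e : ∑ i, opD K α lam i = ((n : ℝ) - (K + 1)) * esym Finset.univ (K + 1) (withExtra α lam)
      + α * esym (Finset.univ.erase none) K (withExtra α lam) := by
    have e1 : ∑ i, opD K α lam i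
      = ∑ i, esym (Finset.univ.erase (some i)) (K + 1) (withExtra α lam) := rfl
    rw [e1]
    push_cast at hsum
    linarith
  rw [e]
  rcases hK with ⟨rfl, hn⟩ | rfl
  · have h1 := h.le_esym_one (Finset.mem_univ (some i₁))
    have h2 := h 1 (by omega)
    rw [withExtra_some] at h1
    have h3 : max (lam i₁) 0 ≤ esym Finset.univ 1 (withExtra α lam) := max_le h1.le h2.le
    have h4 : (2 : ℝ) ≤ n := by exact_mod_cast hn
    have h5 : min 1 α * max (lam i₁) 0 ≤ max (lam i₁) 0 :=
      mul_le_of_le_one_left (le_max_right _ _) (min_le_left _ _)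
    simp only [CharP.cast_eq_zero, zero_add, esym_zero, mul_one]
    nlinarith
  · have hc := h.erase (Finset.mem_univ none)
    have h1 := hc.le_esym_one (i := some i₁) (by simp)
    rw [withExtra_some] at h1
    have h2 := hc 1 (by omega)
    have h3 : max (lam i₁) 0 ≤ esym (Finset.univ.erase none) 1 (withExtra α lam) :=
      max_le h1.le h2.le
    have hn : (2 : ℝ) ≤ n := by
      by_contra! hn
      have hn' : n < 2 := by exact_mod_cast hn
      refine (hc 2 le_rfl).ne' (esym_eq_zero_of_card_lt ?_ _)
      rw [Finset.card_erase_of_mem (Finset.mem_univ _), Finset.card_univ, Fintype.card_option,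
        Fintype.card_fin]
      omega
    have h4 := h 2 (by omega)
    have h5 : min 1 α * max (lam i₁) 0 ≤ α * max (lam i₁) 0 :=
      mul_le_mul_of_nonneg_right (min_le_right _ _) (le_max_right _ _)
    have h6 := mul_le_mul_of_nonneg_left h3 hα.le
    have h7 : 0 ≤ ((n : ℝ) - 2) * esym Finset.univ 2 (withExtra α lam) :=
      mul_nonneg (by linarith) h4.le
    push_cast
    norm_num
    linarith

/-- The condition `α ≤ λ₁` makes `λ₁` the largest of all `n + 1` entries, so `λ₁ F₁` is bounded
below by a multiple of `σ_{K+2}`. -/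
theorem opD_mul_sq_ge (hα : 0 ≤ α) {lam : Fin n → ℝ}
    (h : InCone Finset.univ (K + 2) (withExtra α lam)) (hmax : ∀ j, lam j ≤ lam i₁)
    (hαl : α ≤ lam i₁) :
    (K + 2) / (n + 1) * esym Finset.univ (K + 2) (withExtra α lam) * lam i₁
      ≤ ∑ i, opD K α lam i * lam i ^ 2 := by
  have h1 := h.mul_esym_erase_ge (Finset.mem_univ (some i₁)) (by
    rintro (- | j) -
    · simpa using hαl
    · simpa using hmax j)
  rw [withExtra_some, Finset.card_univ, Fintype.card_option, Fintype.card_fin] at h1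
  have h2 : opD K α lam i₁ * lam i₁ ^ 2 ≤ ∑ i, opD K α lam i * lam i ^ 2 :=
    Finset.single_le_sum (f := fun i => opD K α lam i * lam i ^ 2)
      (fun i _ => mul_nonneg (opD_pos h i).le (sq_nonneg _)) (Finset.mem_univ i₁)
  refine le_trans ?_ h2
  have h3 := mul_le_mul_of_nonneg_right h1 (hα.trans hαl)
  push_cast at h3
  rw [div_mul_eq_mul_div, div_mul_eq_mul_div, div_le_iff₀ (by positivity)]
  have e : opD K α lam i₁ = esym (Finset.univ.erase (some i₁)) (K + 1) (withExtra α lam) := rfl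
  rw [e]
  linarith

theorem norm_pair_lt {M₀ M₁ : ℝ} {x : E} (h0 : |u x| ≤ M₀) (h1 : ‖gradient u x‖ ≤ M₁) :
    ‖(u x, gradient u x)‖ < |M₀| + |M₁| + 1 := by
  rw [Prod.norm_def]
  refine max_lt ?_ ?_
  · rw [Real.norm_eq_abs]; linarith [le_abs_self M₀, abs_nonneg M₁]
  · linarith [le_abs_self M₁, abs_nonneg M₀]

/-- A choice of the auxiliary constants. -/
theorem exists_constants (n : ℕ) {η ε θ : ℝ} (hη : 0 < η) (hε : 0 < ε) (hθ : 0 < θ) (M₁ : ℝ) :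
    ∃ N κ c₀ : ℝ, 0 < N ∧ 3 * N * M₁ ^ 2 ≤ 1 / 4 ∧ 2 * (1 + 1 / η) * N * M₁ ^ 2 ≤ 1 / 4 ∧
      0 < κ ∧ 1 ≤ c₀ ∧ 1 ≤ c₀ * ε ^ 2 ∧ 1 ≤ c₀ * θ ∧ κ * c₀ * (n + 1) ≤ N / 4 := by
  have hA : 0 < 16 * (1 + 1 / η) * (1 + M₁ ^ 2) := by positivity
  set A := 16 * (1 + 1 / η) * (1 + M₁ ^ 2) with hAdef
  have hη1 : 0 < 1 / η := by positivity
  set c₀ := 1 + 1 / ε ^ 2 + 1 / θ with hc₀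
  have h1 : 0 < 1 / ε ^ 2 := by positivity
  have h2 : 0 < 1 / θ := by positivity
  have hc0 : 0 < c₀ := by positivity
  -- The value of `κ` makes the last requirement an equality; none of these constants involves `β`
  -- or `m`.
  refine ⟨1 / A, 1 / A / (4 * c₀ * (n + 1)), c₀, by positivity, ?_, ?_, by positivity,
    by linarith, ?_, ?_, le_of_eq (by field_simp)⟩
  · rw [mul_one_div, div_mul_eq_mul_div, div_le_iff₀ hA, hAdef]
    nlinarith [sq_nonneg M₁, mul_nonneg hη1.le (sq_nonneg M₁)]
  · rw [mul_one_div, div_mul_eq_mul_div, div_le_iff₀ hA, hAdef]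
    nlinarith [sq_nonneg M₁, mul_nonneg hη1.le (sq_nonneg M₁)]
  · have : 1 / ε ^ 2 * ε ^ 2 = 1 := by field_simp
    have h3 : 0 ≤ (1 + 1 / θ) * ε ^ 2 := by positivity
    rw [hc₀]; nlinarith
  · have : 1 / θ * θ = 1 := by field_simp
    have h3 : 0 ≤ (1 + 1 / ε ^ 2) * θ := by positivity
    rw [hc₀]; nlinarith

theorem le_mul_sq_of_threshold {S κ y : ℝ} (hS : 0 ≤ S) (hκ : 0 < κ) (hy : 1 + S / κ ≤ y) :
    S ≤ κ * y ^ 2 := by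
  have h1 : 0 ≤ S / κ := by positivity
  have h2 : S = κ * (S / κ) := by field_simp
  rw [h2]
  exact mul_le_mul_of_nonneg_left (by nlinarith) hκ.le

theorem mul_le_of_le_div_add {ν l w P T M : ℝ} (hw : 0 < w) (hν : 0 < ν) (hνM : ν ≤ M)
    (hT : 0 ≤ T) (h : w * l ≤ P / ν + T) : ν * l ≤ (P + T * M) / w := by
  rw [le_div_iff₀ hw]
  have h4 := mul_le_mul_of_nonneg_left h hν.le
  have h5 : ν * (P / ν + T) = P + T * ν := by field_simp
  have h6 : T * ν ≤ T * M := mul_le_mul_of_nonneg_left hνM hT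
  linarith

-- Here `m = 0`. The right-hand side costs a bounded amount after division by `λ₁`, so `F₁ λ₁² ≥ c
-- λ₁` alone gives `w λ₁ ≤ P/ν + const`, which is multiplied by `ν`.
set_option maxHeartbeats 1000000 in
theorem maxPointBound_of_convex (hΩ : IsOpen Ω) (hne : Ω.Nonempty)
    (hbdd : Bornology.IsBounded Ω) (hα : 0 < α) (hf : IsC11 Ω f)
    (hpos : ∀ x ∈ closure Ω, ∀ (z : ℝ) (p : E), 0 < f (x, z, p))
    (hconv : ∀ x ∈ closure Ω, ∀ z : ℝ,
      ConvexOn ℝ Set.univ (fun p : E => f (x, z, p) ^ (1 / ((K + 2 : ℕ) : ℝ))))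
    (M₀ M₁ : ℝ) {δ : ℝ} (hδ : 0 < δ) :
    ∃ N, 0 < N ∧ MaxPointBound (K + 2) α f Ω M₀ M₁ (1 + δ) N 0 := by
  obtain ⟨s, hs0, hs1, hs⟩ : ∃ s : ℝ, 0 < s ∧ s < 1 ∧
      1 + (1 + s) / (1 + δ) ≤ 2 * (1 - s) / (1 + s) := by
    have h1 : 0 < 1 + δ := by linarith
    -- With this `s`, `1/(1+δ) = 1 - 5s`, and after clearing `1 + s` the inequality holds with
    -- margin `9s² + 5s³`.
    refine ⟨δ / (5 * (1 + δ)), by positivity, ?_, ?_⟩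
    · rw [div_lt_one (by positivity)]; linarith
    · set s := δ / (5 * (1 + δ)) with hs
      have h2 : 0 < s := by positivity
      have h3 : δ = 5 * s * (1 + δ) := by rw [hs]; field_simp
      rw [le_div_iff₀ (by linarith)]
      have h4 : (1 + s) / (1 + δ) = (1 + s) * (1 - 5 * s) := by
        rw [div_eq_iff h1.ne']; linear_combination (-(1 + s)) * h3
      rw [h4]
      nlinarith [mul_pos h2 h2, mul_pos (mul_pos h2 h2) h2]
  obtain ⟨N, κ, c₀, hN, hN1, hN2, hκ, hc1, hc2, hc3, hκN⟩ := exists_constants n hs0 hs0 hs0 M₁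
  refine ⟨N, hN, ?_⟩
  obtain ⟨c, C, C₁, L, hd⟩ := hf.exists_dataBounds hne hbdd hpos (R := |M₀| + |M₁| + 1)
    (by positivity)
  obtain ⟨r, hr⟩ := hbdd.exists_norm_le
  set S := (3 * (1 + δ) ^ 2 + (1 + δ)) * M₁ ^ 2 with hSdef
  have hS0 : 0 ≤ S := by positivity
  set CQ := C₁ + 2 * L * (1 + M₁) ^ 2 + 2 * C₁ ^ 2 * (1 + M₁) ^ 2 / c with hCQ
  set P := (1 + δ) * ((K + 2) * C) + n * (C₁ * ((1 + δ) * M₁)) with hP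
  set T := N * (n * (M₁ * (C₁ * (1 + M₁)))) with hT
  set w := N / 2 * ((K + 2) / (n + 1) * c) with hw
  have hwpos : 0 < w := by have := hd.pos; positivity
  refine ⟨max (max (1 + S / κ) (max 1 α)) ((P + (2 * CQ + T) * M₀) / w), ?_⟩
  intro u hu hu0 hu1 x₀ hx₀ b i₁ e he hmax
  set lam := hessianEigenvalues u x₀
  set ν := -u x₀ - e with hν
  -- Below either threshold the conclusion is immediate, as both are built into the bound; above
  -- them the absorption arguments apply.
  rcases le_or_gt (lam i₁) (max 1 α) with hl | hl
  · exact Or.inr (hl.trans ((le_max_right _ _).trans (le_max_left _ _)))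
  left
  rcases le_or_gt (ν * lam i₁) (1 + S / κ) with hy | hy
  · exact hy.trans ((le_max_left _ _).trans (le_max_left _ _))
  refine le_trans ?_ (le_max_right _ _)
  have hl1 : 1 < lam i₁ := (le_max_left _ _).trans_lt hl
  have hlα : α < lam i₁ := (le_max_right _ _).trans_lt hl
  have hMu := hu1 x₀ hx₀
  have hM1 : 0 ≤ M₁ := (norm_nonneg _).trans hMu
  have hC0 := hd.nonneg
  have hc0 := hd.pos
  have hR := norm_pair_lt (hu0 x₀ hx₀) hMu
  have hQ := rhs_second_derivative_ge_of_convex hu hΩ hf hpos hconv hd hx₀ hR hMu hmax.diag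
    hmax.max_pos.le
  have hm : 2 * (1 + 1 / s) * 0 * r ^ 2 ≤ (1 + δ) / 2 := by
    rw [mul_zero, zero_mul]; positivity
  have hκ' : (3 * (1 + δ) ^ 2 + (1 + δ)) * M₁ ^ 2 + 3 * 0 ^ 2 * r ^ 2 * ν ^ 2
      ≤ κ * (ν * lam i₁) ^ 2 :=
    le_trans (le_of_eq (by rw [hSdef]; ring)) (le_mul_sq_of_threshold hS0 hκ hy.le)
  have hmain := hmax.inequality (r := r) hu hΩ hα hf hpos hd hx₀ hR hMu (hr _ hx₀)
    (by linarith only [hδ]) hN le_rfl hs0 hs0 hs1 hs hN1 hN2 hm hκ.le hκ' hc1 hc2 hc3 hκN hQ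
  have hFl := opD_mul_sq_ge hα.le (hu.inCone hα hpos hx₀) hmax.le_max hlα.le
  have hνpos := hmax.below
  have hmem : ((x₀, u x₀, gradient u x₀) : E × ℝ × E)
      ∈ Ω ×ˢ Metric.closedBall (0 : ℝ × E) (|M₀| + |M₁| + 1) := ⟨hx₀, by simpa using hR.le⟩
  have hcl : c ≤ esym Finset.univ (K + 2) (withExtra α lam) := by
    rw [hu.equation_esym hx₀]; exact hd.lower _ hmem
  have h1 : w * lam i₁ ≤ N / 2 * ∑ i, opD K α lam i * lam i ^ 2 := by
    rw [hw, mul_assoc]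
    refine mul_le_mul_of_nonneg_left (le_trans ?_ hFl) (by positivity)
    gcongr
  have hCQ0 : 0 ≤ CQ := by positivity
  have h2 : CQ * (1 + lam i₁) / lam i₁ ≤ 2 * CQ := by
    rw [div_le_iff₀ (one_pos.trans hl1)]
    linarith only [mul_le_mul_of_nonneg_left hl1.le hCQ0]
  have h3 : w * lam i₁ ≤ 2 * CQ + P / ν + T := by
    rw [zero_div, zero_mul, add_zero, zero_mul, mul_zero, mul_zero, add_zero] at hmain
    linarith only [hmain, h1, h2]
  have hνM : ν ≤ M₀ := by
    have := (abs_le.1 (hu0 x₀ hx₀)).1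
    rw [hν]; linarith only [this, he]
  have hT0 : 0 ≤ T := by positivity
  exact mul_le_of_le_div_add hwpos hνpos hνM (by positivity)
    (h3.trans (le_of_eq (by ring)))

-- The right-hand side costs up to `4 CQ λ₁`. The trace term pays for this and leaves one further
-- `λ₁` if `m` is large; `β` must then be large relative to `m`.
set_option maxHeartbeats 1000000 in
theorem maxPointBound_of_trace (hΩ : IsOpen Ω) (hne : Ω.Nonempty)
    (hbdd : Bornology.IsBounded Ω) (hα : 0 < α) (hf : IsC11 Ω f)
    (hpos : ∀ x ∈ closure Ω, ∀ (z : ℝ) (p : E), 0 < f (x, z, p))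
    (hK : K = 0 ∧ 2 ≤ n ∨ K = 1) (M₀ M₁ : ℝ) :
    ∃ β N m, 1 ≤ β ∧ 0 < N ∧ 0 ≤ m ∧ MaxPointBound (K + 2) α f Ω M₀ M₁ β N m := by
  obtain ⟨N, κ, c₀, hN, hN1, hN2, hκ, hc1, hc2, hc3, hκN⟩ :=
    exists_constants n (η := 1) (ε := 1 / 8) (θ := 1 / 8) one_pos (by norm_num) (by norm_num) M₁
  obtain ⟨c, C, C₁, L, hd⟩ := hf.exists_dataBounds hne hbdd hpos (R := |M₀| + |M₁| + 1)
    (by positivity)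
  obtain ⟨r, hr⟩ := hbdd.exists_norm_le
  have hC0 := hd.nonneg
  have hc0 := hd.pos
  set CQ := C₁ + 2 * L * (1 + M₁) ^ 2 + C₁ ^ 2 * (1 + M₁) ^ 2 / c with hCQ
  have hCQ0 : 0 ≤ CQ := by positivity
  have hmin : 0 < min 1 α := lt_min one_pos hα
  -- This gives `(m/2) Σ F_i ≥ (4 CQ + 1) λ₁`.
  set m := 2 * (4 * CQ + 1) / min 1 α with hm
  have hm0 : 0 ≤ m := by positivity
  have hmα : m * min 1 α = 2 * (4 * CQ + 1) := div_mul_cancel₀ _ hmin.ne'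
  -- The part `8 m r²` meets the smallness of `m r²` against `β`; the `8` ensures `1 + 2/β ≤ 5/4 ≤
  -- 14/9`.
  set β := 8 + 8 * m * r ^ 2 with hβ
  have hβ8 : 8 ≤ β := by
    have : 0 ≤ 8 * m * r ^ 2 := by positivity
    linarith
  have hmR : 2 * (1 + 1 / 1) * m * r ^ 2 ≤ β / 2 := by
    rw [hβ]; linarith only []
  have hβθ : 1 + (1 + 1) / β ≤ 2 * (1 - 1 / 8) / (1 + 1 / 8) := by
    have : (1 + 1) / β ≤ 1 / 4 := by
      rw [div_le_iff₀ (by linarith only [hβ8])]; linarith only [hβ8]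
    norm_num at this ⊢
    linarith only [this]
  refine ⟨β, N, m, by linarith only [hβ8], hN, hm0, ?_⟩
  set S := (3 * β ^ 2 + β) * M₁ ^ 2 + 3 * m ^ 2 * r ^ 2 * M₀ ^ 2 with hSdef
  have hS0 : 0 ≤ S := by positivity
  set P := β * ((K + 2) * C) + n * (C₁ * (β * M₁)) with hP
  set T := n * (C₁ * (m * r)) + N * (n * (M₁ * (C₁ * (1 + M₁)))) with hT
  refine ⟨max (max (1 + S / κ) 1) (P + T * M₀), ?_⟩
  intro u hu hu0 hu1 x₀ hx₀ b i₁ e he hmax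
  set lam := hessianEigenvalues u x₀
  set ν := -u x₀ - e with hν
  rcases le_or_gt (lam i₁) 1 with hl | hl
  · exact Or.inr (hl.trans ((le_max_right _ _).trans (le_max_left _ _)))
  left
  rcases le_or_gt (ν * lam i₁) (1 + S / κ) with hy | hy
  · exact hy.trans ((le_max_left _ _).trans (le_max_left _ _))
  refine le_trans ?_ (le_max_right _ _)
  have hMu := hu1 x₀ hx₀
  have hM1 : 0 ≤ M₁ := (norm_nonneg _).trans hMu
  have hr0 : 0 ≤ r := (norm_nonneg _).trans (hr _ hx₀)
  have hR := norm_pair_lt (hu0 x₀ hx₀) hMu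
  have hνpos := hmax.below
  have hνM : ν ≤ M₀ := by
    have := (abs_le.1 (hu0 x₀ hx₀)).1
    rw [hν]; linarith
  have hQ := rhs_second_derivative_ge hu hΩ hf hd hx₀ hR hMu hmax.diag hmax.max_pos.le
  have hκ' : (3 * β ^ 2 + β) * M₁ ^ 2 + 3 * m ^ 2 * r ^ 2 * ν ^ 2 ≤ κ * (ν * lam i₁) ^ 2 := by
    refine le_trans ?_ (le_mul_sq_of_threshold hS0 hκ hy.le)
    have h1 : ν ^ 2 ≤ M₀ ^ 2 := pow_le_pow_left₀ hνpos.le hνM 2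
    have h2 : 0 ≤ 3 * m ^ 2 * r ^ 2 := by positivity
    linarith only [mul_le_mul_of_nonneg_left h1 h2, hSdef]
  have hmain := hmax.inequality (r := r) hu hΩ hα hf hpos hd hx₀ hR hMu (hr _ hx₀)
    (by linarith only [hβ8]) hN hm0 one_pos (by norm_num only) (by norm_num only) hβθ hN1 hN2
    hmR hκ.le hκ' hc1 hc2 hc3 hκN hQ
  have htr := opD_sum_ge hα (hu.inCone hα hpos hx₀) hK i₁
  have hcone := hu.inCone hα hpos hx₀
  have h0 : 0 ≤ N / 2 * ∑ i, opD K α lam i * lam i ^ 2 :=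
    mul_nonneg (by positivity) (Finset.sum_nonneg fun i _ =>
      mul_nonneg (opD_pos hcone i).le (sq_nonneg _))
  have h1 : (4 * CQ + 1) * lam i₁ ≤ m / 2 * ∑ i, opD K α lam i := by
    have e : (4 * CQ + 1) * lam i₁ = m / 2 * (min 1 α * lam i₁) := by
      linear_combination (-(lam i₁) / 2) * hmα
    rw [e]
    refine mul_le_mul_of_nonneg_left (le_trans ?_ htr) (by positivity)
    exact mul_le_mul_of_nonneg_left (le_max_left _ _) hmin.le
  have h2 : CQ * (1 + lam i₁) ^ 2 / lam i₁ ≤ 4 * CQ * lam i₁ := by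
    rw [div_le_iff₀ (one_pos.trans hl)]
    have : (1 + lam i₁) ^ 2 ≤ 4 * lam i₁ ^ 2 := by nlinarith only [hl]
    linarith only [mul_le_mul_of_nonneg_left this hCQ0]
  have h3 : 1 * lam i₁ ≤ P / ν + T := by
    rw [hT]
    linarith only [hmain, h0, h1, h2]
  have hT0 : 0 ≤ T := by positivity
  have := mul_le_of_le_div_add one_pos hνpos hνM hT0 h3
  rwa [div_one] at this

end

end SumHessian

namespace SumHessian
open Filter Topology Matrix
open scoped Laplacian

/-! ### The test function attains its maximum, and the estimate -/

section
variable {n : ℕ} {Ω : Set (EuclideanSpace ℝ (Fin n))} {u : EuclideanSpace ℝ (Fin n) → ℝ}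
  {K : ℕ} {α : ℝ}
  {f : EuclideanSpace ℝ (Fin n) × ℝ × EuclideanSpace ℝ (Fin n) → ℝ}

local notation "E" => EuclideanSpace ℝ (Fin n)

theorem IsDirichletSolution.sum_eigenvalues_pos (hu : IsDirichletSolution (K + 2) α f Ω u)
    {x : E} (hx : x ∈ Ω) : 0 < ∑ i, hessianEigenvalues u x i := by
  have h := hu.convex.2 x hx 1 le_rfl (by omega)
  rwa [sigma_eq_esym, esym_one] at h

theorem IsDirichletSolution.neg (hu : IsDirichletSolution (K + 2) α f Ω u) (hΩ : IsOpen Ω)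
    (hbdd : Bornology.IsBounded Ω) {x : E} (hx : x ∈ Ω) : u x < 0 := by
  by_contra! h
  obtain ⟨_, hlip⟩ := hu.lipschitz
  obtain ⟨y, hy, hmax⟩ := hbdd.isCompact_closure.exists_isMaxOn ⟨x, subset_closure hx⟩
    hlip.continuousOn
  -- A maximum on the boundary has value `0 ≤ u x`, so `x` itself is then an interior maximum. There
  -- all eigenvalues are nonpositive, against a positive trace.
  obtain ⟨z, hz, hzmax⟩ : ∃ z ∈ Ω, ∀ w ∈ Ω, u w ≤ u z := by
    by_cases hyΩ : y ∈ Ω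
    · exact ⟨y, hyΩ, fun w hw => hmax (subset_closure hw)⟩
    · have h0 : u y = 0 := hu.boundary y ⟨hy, by rwa [hΩ.interior_eq]⟩
      exact ⟨x, hx, fun w hw => (hmax (subset_closure hw)).trans (h0.trans_le h)⟩
  have hu2 := hu.convex.1
  obtain ⟨b, hb⟩ := exists_eigenbasis hΩ hu2 hz
  refine (hu.sum_eigenvalues_pos hz).not_ge (Finset.sum_nonpos fun i _ => ?_)
  have hi := congrFun (congrFun hb i) i
  rw [hessianIn_apply, diagonal_apply_eq] at hi
  rw [← hi]
  refine ((jet2_line hΩ hu2 hz (b i)).of_isLocalMax ?_).2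
  filter_upwards [eventually_line_mem hΩ hz (b i)] with t ht
  simpa using hzmax _ ht

theorem fderiv_fderiv_le (hΩ : IsOpen Ω) (hu : ContDiffOn ℝ 2 u Ω) {x : E} (hx : x ∈ Ω)
    {b : OrthonormalBasis (Fin n) ℝ E} {lam : Fin n → ℝ} (hb : hessianIn b u x = diagonal lam)
    {i₁ : Fin n} (hmax : ∀ j, lam j ≤ lam i₁) (ξ : E) :
    fderiv ℝ (fderiv ℝ u) x ξ ξ ≤ lam i₁ * ‖ξ‖ ^ 2 := by
  have hij : ∀ i j, fderiv ℝ (fderiv ℝ u) x (b i) (b j) = diagonal lam i j := fun i j => by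
    rw [← dirDeriv_dirDeriv hΩ hu hx, ← hessianIn_apply, hb]
  have e : fderiv ℝ (fderiv ℝ u) x ξ ξ = ∑ i, lam i * inner ℝ (b i) ξ ^ 2 := by
    conv_lhs => rw [← b.sum_repr' ξ]
    simp only [map_sum, map_smul, _root_.sum_apply, _root_.smul_apply, smul_eq_mul, hij,
      diagonal_apply, mul_ite, mul_zero, Finset.sum_ite_eq', Finset.mem_univ,
      if_true]
    exact Finset.sum_congr rfl fun i _ => by ring
  rw [e, ← b.sum_sq_norm_inner_right, Finset.mul_sum]
  refine Finset.sum_le_sum fun i _ => ?_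
  rw [Real.norm_eq_abs, sq_abs]
  exact mul_le_mul_of_nonneg_right (hmax i) (sq_nonneg _)

/-- The factor of the second derivative in the exponentiated test function. -/
noncomputable def testWeight (u : EuclideanSpace ℝ (Fin n) → ℝ) (β N m e : ℝ)
    (y : EuclideanSpace ℝ (Fin n)) : ℝ :=
  (-u y - e) ^ β * Real.exp (N / 2 * ‖gradient u y‖ ^ 2 + m / 2 * ‖y‖ ^ 2)

variable {β N m e : ℝ}

theorem testWeight_pos {y : E} (hy : 0 < -u y - e) : 0 < testWeight u β N m e y :=
  mul_pos (Real.rpow_pos_of_pos hy _) (Real.exp_pos _)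

theorem log_testWeight_mul {y : E} (hy : 0 < -u y - e) {D : ℝ} (hD : 0 < D) :
    Real.log (testWeight u β N m e y * D) = Real.log D + β * Real.log (-u y - e)
      + N / 2 * ‖gradient u y‖ ^ 2 + m / 2 * ‖y‖ ^ 2 := by
  rw [Real.log_mul (testWeight_pos hy).ne' hD.ne', testWeight,
    Real.log_mul (Real.rpow_pos_of_pos hy _).ne' (Real.exp_pos _).ne', Real.log_rpow hy,
    Real.log_exp]
  ring

/-- The exponentiated test function is maximised jointly in the point and a unit direction: it is
continuous even where `u_ξξ ≤ 0`. The level `e > 0` keeps the compact set inside `Ω`, since nothing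
is known about `D²u` at the boundary. -/
theorem IsDirichletSolution.exists_isTestMax (hu : IsDirichletSolution (K + 2) α f Ω u)
    (hΩ : IsOpen Ω) (hbdd : Bornology.IsBounded Ω) (hβ : 0 < β) (N m : ℝ) (he : 0 < e)
    {x : E} (hx : x ∈ Ω) (hex : e < -u x) :
    ∃ x₀ ∈ Ω, ∃ b i₁, IsTestMax u x₀ b i₁ β N m e ∧ ∀ j,
      testWeight u β N m e x * hessianEigenvalues u x j
        ≤ testWeight u β N m e x₀ * hessianEigenvalues u x₀ i₁ := by
  have hu2 := hu.convex.1
  obtain ⟨_, hlip⟩ := hu.lipschitz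
  set S := closure Ω ∩ u ⁻¹' Set.Iic (-e) with hS
  have hScl : IsClosed S := hlip.continuousOn.preimage_isClosed_of_isClosed isClosed_closure
    isClosed_Iic
  have hScomp : IsCompact S := hbdd.isCompact_closure.of_isClosed_subset hScl Set.inter_subset_left
  have hSΩ : S ⊆ Ω := by
    intro y hy
    by_contra hyΩ
    have h0 : u y = 0 := hu.boundary y ⟨hy.1, by rwa [hΩ.interior_eq]⟩
    have h1 : u y ≤ -e := hy.2
    linarith
  have hd1 : ContDiffOn ℝ 1 (fderiv ℝ u) Ω := hu2.fderiv_of_isOpen hΩ (by norm_num)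
  have hd2 : ContinuousOn (fderiv ℝ (fderiv ℝ u)) Ω :=
    hd1.continuousOn_fderiv_of_isOpen hΩ le_rfl
  have hgrad : ContinuousOn (gradient u) Ω :=
    (InnerProductSpace.toDual ℝ E).symm.continuous.comp_continuousOn hd1.continuousOn
  have hw : ContinuousOn (testWeight u β N m e) Ω := by
    refine ContinuousOn.mul ?_ ?_
    · exact ((hu2.continuousOn.neg).sub continuousOn_const).rpow_const fun _ _ => Or.inr hβ.le
    · have := hgrad.norm
      fun_prop
  have hΦ : ContinuousOn (fun q : E × E => testWeight u β N m e q.1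
      * fderiv ℝ (fderiv ℝ u) q.1 q.2 q.2) (S ×ˢ Metric.sphere 0 1) := by
    have hfst : Set.MapsTo Prod.fst (S ×ˢ Metric.sphere (0 : E) 1) Ω := fun q hq => hSΩ hq.1
    refine (hw.comp continuousOn_fst hfst).mul ?_
    exact ((hd2.comp continuousOn_fst hfst).clm_apply continuousOn_snd).clm_apply continuousOn_snd
  obtain ⟨b', hb'⟩ := exists_eigenbasis hΩ hu2 hx
  obtain ⟨j₀, hj₀⟩ : ∃ j, 0 < hessianEigenvalues u x j := by
    by_contra! h
    exact (hu.sum_eigenvalues_pos hx).not_ge (Finset.sum_nonpos fun j _ => h j)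
  have hmem : ∀ j, (x, b' j) ∈ S ×ˢ Metric.sphere (0 : E) 1 := fun j =>
    ⟨⟨subset_closure hx, by simp only [Set.mem_preimage, Set.mem_Iic]; linarith⟩,
      by simp [b'.norm_eq_one]⟩
  obtain ⟨⟨x₀, ξ⟩, ⟨hx₀S, hξ⟩, hmax⟩ := (hScomp.prod (isCompact_sphere (0 : E) 1)).exists_isMaxOn
    ⟨_, hmem j₀⟩ hΦ
  have hξ1 : ‖ξ‖ = 1 := by simpa using hξ
  have hx₀ := hSΩ hx₀S
  have hxj : ∀ j, testWeight u β N m e x * hessianEigenvalues u x j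
      ≤ testWeight u β N m e x₀ * fderiv ℝ (fderiv ℝ u) x₀ ξ ξ := fun j => by
    have h1 := hmax (hmem j)
    have h2 := congrFun (congrFun hb' j) j
    rw [hessianIn_apply, diagonal_apply_eq, dirDeriv_dirDeriv hΩ hu2 hx] at h2
    rw [← h2]
    exact h1
  have hpos : 0 < testWeight u β N m e x₀ * fderiv ℝ (fderiv ℝ u) x₀ ξ ξ :=
    (mul_pos (testWeight_pos (by linarith)) hj₀).trans_le (hxj j₀)
  have hx₀e : 0 ≤ -u x₀ - e := by
    have : u x₀ ≤ -e := hx₀S.2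
    linarith
  -- On the level set `-u = e` the weight vanishes because `β > 0`, but the maximum is positive.
  have hν : 0 < -u x₀ - e := by
    refine hx₀e.lt_of_ne fun h0 => hpos.ne' ?_
    rw [testWeight, ← h0, Real.zero_rpow hβ.ne', zero_mul, zero_mul]
  have hw₀ : 0 < testWeight u β N m e x₀ := testWeight_pos hν
  obtain ⟨b, hb⟩ := exists_eigenbasis hΩ hu2 hx₀
  have : Nonempty (Fin n) := ⟨j₀⟩
  obtain ⟨i₁, hi₁⟩ := Finite.exists_max (hessianEigenvalues u x₀)
  have hξi : testWeight u β N m e x₀ * fderiv ℝ (fderiv ℝ u) x₀ ξ ξ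
      ≤ testWeight u β N m e x₀ * hessianEigenvalues u x₀ i₁ := by
    have := fderiv_fderiv_le hΩ hu2 hx₀ hb hi₁ ξ
    rw [hξ1, one_pow, mul_one] at this
    exact mul_le_mul_of_nonneg_left this hw₀.le
  have hlam : 0 < hessianEigenvalues u x₀ i₁ :=
    pos_of_mul_pos_right (hpos.trans_le hξi) hw₀.le
  have hD₀ : dirDeriv (b i₁) (dirDeriv (b i₁) u) x₀ = hessianEigenvalues u x₀ i₁ := by
    rw [← hessianIn_apply, hb, diagonal_apply_eq]
  refine ⟨x₀, hx₀, b, i₁, ⟨hν, hb, hi₁, hlam, fun i => ?_⟩, fun j => (hxj j).trans hξi⟩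
  have hu4 := hu.contDiffOn
  have hDc : ContinuousOn (dirDeriv (b i₁) (dirDeriv (b i₁) u)) Ω :=
    (contDiffOn_dirDeriv (m := 2) hΩ (contDiffOn_dirDeriv (m := 3) hΩ hu4 _) _).continuousOn
  have hline : Tendsto (fun t : ℝ => x₀ + t • b i) (𝓝 0) (𝓝 x₀) := by
    have h : ContinuousAt (fun t : ℝ => x₀ + t • b i) 0 := by fun_prop
    simpa [ContinuousAt] using h
  have ev1 : ∀ᶠ y in 𝓝 x₀, 0 < -u y - e :=
    (((hu2.continuousOn.continuousAt (hΩ.mem_nhds hx₀)).neg).sub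
      continuousAt_const).eventually (lt_mem_nhds hν)
  have ev2 : ∀ᶠ y in 𝓝 x₀, 0 < dirDeriv (b i₁) (dirDeriv (b i₁) u) y :=
    (hDc.continuousAt (hΩ.mem_nhds hx₀)).eventually (lt_mem_nhds (by rwa [hD₀]))
  filter_upwards [hline.eventually ev1, hline.eventually ev2, eventually_line_mem hΩ hx₀ (b i)]
    with t h1 h2 h3
  simp only [sum_sq_dirDeriv, zero_smul, add_zero]
  rw [← log_testWeight_mul h1 h2, ← log_testWeight_mul hν (by rwa [hD₀])]
  refine Real.log_le_log (mul_pos (testWeight_pos h1) h2) ?_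
  rw [hD₀, dirDeriv_dirDeriv hΩ hu2 h3]
  refine le_trans ?_ hξi
  -- The direction `b i₁` is frozen while the point moves, so only a fixed second derivative, not an
  -- eigenvalue, is differentiated later.
  exact hmax (a := (x₀ + t • b i, b i₁)) ⟨⟨subset_closure h3, by
    simp only [Set.mem_preimage, Set.mem_Iic]; linarith⟩, by simp [b.norm_eq_one]⟩

theorem rpow_mul_le_of_le_or_le {ν l B M : ℝ} (hβ : 1 ≤ β) (hν : 0 < ν) (hνM : ν ≤ M)
    (h : ν * l ≤ B ∨ l ≤ B) : ν ^ β * l ≤ (M ^ (β - 1) + M ^ β) * |B| := by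
  have hM : 0 < M := hν.trans_le hνM
  have h1 : ν ^ (β - 1) ≤ M ^ (β - 1) := Real.rpow_le_rpow hν.le hνM (by linarith)
  have h2 : ν ^ β ≤ M ^ β := Real.rpow_le_rpow hν.le hνM (by linarith)
  have h3 : 0 ≤ M ^ (β - 1) * |B| := by positivity
  have h4 : 0 ≤ M ^ β * |B| := by positivity
  have hB := le_abs_self B
  rw [add_mul]
  rcases h with h | h
  · have e : ν ^ β * l = ν ^ (β - 1) * (ν * l) := by
      rw [← mul_assoc, ← Real.rpow_add_one hν.ne', sub_add_cancel]
    have := mul_le_mul h1 le_rfl (abs_nonneg B) (by positivity)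
    have := mul_le_mul_of_nonneg_left (h.trans hB) (Real.rpow_nonneg hν.le (β - 1))
    linarith
  · have := mul_le_mul h2 le_rfl (abs_nonneg B) (by positivity)
    have := mul_le_mul_of_nonneg_left (h.trans hB) (Real.rpow_nonneg hν.le β)
    linarith

/-- The bound at the maximum point carries over to every eigenvalue at `x`, because the exponential
factor is at least `1` at `x` and bounded at the maximum. Summing over eigenvalues and letting `e`
tend to `0` gives the estimate. -/
theorem MaxPointBound.pogorelov {M₀ M₁ : ℝ} (hmp : MaxPointBound (K + 2) α f Ω M₀ M₁ β N m)
    (hΩ : IsOpen Ω) (hbdd : Bornology.IsBounded Ω) (hβ : 1 ≤ β) (hN : 0 ≤ N) (hm : 0 ≤ m) :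
    ∃ C > (0 : ℝ), ∀ u : E → ℝ, IsDirichletSolution (K + 2) α f Ω u →
      (∀ x ∈ Ω, |u x| ≤ M₀) → (∀ x ∈ Ω, ‖gradient u x‖ ≤ M₁) →
      ∀ x ∈ Ω, (-u x) ^ β * Δ u x ≤ C := by
  obtain ⟨B, hB⟩ := hmp
  obtain ⟨r, hr⟩ := hbdd.exists_norm_le
  set D := (|M₀| ^ (β - 1) + |M₀| ^ β) * |B| * Real.exp (N / 2 * M₁ ^ 2 + m / 2 * r ^ 2) with hD
  have hD0 : 0 ≤ D := by positivity
  refine ⟨n * D + 1, by positivity, fun u hu hu0 hu1 x hx => ?_⟩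
  have hneg := hu.neg hΩ hbdd hx
  have hΔ := hu.sum_eigenvalues_pos hx
  rw [laplacian_eq_sum_eigenvalues hΩ hu.convex.1 hx]
  have hlevel : ∀ e ∈ Set.Ioo 0 (-u x),
      (-u x - e) ^ β * ∑ i, hessianEigenvalues u x i ≤ n * D + 1 := by
    rintro e ⟨he, hex⟩
    obtain ⟨x₀, hx₀, b, i₁, hT, hle⟩ :=
      hu.exists_isTestMax hΩ hbdd (by linarith : 0 < β) N m he hx hex
    have hνM : -u x₀ - e ≤ |M₀| := by
      linarith [neg_abs_le (u x₀), hu0 x₀ hx₀, le_abs_self M₀]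
    have h1 := rpow_mul_le_of_le_or_le hβ hT.below hνM (hB u hu hu0 hu1 x₀ hx₀ b i₁ e he hT)
    have h2 : Real.exp (N / 2 * ‖gradient u x₀‖ ^ 2 + m / 2 * ‖x₀‖ ^ 2)
        ≤ Real.exp (N / 2 * M₁ ^ 2 + m / 2 * r ^ 2) := by
      have := hu1 x₀ hx₀
      have := hr x₀ hx₀
      gcongr
    have h3 : testWeight u β N m e x₀ * hessianEigenvalues u x₀ i₁ ≤ D := by
      rw [testWeight, mul_right_comm, hD]
      refine mul_le_mul h1 h2 (Real.exp_pos _).le (by positivity)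
    have h4 : (-u x - e) ^ β ≤ testWeight u β N m e x :=
      le_mul_of_one_le_right (Real.rpow_nonneg (by linarith) _)
        (Real.one_le_exp (by positivity))
    have h5 := mul_le_mul_of_nonneg_right h4 hΔ.le
    have h6 : testWeight u β N m e x * ∑ i, hessianEigenvalues u x i ≤ n * D := by
      rw [Finset.mul_sum]
      have := Finset.sum_le_sum fun i (_ : i ∈ Finset.univ) => (hle i).trans h3
      simpa using this
    linarith
  have hlim : Tendsto (fun e : ℝ => (-u x - e) ^ β * ∑ i, hessianEigenvalues u x i) (𝓝[>] 0)
      (𝓝 ((-u x) ^ β * ∑ i, hessianEigenvalues u x i)) := by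
    have hc : Continuous fun e : ℝ => (-u x - e) ^ β * ∑ i, hessianEigenvalues u x i :=
      ((continuous_const.sub continuous_id).rpow_const fun _ => Or.inr (by linarith)).mul
        continuous_const
    simpa using (hc.tendsto 0).mono_left nhdsWithin_le_nhds
  refine le_of_tendsto hlim ?_
  filter_upwards [Ioo_mem_nhdsGT (by linarith : 0 < -u x)] with e he using hlevel e he

/-- In dimension at most one, the equation with `k = 2` reads `α Δu = f`. -/
theorem laplacian_bound_of_dim_lt_two (hn : n < 2) (hΩ : IsOpen Ω) (hne : Ω.Nonempty)
    (hbdd : Bornology.IsBounded Ω) (hα : 0 < α) (hf : IsC11 Ω f)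
    (hpos : ∀ x ∈ closure Ω, ∀ (z : ℝ) (p : E), 0 < f (x, z, p)) (M₀ M₁ : ℝ) :
    ∃ C > (0 : ℝ), ∀ u : E → ℝ, IsDirichletSolution 2 α f Ω u →
      (∀ x ∈ Ω, |u x| ≤ M₀) → (∀ x ∈ Ω, ‖gradient u x‖ ≤ M₁) →
      ∀ x ∈ Ω, (-u x) ^ (1 : ℝ) * Δ u x ≤ C := by
  obtain ⟨c, C, C₁, L, hd⟩ := hf.exists_dataBounds hne hbdd hpos (R := |M₀| + |M₁| + 1)
    (by positivity)
  refine ⟨|M₀| * (|C| / α) + 1, by positivity, fun u hu hu0 hu1 x hx => ?_⟩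
  have hR := norm_pair_lt (hu0 x hx) (hu1 x hx)
  have hup : f (x, u x, gradient u x) ≤ C := hd.upper _ ⟨hx, by simpa using hR.le⟩
  have hΔ := hu.sum_eigenvalues_pos (K := 0) hx
  have heq := hu.equation x hx
  rw [sigma_eq_esym, sigma_eq_esym, esym_one,
    esym_eq_zero_of_card_lt (by simpa using hn), zero_add] at heq
  rw [laplacian_eq_sum_eigenvalues hΩ hu.convex.1 hx, Real.rpow_one]
  have h1 : ∑ i, hessianEigenvalues u x i ≤ |C| / α := by
    rw [le_div_iff₀ hα]; linarith [le_abs_self C]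
  have h2 : -u x ≤ |M₀| := by linarith [neg_abs_le (u x), hu0 x hx, le_abs_self M₀]
  have h3 := mul_le_mul h2 h1 hΔ.le (abs_nonneg _)
  linarith

end

end SumHessian

/-! ### Proof of the theorem -/

open SumHessian in
open scoped Laplacian in
theorem theorem1p1 {n : ℕ} (Ω : Set (EuclideanSpace ℝ (Fin n)))
    (hΩ_open : IsOpen Ω) (hΩ_conn : IsConnected Ω) (hΩ_bdd : Bornology.IsBounded Ω)
    (α : ℝ) (hα : 0 < α)
    (f : EuclideanSpace ℝ (Fin n) × ℝ × EuclideanSpace ℝ (Fin n) → ℝ)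
    (hf : IsC11 Ω f)
    (hf_pos : ∀ x ∈ closure Ω, ∀ (z : ℝ) (p : EuclideanSpace ℝ (Fin n)), 0 < f (x, z, p))
    -- bounds for `sup |u|` and `sup |Du|`
    (M₀ M₁ : ℝ) :
    (∀ k : ℕ, k = 2 ∨ k = 3 →
      ∃ β > (0 : ℝ), ∃ C > (0 : ℝ), ∀ u : EuclideanSpace ℝ (Fin n) → ℝ,
        IsDirichletSolution k α f Ω u →
        (∀ x ∈ Ω, |u x| ≤ M₀) → (∀ x ∈ Ω, ‖gradient u x‖ ≤ M₁) →
        ∀ x ∈ Ω, (-u x) ^ β * Δ u x ≤ C) ∧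
    (∀ k : ℕ, 1 < k → k ≤ n →
      (∀ x ∈ closure Ω, ∀ z : ℝ,
        ConvexOn ℝ Set.univ
          (fun p : EuclideanSpace ℝ (Fin n) => f (x, z, p) ^ (1 / (k : ℝ)))) →
      ∀ δ > (0 : ℝ), ∃ C > (0 : ℝ), ∀ u : EuclideanSpace ℝ (Fin n) → ℝ,
        IsDirichletSolution k α f Ω u →
        (∀ x ∈ Ω, |u x| ≤ M₀) → (∀ x ∈ Ω, ‖gradient u x‖ ≤ M₁) →
        ∀ x ∈ Ω, (-u x) ^ (1 + δ) * Δ u x ≤ C) := by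
  refine ⟨fun k hk => ?_, fun k hk1 _ hconv δ hδ => ?_⟩
  · have htrace : ∀ K : ℕ, (K = 0 ∧ 2 ≤ n ∨ K = 1) →
        ∃ β > (0 : ℝ), ∃ C > (0 : ℝ), ∀ u : EuclideanSpace ℝ (Fin n) → ℝ,
          IsDirichletSolution (K + 2) α f Ω u →
          (∀ x ∈ Ω, |u x| ≤ M₀) → (∀ x ∈ Ω, ‖gradient u x‖ ≤ M₁) →
          ∀ x ∈ Ω, (-u x) ^ β * Δ u x ≤ C := by
      intro K hK
      obtain ⟨β, N, m, hβ, hN, hm, hmp⟩ := maxPointBound_of_trace hΩ_open hΩ_conn.nonempty hΩ_bdd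
        hα hf hf_pos hK M₀ M₁
      exact ⟨β, by linarith, hmp.pogorelov hΩ_open hΩ_bdd hβ hN.le hm⟩
    rcases hk with rfl | rfl
    -- For `k = 2` and `n < 2` the trace `Σ F_i` does not grow with `λ₁`, so that case is read off
    -- from the equation. For `k = 3` no such case arises: the cone condition already forces `n ≥
    -- 2`.
    · rcases le_or_gt 2 n with hn | hn
      · exact htrace 0 (Or.inl ⟨rfl, hn⟩)
      · exact ⟨1, one_pos, laplacian_bound_of_dim_lt_two hn hΩ_open hΩ_conn.nonempty hΩ_bdd hα hf
          hf_pos M₀ M₁⟩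
    · exact htrace 1 (Or.inr rfl)
  · obtain ⟨K, rfl⟩ : ∃ K, k = K + 2 := ⟨k - 2, by omega⟩
    obtain ⟨N, hN, hmp⟩ := maxPointBound_of_convex hΩ_open hΩ_conn.nonempty hΩ_bdd hα hf hf_pos
      hconv M₀ M₁ hδ
    exact hmp.pogorelov hΩ_open hΩ_bdd (by linarith) hN.le le_rfl
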